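/- **Setting.** Let $1<\gamma<3$, $A>0$, $\rho_0>0$; put $c^2(\rho)=A\gamma\rho^{\gamma-1}$, $h(\rho)=c^2(\rho)/(\gamma-1)$. Points are $(t,x)\in\mathbb R\times\mathbb R^3$, $r=|x|$, $\omega=x/|x|$, $\nabla=(\partial_t,\nabla_x)$, $Z_1=x_1\partial_2-x_2\partial_1$, $Z_2=x_2\partial_3-x_3\partial_2$, $Z_3=x_3\partial_1-x_1\partial_3$; functions of $(t,\omega)$ are also regarded as functions of $(t,x)$ through $\omega=x/|x|$. *Background solution.* For $b_0>0$ let $s_0>b_0$ and $(\hat\rho,\hat u)(s)$, $\hat\rho>0$, solve $$\hat\rho'=\frac{2(s-\hat u)\hat\rho\hat u}{s((s-\hat u)^2-c^2(\hat\rho))},\qquad \hat u'=\frac{2c^2(\hat\rho)\hat u}{s((s-\hat u)^2-c^2(\hat\rho))}$$ on $(b_0-\tau_0,s_0+\tau_0)$ for some $0<\tau_0\le b_0^{-4/(\gamma-1)}(s_0-b_0)$, with non-vanishing factor $(s-\hat u)^2-c^2(\hat\rho)$, and with $\hat u(b_0)=b_0$; at $s_0$: $s_0(\hat\rho-\rho_0)=\hat\rho\hat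 u$, $s_0\hat u=\frac12\hat u^2+h(\hat\rho)-h(\rho_0)$, $\hat u-c(\hat\rho)<s_0<\hat u+c(\hat\rho)$, $c(\rho_0)<s_0$. Put $\hat\varphi(s)=\int_{s_0}^s\hat u$, $\hat\Phi(t,x)=t\hat\varphi(r/t)$, and, with all functions taken at $s_0$, $Q=\frac12\hat u^2-h(\hat\rho)+h(\rho_0)$, $$B_1=2\hat\rho\hat u-\frac{\hat\rho\hat u}{c^2(\hat\rho)}Q,\qquad B_2=\hat\rho-\rho_0-\frac{\hat\rho}{c^2(\hat\rho)}Q,\qquad \mathcal B_0=\partial_r+\frac{B_2}{B_1}\partial_t .$$ *Piston.* Let $\varepsilon>0$, $\sigma(t,\omega)=tb(t,\omega)$ with $b$ smooth and $|\partial_t^{k_0}Z^k(b-b_0)|\le K_{k_0,k}\,\varepsilon(1+t)^{-k_0}$ for all $k_0$ and all multi-indices $k$ ($t>0$). Put $\mathcal B_\sigma g=\partial_rg-r^{-2}\sum_{i=1}^3Z_i\sigma\,Z_ig$. Let $f_a$ be the smooth solution in $\{t>0,\ r\ge\sigma\}$ of $$\mathcal B_\sigma f_a=\frac{\partial_t\sigma-\hat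 u(\sigma/t)}{t\,\hat\varphi(\sigma/t)},\qquad f_a=0\ \text{ on } r=\sigma,$$ and $\Phi_a=(1+f_a)\hat\Phi$. *Shock solution.* For $T_0>1$ let $\zeta>\sigma$ be $C^2$ on $[1,T_0]\times\mathbb S^2$ and let $\Phi$ be $C^2$ up to the boundary of $D=\{1\le t\le T_0,\ \sigma\le r\le\zeta\}$ such that, with $\rho=h^{-1}(h(\rho_0)-\partial_t\Phi-\frac12|\nabla_x\Phi|^2)$, $$\partial_t^2\Phi+2\sum_k\partial_k\Phi\,\partial_{tk}^2\Phi+\sum_{i,j}\partial_i\Phi\,\partial_j\Phi\,\partial_{ij}^2\Phi-c^2(\rho)\Delta\Phi=0\ \text{ in } D,\qquad \mathcal B_\sigma\Phi=\partial_t\sigma\ \text{ on } r=\sigma,$$ $$\rho\,\partial_r\Phi-(\rho-\rho_0)\partial_t\zeta=\frac{\rho}{r^2}\sum_iZ_i\zeta\, Z_i\Phi\quad\text{and}\quad \Phi=0\qquad\text{on } r=\zeta .$$ Put $\dot\varphi=\Phi-\Phi_a$, $\xi=\zeta/t-s_0$. Assume that $|\dot\varphi|+|\xi|\le K_0\varepsilon$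 at $t=1$ in $D$, and that $$|\xi|+\sum_{l=0}^1t^l\bigl(|\nabla^{l+1}\dot\varphi|+|\nabla^{l+1}\xi|\bigr)\le M\varepsilon\quad\text{in } D .$$ Write $\int_{\Gamma_{T_0}}g\,dS=\int_{\mathbb S^2}\int_1^{T_0}g(t,\zeta(t,\omega)\omega)\,dt\,d\omega$. **Lemma 5.2 (improved Hardy-type inequality on the shock surface).** There are $b_*>0$ and $C_*>0$, depending only on the gas $(\gamma,A,\rho_0)$, such that for every $b_0\ge b_*$ there is a constant $C$, depending only on $b_0$, the gas and the constants $K_{k_0,k},K_0$ (not on $M$, $\varepsilon$, $T_0$, $\mu$ or the solution), with the following property. For every background solution and every $M>0$ there is $\varepsilon_0>0$ such that, whenever $0<\varepsilon<\varepsilon_0$, in the above setting one has for every $\mu<-1-\frac12\sqrt{\frac{\gamma+7}2}$ $$\begin{aligned}\int_{\Gamma_{T_0}}t^{\mu-1}|\dot\varphi|^2dS\le{}& C\varepsilon^2+\frac1{\mu^2}\Bigl(1+C_*\bigl(b_0^{-\frac2{\gamma-1}}+b_0^{-2}\bigr)\Bigr)\int_{\Gamma_{T_0}}t^{\mu+1}(\partial_t\dot\varphi)^2dS\\&+C\varepsilon\Bigl(\int_{\Gamma_{T_0}}t^{\mu+1}(\mathcal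 B_0\dot\varphi)^2dS+\int_{\Gamma_{T_0}}t^{\mu+1}\frac1{r^2}\sum_{k=1}^3(Z_k\dot\varphi)^2dS\Bigr).\end{aligned}$$ -/

import Mathlib

open MeasureTheory Set
open scoped ContDiff

noncomputable section

/-- Physical space `ℝ³` with its Euclidean norm. Space-time points are `p = (t, x) : ℝ × E3`. -/
abbrev E3 : Type := EuclideanSpace ℝ (Fin 3)

/-! ### Differential operators -/

/-- `∂_t`. -/
def dt (f : ℝ × E3 → ℝ) (p : ℝ × E3) : ℝ := fderiv ℝ f p (1, 0)

/-- `∂_i`, the derivative with respect to the Cartesian coordinate `x_i`. -/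
def dx (i : Fin 3) (f : ℝ × E3 → ℝ) (p : ℝ × E3) : ℝ :=
  fderiv ℝ f p (0, EuclideanSpace.single i 1)

/-- The radial derivative `∂_r`, where `r = |x|`. -/
def dr (f : ℝ × E3 → ℝ) (p : ℝ × E3) : ℝ := fderiv ℝ f p (0, ‖p.2‖⁻¹ • p.2)

/-- The rotation fields `x₁∂₂ - x₂∂₁`, `x₂∂₃ - x₃∂₂`, `x₃∂₁ - x₁∂₃`, as vectors at `x`
(coordinates are numbered `0, 1, 2` in the code). -/
def rotVec (i : Fin 3) (x : E3) : E3 :=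
  match i with
  | 0 => !₂[-x 1, x 0, 0]
  | 1 => !₂[0, -x 2, x 1]
  | 2 => !₂[x 2, 0, -x 0]

/-- The rotation derivative `Z_i f`. -/
def dZ (i : Fin 3) (f : ℝ × E3 → ℝ) (p : ℝ × E3) : ℝ := fderiv ℝ f p (0, rotVec i p.2)

/-- A function `g (t, ω)` of time and of the direction `ω ∈ S²`, regarded as the function
`(t, x) ↦ g (t, x / |x|)`. Only the values of `g t` on the unit sphere matter. -/
def onRays (g : ℝ → E3 → ℝ) (p : ℝ × E3) : ℝ := g p.1 (‖p.2‖⁻¹ • p.2)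

/-! ### The gas -/

/-- A polytropic gas `P = A ρ ^ γ` with `1 < γ < 3`, at rest with density `ρ₀` ahead of the shock. -/
structure Gas where
  γ : ℝ
  A : ℝ
  ρ₀ : ℝ
  one_lt_γ : 1 < γ
  γ_lt_three : γ < 3
  A_pos : 0 < A
  ρ₀_pos : 0 < ρ₀

namespace Gas

/-- `c²(ρ) = P'(ρ)`, the square of the sound speed. -/
def soundSq (G : Gas) (ρ : ℝ) : ℝ := G.A * G.γ * ρ ^ (G.γ - 1)

/-- The sound speed `c(ρ)`. -/
def sound (G : Gas) (ρ : ℝ) : ℝ := Real.sqrt (G.soundSq ρ)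

/-- The specific enthalpy `h(ρ) = c²(ρ) / (γ - 1)`. -/
def enthalpy (G : Gas) (ρ : ℝ) : ℝ := G.soundSq ρ / (G.γ - 1)

/-- The inverse function `h⁻¹` of the enthalpy. -/
def enthalpyInv (G : Gas) (q : ℝ) : ℝ := ((G.γ - 1) * q / (G.A * G.γ)) ^ (1 / (G.γ - 1))

theorem enthalpy_enthalpyInv (G : Gas) {q : ℝ} (hq : 0 ≤ q) :
    G.enthalpy (G.enthalpyInv q) = q := by
  have h1 : 0 < G.γ - 1 := sub_pos.2 G.one_lt_γ
  have h2 : 0 < G.γ := by linarith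
  have h3 := G.A_pos
  unfold enthalpy enthalpyInv soundSq
  rw [← Real.rpow_mul (by positivity), one_div, inv_mul_cancel₀ h1.ne', Real.rpow_one]
  field_simp

/-- The density `H(∇Φ) = h⁻¹(B₀ - ∂_t Φ - |∇ₓΦ|² / 2)` given by Bernoulli's law, `B₀ = h(ρ₀)`. -/
def density (G : Gas) (Φ : ℝ × E3 → ℝ) (p : ℝ × E3) : ℝ :=
  G.enthalpyInv (G.enthalpy G.ρ₀ - dt Φ p - (∑ i, dx i Φ p ^ 2) / 2)

end Gas

/-! ### The self-similar background solution -/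

/-- The self-similar flow `ρ = ρ(s)`, velocity `u(s) x / |x|`, `s = |x| / t`, behind the shock
`|x| = s₀ t` that is driven by the ball `|x| ≤ b₀ t` (in space dimension 3), extended as a solution
of the same system to the slightly larger interval `(b₀ - τ, s₀ + τ)`. -/
structure Background (G : Gas) (b₀ : ℝ) where
  s₀ : ℝ
  τ : ℝ
  ρ : ℝ → ℝ
  u : ℝ → ℝ
  b₀_lt_s₀ : b₀ < s₀
  τ_pos : 0 < τ
  τ_le : τ ≤ b₀ ^ (-4 / (G.γ - 1)) * (s₀ - b₀)
  ρ_pos : ∀ s ∈ Ioo (b₀ - τ) (s₀ + τ), 0 < ρ s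
  /-- the denominator in the system does not vanish -/
  denom_ne : ∀ s ∈ Ioo (b₀ - τ) (s₀ + τ), (s - u s) ^ 2 - G.soundSq (ρ s) ≠ 0
  ode_ρ : ∀ s ∈ Ioo (b₀ - τ) (s₀ + τ),
    HasDerivAt ρ (2 * (s - u s) * ρ s * u s / (s * ((s - u s) ^ 2 - G.soundSq (ρ s)))) s
  ode_u : ∀ s ∈ Ioo (b₀ - τ) (s₀ + τ),
    HasDerivAt u (2 * G.soundSq (ρ s) * u s / (s * ((s - u s) ^ 2 - G.soundSq (ρ s)))) s
  /-- Rankine-Hugoniot conditions -/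
  rh_mass : s₀ * (ρ s₀ - G.ρ₀) - ρ s₀ * u s₀ = 0
  rh_energy : s₀ * u s₀ - (u s₀ ^ 2 / 2 + G.enthalpy (ρ s₀) - G.enthalpy G.ρ₀) = 0
  /-- Lax entropy conditions -/
  lax_left : u s₀ - G.sound (ρ s₀) < s₀
  lax_right : s₀ < u s₀ + G.sound (ρ s₀)
  lax_ahead : G.sound G.ρ₀ < s₀
  /-- the gas does not penetrate the piston -/
  wall : u b₀ = b₀

namespace Background

variable {G : Gas} {b₀ : ℝ}

/-- The profile of the background potential: `φ̂' = û`, `φ̂(s₀) = 0`. -/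
def profile (bg : Background G b₀) (s : ℝ) : ℝ := ∫ y in bg.s₀..s, bg.u y

/-- The background potential `Φ̂(t, x) = t φ̂(|x| / t)`. -/
def potential (bg : Background G b₀) (p : ℝ × E3) : ℝ := p.1 * bg.profile (‖p.2‖ / p.1)

/-- The coefficient of `∂_r` in the linearized Rankine-Hugoniot condition. -/
def B₁ (bg : Background G b₀) : ℝ :=
  2 * bg.ρ bg.s₀ * bg.u bg.s₀ - 1 / G.soundSq (bg.ρ bg.s₀) * bg.ρ bg.s₀ * bg.u bg.s₀ *
    (bg.u bg.s₀ ^ 2 / 2 - G.enthalpy (bg.ρ bg.s₀) + G.enthalpy G.ρ₀)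

/-- The coefficient of `∂_t` in the linearized Rankine-Hugoniot condition. -/
def B₂ (bg : Background G b₀) : ℝ :=
  bg.ρ bg.s₀ - G.ρ₀ - 1 / G.soundSq (bg.ρ bg.s₀) * bg.ρ bg.s₀ *
    (bg.u bg.s₀ ^ 2 / 2 - G.enthalpy (bg.ρ bg.s₀) + G.enthalpy G.ρ₀)

/-- The boundary operator `𝓑₀ = ∂_r + μ₁ ∂_t`, `μ₁ = B₂ / B₁`. -/
def shockOp (bg : Background G b₀) (f : ℝ × E3 → ℝ) (p : ℝ × E3) : ℝ :=
  dr f p + bg.B₂ / bg.B₁ * dt f p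

end Background

/-! ### The perturbed piston and the modified background solution -/

/-- The path `σ(t, ω) = t b(t, ω)` of the piston. -/
def pistonPath (b : ℝ → E3 → ℝ) (t : ℝ) (y : E3) : ℝ := t * b t y

/-- `b` is smooth on `(0, ∞) × S²`, and
`|∂_t^{k₀} Z^k (b - b₀)| ≤ K_{k₀, k} ε / (1 + t)^{k₀}` for all `k₀` and all multi-indices `k`. -/
structure IsPistonSpeed (b₀ ε : ℝ) (K : ℕ → (Fin 3 → ℕ) → ℝ) (b : ℝ → E3 → ℝ) : Prop where
  smooth : ∀ p : ℝ × E3, 0 < p.1 → p.2 ≠ 0 → ContDiffAt ℝ ∞ (onRays b) p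
  bound : ∀ (k₀ : ℕ) (k : Fin 3 → ℕ) (p : ℝ × E3), 0 < p.1 → p.2 ≠ 0 →
    |(dt^[k₀] ((dZ 0)^[k 0] ((dZ 1)^[k 1] ((dZ 2)^[k 2] fun q => onRays b q - b₀)))) p|
      ≤ K k₀ k * ε / (1 + p.1) ^ k₀

/-- The operator `𝓑_σ f = ∂_r f - r⁻² ∑ᵢ Zᵢσ Zᵢf` of the boundary condition on the piston. -/
def wallOp (σ : ℝ → E3 → ℝ) (f : ℝ × E3 → ℝ) (p : ℝ × E3) : ℝ :=
  dr f p - 1 / ‖p.2‖ ^ 2 * ∑ i, dZ i (onRays σ) p * dZ i f p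

/-- `f` is the corrector `f_a`: the smooth solution, on the outside `r ≥ σ(t, ω)` of the piston, of
the transport problem `𝓑_σ f = (∂_t σ - û(σ/t)) / Φ̂|_{r = σ}`, `f = 0` on `r = σ`. -/
structure IsCorrector {G : Gas} {b₀ : ℝ} (bg : Background G b₀) (σ : ℝ → E3 → ℝ)
    (f : ℝ × E3 → ℝ) : Prop where
  smooth : ∀ p : ℝ × E3, 0 < p.1 → p.2 ≠ 0 → onRays σ p ≤ ‖p.2‖ → ContDiffAt ℝ ∞ f p
  transport : ∀ p : ℝ × E3, 0 < p.1 → p.2 ≠ 0 → onRays σ p ≤ ‖p.2‖ →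
    wallOp σ f p = (dt (onRays σ) p - bg.u (onRays σ p / p.1)) /
      (p.1 * bg.profile (onRays σ p / p.1))
  wall : ∀ p : ℝ × E3, 0 < p.1 → p.2 ≠ 0 → onRays σ p = ‖p.2‖ → f p = 0

/-- The modified background potential `Φ_a = (1 + f_a) Φ̂`. -/
def modifiedPotential {G : Gas} {b₀ : ℝ} (bg : Background G b₀) (f : ℝ × E3 → ℝ)
    (p : ℝ × E3) : ℝ := (1 + f p) * bg.potential p

/-! ### Shock solutions and their perturbations -/

/-- The closed domain `1 ≤ t ≤ T`, `σ(t, ω) ≤ r ≤ ζ(t, ω)` between piston and shock. -/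
def shockDomain (σ ζ : ℝ → E3 → ℝ) (T : ℝ) : Set (ℝ × E3) :=
  {p | p.1 ∈ Icc 1 T ∧ p.2 ≠ 0 ∧ onRays σ p ≤ ‖p.2‖ ∧ ‖p.2‖ ≤ onRays ζ p}

/-- `(Φ, ζ)` is a `C²` solution on `[1, T]` of the piston problem for the piston `r = σ(t, ω)`. -/
structure IsShockSolution (G : Gas) (σ : ℝ → E3 → ℝ) (T : ℝ) (ζ : ℝ → E3 → ℝ)
    (Φ : ℝ × E3 → ℝ) : Prop where
  /-- the shock lies ahead of the piston -/
  ahead : ∀ t ∈ Icc 1 T, ∀ y : E3, ‖y‖ = 1 → σ t y < ζ t y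
  /-- `ζ` is `C²` on `[1, T] × S²` -/
  regular_ζ : ∀ p : ℝ × E3, p.1 ∈ Icc 1 T → p.2 ≠ 0 → ContDiffAt ℝ 2 (onRays ζ) p
  /-- `Φ` is `C²` up to the boundary -/
  regular_Φ : ∀ p ∈ shockDomain σ ζ T, ContDiffAt ℝ 2 Φ p
  /-- the potential flow equation -/
  equation : ∀ p ∈ shockDomain σ ζ T,
    dt (dt Φ) p + 2 * ∑ k, dx k Φ p * dt (dx k Φ) p
      + ∑ i, ∑ j, dx i Φ p * dx j Φ p * dx i (dx j Φ) p
      - G.soundSq (G.density Φ p) * ∑ i, dx i (dx i Φ) p = 0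
  /-- the boundary condition on the piston -/
  piston : ∀ p ∈ shockDomain σ ζ T, ‖p.2‖ = onRays σ p → wallOp σ Φ p = dt (onRays σ) p
  /-- the Rankine-Hugoniot condition on the shock -/
  rankineHugoniot : ∀ p ∈ shockDomain σ ζ T, ‖p.2‖ = onRays ζ p →
    G.density Φ p * dr Φ p - (G.density Φ p - G.ρ₀) * dt (onRays ζ) p
      = 1 / ‖p.2‖ ^ 2 * G.density Φ p * ∑ i, dZ i (onRays ζ) p * dZ i Φ p
  /-- continuity of the potential across the shock -/
  continuity : ∀ p ∈ shockDomain σ ζ T, ‖p.2‖ = onRays ζ p → Φ p = 0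

/-- The perturbation `φ̇ = Φ - Φ_a` of the potential. -/
def pertPotential {G : Gas} {b₀ : ℝ} (bg : Background G b₀) (f Φ : ℝ × E3 → ℝ)
    (p : ℝ × E3) : ℝ := Φ p - modifiedPotential bg f p

/-- The perturbation `ξ = ζ / t - s₀` of the shock, as a function of `(t, x)`. -/
def pertShock {G : Gas} {b₀ : ℝ} (bg : Background G b₀) (ζ : ℝ → E3 → ℝ) (p : ℝ × E3) : ℝ :=
  onRays ζ p / p.1 - bg.s₀

/-- The integral of `g` over the shock surface `Γ_T = {1 < t < T, r = ζ(t, ω), ω ∈ S²}` with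
respect to `dω dt`, where `dω` is the surface measure of the unit sphere `S²`. -/
def shockIntegral (ζ : ℝ → E3 → ℝ) (T : ℝ) (g : ℝ × E3 → ℝ) : ℝ :=
  ∫ y : Metric.sphere (0 : E3) 1, (∫ t in (1 : ℝ)..T, g (t, ζ t y • (y : E3)))
    ∂(volume : Measure E3).toSphere

end

/-! ### The background solution -/

/-! On the shock `r = ζ` one has `Φ = 0`, hence `φ̇ = -Φ_a = -(1 + f_a) t φ̂(s₀ + ξ)`. Since `φ̂(s₀)
= 0` and `φ̂' = û`, the perturbation is dominated by the displacement `ψ = ζ - s₀ t = t ξ`: `|φ̇| ≤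
(1 + η) û(s₀) |ψ|`, with `η` as small as desired. A Hardy inequality for `ψ` on each ray therefore
suffices, and `ψ' = ∂_t ζ - s₀` is governed by the jump conditions.

Differentiating `Φ = 0` along the shock gives `∂_t ζ ∂_r Φ = -∂_t Φ` and `Z_k ζ ∂_r Φ = -Z_k Φ`. The
Rankine-Hugoniot condition times `∂_r Φ` thus becomes a relation (`jump`) between `∂_t Φ`, `∂_r Φ`
and `r⁻² ∑ (Z_k Φ)²` that is free of `ζ`. Its linearization at the background has the coefficients
`B₂` and `B₁`. Solving it for `∂_r Φ` and inserting the result in `∂_t ζ = -∂_t Φ / ∂_r Φ` gives,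
with `û`, `û'` taken at `s₀`, `ψ' + (κ/û) ∂_t φ̇ + θ ψ/t ≈ 0`, where `κ = 1 - s₀ B₂/B₁` and `θ = -κ
s₀ û'/û`. For large `b₀` the shock is strong and `1/4 ≤ κ ≤ 1/2` (`densityRatio_le`,
`polarCoeff_mem`). Since `-s₀ û' ≥ 2 û`, also `θ ≥ 1/2`, so the last term is a damping.

Testing with `t^μ ψ` (`hardy_of_damped`), the damping pays for the errors and Young's inequality
yields the factor `4 κ²/(û² μ²)` in front of `∫ t^(μ+1) (∂_t φ̇)²`. Returning from `ψ` to `φ̇` costs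
`û²`, and `4 κ² ≤ 1` leaves `1/μ²` up to losses made small through `ε₀`. The condition on `μ` forces
`μ < -2` with a margin, so `t^(μ+1)` is integrable on `[1, ∞)` and an inhomogeneous error of size
`ε` contributes `O(ε²)` uniformly in `T` and `μ`.

The constant `C` is fixed before the background solution and `M`, so this inhomogeneous error needs
an explicit constant. It stems from the value of `f_a` alone. A maximum principle for `𝓑_σ`
(`wallField_comparison`) gives `|f_a| ≤ 20 N ε/û(s₀)`, because the datum of the transport problem is
`O(ε)` by `û(b₀) = b₀`, `û'(b₀) = -2`. The derivatives of `f_a` may have background-dependent bounds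
(`exists_corrector_bounds`): on the shock they only occur multiplied by `φ̂(s₀ + ξ) = O(ξ)`. The
pieces meet in `exists_perturbedShockSpeed_bound` and `exists_shock_inequality`. -/

theorem Gas.soundSq_pos (G : Gas) {ρ : ℝ} (hρ : 0 < ρ) : 0 < G.soundSq ρ := by
  have h2 : 0 < G.γ := by linarith [G.one_lt_γ]
  have h3 := G.A_pos
  unfold Gas.soundSq
  positivity

theorem Gas.continuousAt_soundSq (G : Gas) {ρ : ℝ} (hρ : 0 < ρ) :
    ContinuousAt G.soundSq ρ := by
  unfold Gas.soundSq
  exact continuousAt_const.mul (Real.continuousAt_rpow_const _ _ (Or.inl hρ.ne'))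

theorem Gas.enthalpyInv_enthalpy (G : Gas) {ρ : ℝ} (hρ : 0 < ρ) :
    G.enthalpyInv (G.enthalpy ρ) = ρ := by
  have h1 : 0 < G.γ - 1 := sub_pos.2 G.one_lt_γ
  have h2 : 0 < G.γ := by linarith
  have h3 := G.A_pos
  have h : (G.γ - 1) * (G.A * G.γ * ρ ^ (G.γ - 1) / (G.γ - 1)) / (G.A * G.γ) = ρ ^ (G.γ - 1) := by
    field_simp
  unfold enthalpyInv enthalpy soundSq
  rw [h, ← Real.rpow_mul hρ.le, mul_one_div_cancel h1.ne', Real.rpow_one]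

/-- Inverse of `dh/dρ = c²/ρ`; it produces the factors `ρ/c²` in `B₁` and `B₂`. -/
theorem Gas.hasDerivAt_enthalpyInv (G : Gas) {ρ : ℝ} (hρ : 0 < ρ) :
    HasDerivAt G.enthalpyInv (ρ / G.soundSq ρ) (G.enthalpy ρ) := by
  have h1 : 0 < G.γ - 1 := sub_pos.2 G.one_lt_γ
  have h2 : 0 < G.γ := by linarith
  have h3 := G.A_pos
  have h : (G.γ - 1) * G.enthalpy ρ / (G.A * G.γ) = ρ ^ (G.γ - 1) := by
    unfold enthalpy soundSq
    field_simp
  have hlin : HasDerivAt (fun q => (G.γ - 1) * q / (G.A * G.γ)) ((G.γ - 1) / (G.A * G.γ))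
      (G.enthalpy ρ) := by
    simpa using ((hasDerivAt_id (G.enthalpy ρ)).const_mul (G.γ - 1)).div_const (G.A * G.γ)
  have hpow := hlin.rpow_const (p := 1 / (G.γ - 1)) (Or.inl (by rw [h]; positivity))
  refine hpow.congr_deriv ?_
  have e : (ρ ^ (G.γ - 1)) ^ (1 / (G.γ - 1) - 1) = ρ / ρ ^ (G.γ - 1) := by
    rw [← Real.rpow_mul hρ.le, mul_sub, mul_one_div_cancel h1.ne', mul_one, Real.rpow_sub hρ,
      Real.rpow_one]
  rw [h, e]
  unfold soundSq
  have : 0 < ρ ^ (G.γ - 1) := by positivity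
  field_simp

/-! ### Background flow between piston and shock -/

namespace Background

variable {G : Gas} {b₀ : ℝ} (bg : Background G b₀)

theorem mem_Ioo_of_mem_Icc {s : ℝ} (hs : s ∈ Icc b₀ bg.s₀) :
    s ∈ Ioo (b₀ - bg.τ) (bg.s₀ + bg.τ) :=
  ⟨by linarith [hs.1, bg.τ_pos], by linarith [hs.2, bg.τ_pos]⟩

theorem wall_mem : b₀ ∈ Icc b₀ bg.s₀ := ⟨le_rfl, bg.b₀_lt_s₀.le⟩

theorem shock_mem : bg.s₀ ∈ Icc b₀ bg.s₀ := ⟨bg.b₀_lt_s₀.le, le_rfl⟩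

theorem continuousAt_u {s : ℝ} (hs : s ∈ Ioo (b₀ - bg.τ) (bg.s₀ + bg.τ)) :
    ContinuousAt bg.u s := (bg.ode_u s hs).continuousAt

theorem continuousAt_denom {s : ℝ} (hs : s ∈ Ioo (b₀ - bg.τ) (bg.s₀ + bg.τ)) :
    ContinuousAt (fun s => (s - bg.u s) ^ 2 - G.soundSq (bg.ρ s)) s :=
  ((continuousAt_id.sub (bg.continuousAt_u hs)).pow 2).sub
    (ContinuousAt.comp (f := bg.ρ) (g := G.soundSq) (G.continuousAt_soundSq (bg.ρ_pos s hs))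
      (bg.ode_ρ s hs).continuousAt)

/-- The Lax conditions say `|s₀ - û| < c` at `s₀`. The denominator is continuous without zeros on an
interval, so its sign at the shock persists. -/
theorem denom_neg {s : ℝ} (hs : s ∈ Ioo (b₀ - bg.τ) (bg.s₀ + bg.τ)) :
    (s - bg.u s) ^ 2 - G.soundSq (bg.ρ s) < 0 := by
  have h0 := bg.mem_Ioo_of_mem_Icc bg.shock_mem
  have hshock : (bg.s₀ - bg.u bg.s₀) ^ 2 - G.soundSq (bg.ρ bg.s₀) < 0 := by
    have h1 := bg.lax_left
    have h2 := bg.lax_right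
    have h3 : G.sound (bg.ρ bg.s₀) ^ 2 = G.soundSq (bg.ρ bg.s₀) :=
      Real.sq_sqrt (G.soundSq_pos (bg.ρ_pos _ h0)).le
    nlinarith
  by_contra hcon
  obtain ⟨x, hx, hx0⟩ := isPreconnected_Ioo.intermediate_value h0 hs
    (f := fun s => (s - bg.u s) ^ 2 - G.soundSq (bg.ρ s))
    (fun y hy => (bg.continuousAt_denom hy).continuousWithinAt)
    (show (0 : ℝ) ∈ _ from ⟨hshock.le, not_lt.1 hcon⟩)
  exact bg.denom_ne x hx hx0

theorem continuousOn_rate (hb : 0 < b₀) :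
    ContinuousOn (fun s => 2 * G.soundSq (bg.ρ s) / (s * ((s - bg.u s) ^ 2 - G.soundSq (bg.ρ s))))
      (Icc b₀ bg.s₀) := by
  intro s hs
  have hs' := bg.mem_Ioo_of_mem_Icc hs
  refine (ContinuousAt.div (continuousAt_const.mul (ContinuousAt.comp (f := bg.ρ)
    (g := G.soundSq) (G.continuousAt_soundSq (bg.ρ_pos s hs')) (bg.ode_ρ s hs').continuousAt))
    (continuousAt_id.mul (bg.continuousAt_denom hs')) ?_).continuousWithinAt
  exact mul_ne_zero (by dsimp; linarith [hs.1]) (bg.denom_ne s hs')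

/-- The velocity equation has the form `u' = a(s) u` with `a` bounded by some `L` on the compact
interval. Hence `u² exp(2 L s)` is nondecreasing, and `u` cannot vanish after starting from `u(b₀) =
b₀ > 0`. -/
theorem u_pos (hb : 0 < b₀) {s : ℝ} (hs : s ∈ Icc b₀ bg.s₀) : 0 < bg.u s := by
  obtain ⟨L, hL⟩ := isCompact_Icc.exists_bound_of_continuousOn (bg.continuousOn_rate hb)
  have hder : ∀ s ∈ Icc b₀ bg.s₀, HasDerivAt (fun s => bg.u s ^ 2 * Real.exp (2 * L * s))
      (2 * (2 * G.soundSq (bg.ρ s) / (s * ((s - bg.u s) ^ 2 - G.soundSq (bg.ρ s))) + L) *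
        (bg.u s ^ 2 * Real.exp (2 * L * s))) s := by
    intro s hs
    have h1 := bg.ode_u s (bg.mem_Ioo_of_mem_Icc hs)
    have h2 : HasDerivAt (fun s => Real.exp (2 * L * s)) (Real.exp (2 * L * s) * (2 * L)) s := by
      simpa using ((hasDerivAt_id s).const_mul (2 * L)).exp
    refine ((h1.pow 2).mul h2).congr_deriv ?_
    simp only [Pi.pow_apply, Nat.cast_ofNat, Nat.add_one_sub_one, pow_one]
    ring
  have hmono : MonotoneOn (fun s => bg.u s ^ 2 * Real.exp (2 * L * s)) (Icc b₀ bg.s₀) := by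
    refine monotoneOn_of_hasDerivWithinAt_nonneg (convex_Icc _ _)
      (fun s hs => (hder s hs).continuousAt.continuousWithinAt)
      (fun s hs => (hder s (interior_subset hs)).hasDerivWithinAt) (fun s hs => ?_)
    have h := hL s (interior_subset hs)
    rw [Real.norm_eq_abs] at h
    have := (abs_le.1 h).1
    have : 0 ≤ 2 * G.soundSq (bg.ρ s) / (s * ((s - bg.u s) ^ 2 - G.soundSq (bg.ρ s))) + L := by
      linarith
    positivity
  have hne : ∀ s ∈ Icc b₀ bg.s₀, bg.u s ≠ 0 := by
    intro s hs h0
    have h := hmono bg.wall_mem hs hs.1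
    simp only [h0, bg.wall] at h
    have : 0 < b₀ ^ 2 * Real.exp (2 * L * b₀) := by positivity
    nlinarith
  by_contra hcon
  obtain ⟨x, hx, hx0⟩ := isPreconnected_Icc.intermediate_value hs bg.wall_mem
    (f := bg.u) (fun y hy => (bg.continuousAt_u (bg.mem_Ioo_of_mem_Icc hy)).continuousWithinAt)
    (show (0 : ℝ) ∈ _ from ⟨not_lt.1 hcon, by rw [bg.wall]; exact hb.le⟩)
  exact hne x hx hx0

theorem deriv_u_neg (hb : 0 < b₀) {s : ℝ} (hs : s ∈ Icc b₀ bg.s₀) :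
    2 * G.soundSq (bg.ρ s) * bg.u s / (s * ((s - bg.u s) ^ 2 - G.soundSq (bg.ρ s))) < 0 := by
  have hs' := bg.mem_Ioo_of_mem_Icc hs
  have h1 := G.soundSq_pos (bg.ρ_pos s hs')
  have h2 := bg.u_pos hb hs
  have h3 : 0 < s := by linarith [hs.1]
  exact div_neg_of_pos_of_neg (by positivity) (mul_neg_of_pos_of_neg h3 (bg.denom_neg hs'))

theorem antitoneOn_u (hb : 0 < b₀) : AntitoneOn bg.u (Icc b₀ bg.s₀) := by
  have h := fun s (hs : s ∈ Icc b₀ bg.s₀) => bg.ode_u s (bg.mem_Ioo_of_mem_Icc hs)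
  refine antitoneOn_of_deriv_nonpos (convex_Icc _ _)
    (fun s hs => (h s hs).continuousAt.continuousWithinAt)
    (fun s hs => (h s (interior_subset hs)).differentiableAt.differentiableWithinAt)
    (fun s hs => ?_)
  rw [(h s (interior_subset hs)).deriv]
  exact (bg.deriv_u_neg hb (interior_subset hs)).le

/-- At the piston `s - û = 0`, so the sound speed cancels from the equation. This universal slope
keeps the bound on the corrector's datum explicit. -/
theorem hasDerivAt_u_wall (hb : 0 < b₀) : HasDerivAt bg.u (-2) b₀ := by
  have hs := bg.mem_Ioo_of_mem_Icc bg.wall_mem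
  refine (bg.ode_u b₀ hs).congr_deriv ?_
  have := (G.soundSq_pos (bg.ρ_pos _ hs)).ne'
  rw [bg.wall, sub_self]
  field_simp
  simp [this]

/-- The slope of the velocity profile at the shock. -/
noncomputable def shockSlope : ℝ :=
  2 * G.soundSq (bg.ρ bg.s₀) * bg.u bg.s₀ /
    (bg.s₀ * ((bg.s₀ - bg.u bg.s₀) ^ 2 - G.soundSq (bg.ρ bg.s₀)))

theorem hasDerivAt_u_shock : HasDerivAt bg.u bg.shockSlope bg.s₀ :=
  bg.ode_u _ (bg.mem_Ioo_of_mem_Icc bg.shock_mem)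

/-- The right side equals `2 c² û / (c² - (s₀ - û)²)`, whose denominator is at most `c²`. This is
the source of the damping. -/
theorem two_le_shockSlope (hb : 0 < b₀) : 2 * bg.u bg.s₀ ≤ -(bg.s₀ * bg.shockSlope) := by
  have hs := bg.mem_Ioo_of_mem_Icc bg.shock_mem
  have h1 := G.soundSq_pos (bg.ρ_pos _ hs)
  have h2 := bg.denom_neg hs
  have h3 := bg.u_pos hb bg.shock_mem
  have h4 : 0 < bg.s₀ := hb.trans bg.b₀_lt_s₀
  have e : -(bg.s₀ * bg.shockSlope) = 2 * G.soundSq (bg.ρ bg.s₀) * bg.u bg.s₀ /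
      (G.soundSq (bg.ρ bg.s₀) - (bg.s₀ - bg.u bg.s₀) ^ 2) := by
    unfold shockSlope
    rw [← neg_sub, mul_neg, div_neg]
    field_simp
  rw [e, le_div_iff₀ (by linarith)]
  nlinarith [sq_nonneg (bg.s₀ - bg.u bg.s₀), mul_nonneg h3.le (sq_nonneg (bg.s₀ - bg.u bg.s₀))]

theorem intervalIntegrable_u {s s' : ℝ} (hs : s ∈ Ioo (b₀ - bg.τ) (bg.s₀ + bg.τ))
    (hs' : s' ∈ Ioo (b₀ - bg.τ) (bg.s₀ + bg.τ)) : IntervalIntegrable bg.u volume s s' :=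
  ContinuousOn.intervalIntegrable fun _ hx => (bg.continuousAt_u
    (ordConnected_Ioo.uIcc_subset hs hs' hx)).continuousWithinAt

theorem hasDerivAt_profile {s : ℝ} (hs : s ∈ Ioo (b₀ - bg.τ) (bg.s₀ + bg.τ)) :
    HasDerivAt bg.profile (bg.u s) s := by
  have hcont : ContinuousOn bg.u (Ioo (b₀ - bg.τ) (bg.s₀ + bg.τ)) :=
    fun x hx => (bg.continuousAt_u hx).continuousWithinAt
  exact intervalIntegral.integral_hasDerivAt_right
    (bg.intervalIntegrable_u (bg.mem_Ioo_of_mem_Icc bg.shock_mem) hs)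
    (hcont.stronglyMeasurableAtFilter isOpen_Ioo s hs) (bg.continuousAt_u hs)

theorem profile_shock : bg.profile bg.s₀ = 0 := intervalIntegral.integral_same

/-- `û` decreases, so it is at least `û(s₀)` throughout. The factor `s₀ - b₀` later cancels against
the thickness of the layer between piston and shock. -/
theorem profile_wall_le (hb : 0 < b₀) :
    bg.profile b₀ ≤ -((bg.s₀ - b₀) * bg.u bg.s₀) := by
  have h1 : bg.profile b₀ = -∫ y in b₀..bg.s₀, bg.u y := by
    unfold profile
    rw [intervalIntegral.integral_symm]
  have h2 : ∫ _ in b₀..bg.s₀, bg.u bg.s₀ ≤ ∫ y in b₀..bg.s₀, bg.u y :=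
    intervalIntegral.integral_mono_on bg.b₀_lt_s₀.le (by simp)
      (bg.intervalIntegrable_u (bg.mem_Ioo_of_mem_Icc bg.wall_mem)
        (bg.mem_Ioo_of_mem_Icc bg.shock_mem))
      (fun x hx => bg.antitoneOn_u hb hx bg.shock_mem hx.2)
  rw [intervalIntegral.integral_const, smul_eq_mul] at h2
  linarith

/-- The right side of the equation is continuous. One continuous derivative is what the derivative
bounds on the corrector's datum require. -/
theorem contDiffAt_u (hb : 0 < b₀) {s : ℝ} (hs : s ∈ Icc b₀ bg.s₀) : ContDiffAt ℝ 1 bg.u s := by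
  have hs' := bg.mem_Ioo_of_mem_Icc hs
  have hopen : IsOpen (Ioo (b₀ - bg.τ) (bg.s₀ + bg.τ) ∩ Ioi 0) := isOpen_Ioo.inter isOpen_Ioi
  have hmem : s ∈ Ioo (b₀ - bg.τ) (bg.s₀ + bg.τ) ∩ Ioi 0 := ⟨hs', hb.trans_le hs.1⟩
  refine ContDiffOn.contDiffAt (s := Ioo (b₀ - bg.τ) (bg.s₀ + bg.τ) ∩ Ioi 0) ?_
    (hopen.mem_nhds hmem)
  rw [show (1 : WithTop ℕ∞) = 0 + 1 by simp, contDiffOn_succ_iff_deriv_of_isOpen hopen]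
  refine ⟨fun x hx => (bg.ode_u x hx.1).differentiableAt.differentiableWithinAt, by simp, ?_⟩
  rw [contDiffOn_zero]
  refine ContinuousOn.congr (f := fun s => 2 * G.soundSq (bg.ρ s) * bg.u s /
    (s * ((s - bg.u s) ^ 2 - G.soundSq (bg.ρ s)))) (fun x hx => ?_)
    (fun x hx => (bg.ode_u x hx.1).deriv)
  refine (ContinuousAt.div ((continuousAt_const.mul (ContinuousAt.comp (f := bg.ρ)
    (g := G.soundSq) (G.continuousAt_soundSq (bg.ρ_pos x hx.1))
    (bg.ode_ρ x hx.1).continuousAt)).mul (bg.continuousAt_u hx.1))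
    (continuousAt_id.mul (bg.continuousAt_denom hx.1)) ?_).continuousWithinAt
  exact mul_ne_zero (ne_of_gt hx.2) (bg.denom_ne x hx.1)

theorem contDiffAt_profile {s : ℝ} (hs : s ∈ Ioo (b₀ - bg.τ) (bg.s₀ + bg.τ)) :
    ContDiffAt ℝ 1 bg.profile s := by
  refine ContDiffOn.contDiffAt (s := Ioo (b₀ - bg.τ) (bg.s₀ + bg.τ)) ?_ (isOpen_Ioo.mem_nhds hs)
  rw [show (1 : WithTop ℕ∞) = 0 + 1 by simp, contDiffOn_succ_iff_deriv_of_isOpen isOpen_Ioo]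
  refine ⟨fun x hx => (bg.hasDerivAt_profile hx).differentiableAt.differentiableWithinAt,
    by simp, ?_⟩
  rw [contDiffOn_zero]
  exact ContinuousOn.congr (f := bg.u) (fun x hx => (bg.continuousAt_u hx).continuousWithinAt)
    (fun x hx => (bg.hasDerivAt_profile hx).deriv)

/-! ### Strong shocks: density ratio and polar coefficient -/

/-- The ratio of the densities ahead of and behind the shock. -/
noncomputable def densityRatio : ℝ := G.ρ₀ / bg.ρ bg.s₀

theorem densityRatio_pos : 0 < bg.densityRatio :=
  div_pos G.ρ₀_pos (bg.ρ_pos _ (bg.mem_Ioo_of_mem_Icc bg.shock_mem))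

theorem u_shock : bg.u bg.s₀ = bg.s₀ * (1 - bg.densityRatio) := by
  have h := bg.rh_mass
  have hρ := bg.ρ_pos _ (bg.mem_Ioo_of_mem_Icc bg.shock_mem)
  unfold densityRatio
  field_simp
  linarith

theorem densityRatio_lt_one (hb : 0 < b₀) : bg.densityRatio < 1 := by
  have h := bg.u_pos hb bg.shock_mem
  rw [bg.u_shock] at h
  have := pos_of_mul_pos_right h (hb.trans bg.b₀_lt_s₀).le
  linarith

theorem enthalpy_shock : G.enthalpy (bg.ρ bg.s₀) =
    G.enthalpy G.ρ₀ + bg.s₀ * bg.u bg.s₀ - bg.u bg.s₀ ^ 2 / 2 := by linarith [bg.rh_energy]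

/-- With `û = s₀ (1 - q)` the energy condition reads `h(ρ) = h(ρ₀) + s₀² (1 - q²)/2`. Since `γ < 3`
and `q < 1`, `h(ρ) = h(ρ₀) q^(-(γ-1)) ≤ h(ρ₀) q⁻²`. Multiplying by `q²` gives `(1 - q²)(s₀² q²/2 -
h(ρ₀)) ≤ 0`, so `q` is at most of order `1/s₀`. -/
theorem densityRatio_le {δ : ℝ} (hδ : 0 < δ) (hb : 0 < b₀)
    (hlarge : 4 * G.enthalpy G.ρ₀ < δ ^ 2 * b₀ ^ 2) : bg.densityRatio ≤ δ := by
  by_contra! hcon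
  set q := bg.densityRatio with hq
  have hq0 : 0 < q := bg.densityRatio_pos
  have hq1 : q < 1 := bg.densityRatio_lt_one hb
  have hg : 0 < G.γ - 1 := sub_pos.2 G.one_lt_γ
  have hρ := bg.ρ_pos _ (bg.mem_Ioo_of_mem_Icc bg.shock_mem)
  have hρ' : bg.ρ bg.s₀ = G.ρ₀ * q⁻¹ := by
    have := G.ρ₀_pos
    rw [hq, densityRatio]
    field_simp
  have hh0 : 0 < G.enthalpy G.ρ₀ := div_pos (G.soundSq_pos G.ρ₀_pos) hg
  have h1 : G.enthalpy (bg.ρ bg.s₀) ≤ G.enthalpy G.ρ₀ * (q⁻¹) ^ 2 := by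
    have : G.enthalpy (bg.ρ bg.s₀) = G.enthalpy G.ρ₀ * (q⁻¹) ^ (G.γ - 1) := by
      unfold Gas.enthalpy Gas.soundSq
      rw [hρ', Real.mul_rpow G.ρ₀_pos.le (by positivity)]
      ring
    rw [this, ← Real.rpow_natCast]
    refine mul_le_mul_of_nonneg_left ?_ hh0.le
    refine Real.rpow_le_rpow_of_exponent_le ((one_le_inv₀ hq0).2 hq1.le) ?_
    norm_num
    linarith [G.γ_lt_three]
  have h2 := bg.enthalpy_shock
  rw [bg.u_shock, ← hq] at h2
  have hs : b₀ < bg.s₀ := bg.b₀_lt_s₀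
  have h3 : G.enthalpy G.ρ₀ * (q⁻¹) ^ 2 * q ^ 2 = G.enthalpy G.ρ₀ := by field_simp
  have h4 : G.enthalpy (bg.ρ bg.s₀) * q ^ 2 ≤ G.enthalpy G.ρ₀ := by
    rw [← h3]; exact mul_le_mul_of_nonneg_right h1 (sq_nonneg q)
  rw [h2] at h4
  have h5 : (1 - q ^ 2) * (bg.s₀ ^ 2 * q ^ 2 / 2 - G.enthalpy G.ρ₀) ≤ 0 := by nlinarith
  have h6 : δ ^ 2 * b₀ ^ 2 ≤ bg.s₀ ^ 2 * q ^ 2 := by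
    rw [← mul_pow, ← mul_pow]
    exact pow_le_pow_left₀ (by positivity) (by nlinarith) 2
  have h7 : 0 < 1 - q ^ 2 := by nlinarith
  have h8 : 0 < bg.s₀ ^ 2 * q ^ 2 / 2 - G.enthalpy G.ρ₀ := by linarith
  linarith [mul_pos h7 h8]

/-- The coefficient `1 - s₀ B₂ / B₁` of the linearized shock polar. -/
noncomputable def polarCoeff : ℝ := 1 - bg.s₀ * (bg.B₂ / bg.B₁)

/-- `B₁` and `B₂` through the density ratio `q` and `e = û (s₀ - û) / c²`. -/
theorem coeffs_eq :
    bg.B₁ = bg.ρ bg.s₀ * bg.u bg.s₀ *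
      (2 + bg.u bg.s₀ * (bg.s₀ - bg.u bg.s₀) / G.soundSq (bg.ρ bg.s₀)) ∧
    bg.B₂ = bg.ρ bg.s₀ * (1 - bg.densityRatio +
      bg.u bg.s₀ * (bg.s₀ - bg.u bg.s₀) / G.soundSq (bg.ρ bg.s₀)) := by
  have h := bg.enthalpy_shock
  have hρ := bg.ρ_pos _ (bg.mem_Ioo_of_mem_Icc bg.shock_mem)
  have hQ : bg.u bg.s₀ ^ 2 / 2 - G.enthalpy (bg.ρ bg.s₀) + G.enthalpy G.ρ₀ =
      -(bg.u bg.s₀ * (bg.s₀ - bg.u bg.s₀)) := by rw [h]; ring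
  unfold B₁ B₂ densityRatio
  rw [hQ]
  constructor
  · ring
  · field_simp
    ring

theorem B₁_pos (hb : 0 < b₀) : 0 < bg.B₁ := by
  have hs := bg.mem_Ioo_of_mem_Icc bg.shock_mem
  have h1 := G.soundSq_pos (bg.ρ_pos _ hs)
  have h2 := bg.ρ_pos _ hs
  have h3 := bg.u_pos hb bg.shock_mem
  have h4 : bg.u bg.s₀ ≤ bg.s₀ := by
    rw [bg.u_shock]; nlinarith [bg.densityRatio_pos, hb.trans bg.b₀_lt_s₀]
  rw [bg.coeffs_eq.1]
  have : 0 ≤ bg.u bg.s₀ * (bg.s₀ - bg.u bg.s₀) / G.soundSq (bg.ρ bg.s₀) :=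
    div_nonneg (mul_nonneg h3.le (by linarith)) h1.le
  positivity

/-- With `e = û (s₀ - û)/c²` the coefficient is `(1 - q - q e)/((1 - q)(2 + e))`, which tends to
`1/2` as `q, e → 0`. Smallness of `e` follows from `c² ≥ (γ - 1) s₀ û/2`, that is, `e ≤ 2 q/(γ -
1)`. The upper bound produces the factor `1/μ²` of the final inequality, the lower one the damping
rate `1/2`. -/
theorem polarCoeff_mem (hb : 0 < b₀) (h4 : bg.densityRatio ≤ 1 / 4)
    (h8 : bg.densityRatio ≤ (G.γ - 1) / 8) : bg.polarCoeff ∈ Icc (1 / 4 : ℝ) (1 / 2) := by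
  have hs := bg.mem_Ioo_of_mem_Icc bg.shock_mem
  have hc := G.soundSq_pos (bg.ρ_pos _ hs)
  have hρ := bg.ρ_pos _ hs
  have hu := bg.u_pos hb bg.shock_mem
  have hs0 : 0 < bg.s₀ := hb.trans bg.b₀_lt_s₀
  have hq0 := bg.densityRatio_pos
  have hg : 0 < G.γ - 1 := sub_pos.2 G.one_lt_γ
  obtain ⟨e1, e2⟩ := bg.coeffs_eq
  have hush := bg.u_shock
  have hen := bg.enthalpy_shock
  have hcs : G.soundSq (bg.ρ bg.s₀) = (G.γ - 1) * G.enthalpy (bg.ρ bg.s₀) := by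
    unfold Gas.enthalpy; field_simp
  have hh0 : 0 < G.enthalpy G.ρ₀ := div_pos (G.soundSq_pos G.ρ₀_pos) hg
  set q := bg.densityRatio
  set e := bg.u bg.s₀ * (bg.s₀ - bg.u bg.s₀) / G.soundSq (bg.ρ bg.s₀) with he
  have hsu : bg.s₀ - bg.u bg.s₀ = bg.s₀ * q := by rw [hush]; ring
  have he0 : 0 ≤ e := div_nonneg (mul_nonneg hu.le (by rw [hsu]; positivity)) hc.le
  have he1 : e ≤ 1 / 4 := by
    rw [he, div_le_iff₀ hc, hcs, hen, hsu]
    have h1 : bg.u bg.s₀ ≤ bg.s₀ := by nlinarith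
    have h2 : bg.s₀ * bg.u bg.s₀ / 2 ≤
        G.enthalpy G.ρ₀ + bg.s₀ * bg.u bg.s₀ - bg.u bg.s₀ ^ 2 / 2 := by nlinarith
    have h3 := mul_le_mul_of_nonneg_left h2 hg.le
    have h5 : bg.u bg.s₀ * bg.s₀ * q ≤ bg.u bg.s₀ * bg.s₀ * ((G.γ - 1) / 8) :=
      mul_le_mul_of_nonneg_left h8 (by positivity)
    nlinarith
  have hk : bg.polarCoeff = (1 - q - q * e) / ((1 - q) * (2 + e)) := by
    have h1q : 1 - q ≠ 0 := by linarith
    have h2e : 2 + e ≠ 0 := by linarith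
    unfold polarCoeff
    rw [e1, e2, hush]
    field_simp
    ring
  have hden : 0 < (1 - q) * (2 + e) := mul_pos (by linarith) (by linarith)
  rw [hk]
  constructor
  · rw [le_div_iff₀ hden]; nlinarith [mul_nonneg hq0.le he0]
  · rw [div_le_iff₀ hden]; nlinarith [mul_nonneg hq0.le he0]

end Background

/-! ### Rotations and directional derivatives -/

/-- The rotation fields as linear maps. -/
noncomputable def rotL (i : Fin 3) : E3 →L[ℝ] E3 :=
  LinearMap.toContinuousLinearMap
    { toFun := rotVec i
      map_add' := fun x y => by
        fin_cases i <;> ext j <;> fin_cases j <;> simp [rotVec] <;> ring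
      map_smul' := fun c x => by
        fin_cases i <;> ext j <;> fin_cases j <;> simp [rotVec] }

@[simp] theorem rotL_apply (i : Fin 3) (x : E3) : rotL i x = rotVec i x := rfl

theorem inner_rotVec (i : Fin 3) (x : E3) : inner ℝ x (rotVec i x) = 0 := by
  fin_cases i <;> simp [rotVec, PiLp.inner_apply, Fin.sum_univ_three] <;> ring

theorem norm_rotVec_le (i : Fin 3) (x : E3) : ‖rotVec i x‖ ≤ ‖x‖ := by
  rw [EuclideanSpace.norm_eq, EuclideanSpace.norm_eq]
  refine Real.sqrt_le_sqrt ?_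
  simp only [Real.norm_eq_abs, sq_abs, Fin.sum_univ_three]
  fin_cases i <;> simp [rotVec] <;> nlinarith [sq_nonneg (x 0), sq_nonneg (x 1), sq_nonneg (x 2)]

/-- The structure constants of `so(3)`: the coefficients are zero or a signed unit vector, so a
commutator of rotations costs only first order rotations. -/
theorem rotVec_commutator (i k : Fin 3) : ∃ c : Fin 3 → ℝ, (∀ j, |c j| ≤ 1) ∧
    ∀ x, rotVec i (rotVec k x) - rotVec k (rotVec i x) = ∑ j, c j • rotVec j x := by
  fin_cases i <;> fin_cases k
  · exact ⟨![0, 0, 0], fun j => by fin_cases j <;> simp, fun x => by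
      ext j; fin_cases j <;> simp [rotVec, Fin.sum_univ_three]⟩
  · exact ⟨![0, 0, 1], fun j => by fin_cases j <;> simp, fun x => by
      ext j; fin_cases j <;> simp [rotVec, Fin.sum_univ_three]⟩
  · exact ⟨![0, -1, 0], fun j => by fin_cases j <;> simp, fun x => by
      ext j; fin_cases j <;> simp [rotVec, Fin.sum_univ_three]⟩
  · exact ⟨![0, 0, -1], fun j => by fin_cases j <;> simp, fun x => by
      ext j; fin_cases j <;> simp [rotVec, Fin.sum_univ_three]⟩
  · exact ⟨![0, 0, 0], fun j => by fin_cases j <;> simp, fun x => by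
      ext j; fin_cases j <;> simp [rotVec, Fin.sum_univ_three]⟩
  · exact ⟨![1, 0, 0], fun j => by fin_cases j <;> simp, fun x => by
      ext j; fin_cases j <;> simp [rotVec, Fin.sum_univ_three]⟩
  · exact ⟨![0, 1, 0], fun j => by fin_cases j <;> simp, fun x => by
      ext j; fin_cases j <;> simp [rotVec, Fin.sum_univ_three]⟩
  · exact ⟨![-1, 0, 0], fun j => by fin_cases j <;> simp, fun x => by
      ext j; fin_cases j <;> simp [rotVec, Fin.sum_univ_three]⟩
  · exact ⟨![0, 0, 0], fun j => by fin_cases j <;> simp, fun x => by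
      ext j; fin_cases j <;> simp [rotVec, Fin.sum_univ_three]⟩

/-- `|∇ₓf|² = (∂_r f)² + r⁻² ∑ (Z_k f)²`. -/
theorem sum_dx_sq (f : ℝ × E3 → ℝ) {p : ℝ × E3} (hp : p.2 ≠ 0) :
    ∑ i, dx i f p ^ 2 = dr f p ^ 2 + 1 / ‖p.2‖ ^ 2 * ∑ k, dZ k f p ^ 2 := by
  obtain ⟨t, x⟩ := p
  dsimp only at hp
  have hlin : ∀ v : E3, fderiv ℝ f (t, x) (0, v) = ∑ i, v i * dx i f (t, x) := by
    intro v
    have hv : ((0 : ℝ), v) = ∑ i, v i • ((0 : ℝ), EuclideanSpace.single i (1 : ℝ)) := by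
      rw [Fin.sum_univ_three]
      ext j
      · simp
      · fin_cases j <;> simp
    rw [hv, map_sum]
    exact Finset.sum_congr rfl fun i _ => by rw [map_smul, smul_eq_mul, dx]
  have hn : ‖x‖ ^ 2 = x 0 ^ 2 + x 1 ^ 2 + x 2 ^ 2 := by
    rw [EuclideanSpace.norm_sq_eq]; simp [Fin.sum_univ_three]
  have hn0 : ‖x‖ ≠ 0 := norm_ne_zero_iff.2 hp
  have hdr : dr f (t, x) = ‖x‖⁻¹ * (x 0 * dx 0 f (t, x) + x 1 * dx 1 f (t, x) +
      x 2 * dx 2 f (t, x)) := by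
    rw [dr, hlin]; simp [Fin.sum_univ_three]; ring
  have hZ : ∀ k, dZ k f (t, x) = ∑ i, rotVec k x i * dx i f (t, x) := fun k => hlin _
  simp only [hZ, hdr, Fin.sum_univ_three]
  simp only [rotVec]
  have h2 : (‖x‖⁻¹) ^ 2 * ‖x‖ ^ 2 = 1 := by field_simp
  have h3 : 1 / ‖x‖ ^ 2 = (‖x‖⁻¹) ^ 2 := by simp
  simp only [mul_pow, h3]
  simp only [Matrix.cons_val_zero, Matrix.cons_val_one, Matrix.cons_val]
  rw [hn] at h2
  linear_combination (-(dx 0 f (t, x) ^ 2 + dx 1 f (t, x) ^ 2 + dx 2 f (t, x) ^ 2)) * h2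

/-- The commutator of two derivatives along vector fields is the derivative along
their Lie bracket. -/
theorem fderiv_fderiv_apply_comm {E : Type*} [NormedAddCommGroup E] [NormedSpace ℝ E]
    {f : E → ℝ} {V X : E → E} {p : E} (hf : ContDiffAt ℝ 2 f p)
    (hV : DifferentiableAt ℝ V p) (hX : DifferentiableAt ℝ X p) :
    fderiv ℝ (fun q => fderiv ℝ f q (X q)) p (V p) =
      fderiv ℝ (fun q => fderiv ℝ f q (V q)) p (X p) +
        fderiv ℝ f p (fderiv ℝ X p (V p) - fderiv ℝ V p (X p)) := by
  have hd : DifferentiableAt ℝ (fderiv ℝ f) p :=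
    (hf.fderiv_right (m := 1) (by norm_num)).differentiableAt (by norm_num)
  have hsym := (hf.isSymmSndFDerivAt (by simp)).eq (V p) (X p)
  rw [fderiv_clm_apply hd hX, fderiv_clm_apply hd hV]
  simp only [_root_.add_apply, ContinuousLinearMap.comp_apply,
    ContinuousLinearMap.flip_apply, map_sub]
  linarith

theorem contDiffAt_fderiv_apply {E : Type*} [NormedAddCommGroup E] [NormedSpace ℝ E]
    {f : E → ℝ} {X : E → E} {p : E} {n m : WithTop ℕ∞} (hf : ContDiffAt ℝ m f p)
    (hX : ContDiffAt ℝ n X p) (hnm : n + 1 ≤ m) :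
    ContDiffAt ℝ n (fun q => fderiv ℝ f q (X q)) p :=
  (hf.fderiv_right hnm).clm_apply hX

/-- The rotation field on space-time. -/
noncomputable def rotField (i : Fin 3) : ℝ × E3 →L[ℝ] ℝ × E3 :=
  (0 : ℝ × E3 →L[ℝ] ℝ).prod ((rotL i).comp (ContinuousLinearMap.snd ℝ ℝ E3))

@[simp] theorem rotField_apply (i : Fin 3) (p : ℝ × E3) : rotField i p = (0, rotVec i p.2) := rfl

theorem ContDiffAt.dZ {f : ℝ × E3 → ℝ} {p : ℝ × E3} {n m : WithTop ℕ∞} (hf : ContDiffAt ℝ m f p)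
    (hnm : n + 1 ≤ m) (i : Fin 3) : ContDiffAt ℝ n (dZ i f) p :=
  contDiffAt_fderiv_apply hf (rotField i).contDiff.contDiffAt hnm

theorem ContDiffAt.dt {f : ℝ × E3 → ℝ} {p : ℝ × E3} {n m : WithTop ℕ∞} (hf : ContDiffAt ℝ m f p)
    (hnm : n + 1 ≤ m) : ContDiffAt ℝ n (dt f) p :=
  contDiffAt_fderiv_apply hf contDiffAt_const hnm

theorem dZ_dZ_comm {f : ℝ × E3 → ℝ} {p : ℝ × E3} (hf : ContDiffAt ℝ 2 f p) (i k : Fin 3) :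
    dZ k (dZ i f) p = dZ i (dZ k f) p +
      fderiv ℝ f p (0, rotVec i (rotVec k p.2) - rotVec k (rotVec i p.2)) := by
  have h := fderiv_fderiv_apply_comm hf (rotField k).differentiableAt (rotField i).differentiableAt
  simp only [ContinuousLinearMap.fderiv, rotField_apply, Prod.mk_sub_mk, sub_self] at h
  exact h

theorem dt_dZ_comm {f : ℝ × E3 → ℝ} {p : ℝ × E3} (hf : ContDiffAt ℝ 2 f p) (i : Fin 3) :
    dt (dZ i f) p = dZ i (dt f) p := by
  have h := fderiv_fderiv_apply_comm hf (V := fun _ => ((1 : ℝ), (0 : E3)))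
    (differentiableAt_const _) (rotField i).differentiableAt
  have h0 : rotVec i 0 = 0 := map_zero (rotL i)
  have h1 : fderiv ℝ (fun _ : ℝ × E3 => ((1 : ℝ), (0 : E3))) p = 0 := by
    simp
  rw [h1] at h
  simp only [ContinuousLinearMap.fderiv, rotField_apply, h0, _root_.zero_apply,
    sub_zero, Prod.mk_zero_zero, map_zero, add_zero] at h
  exact h

theorem abs_fderiv_commutator_le (f : ℝ × E3 → ℝ) (p : ℝ × E3) (i k : Fin 3) :
    |fderiv ℝ f p (0, rotVec i (rotVec k p.2) - rotVec k (rotVec i p.2))| ≤ ∑ j, |dZ j f p| := by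
  obtain ⟨c, hc, h⟩ := rotVec_commutator i k
  have e : ((0 : ℝ), ∑ j, c j • rotVec j p.2) = ∑ j, c j • ((0 : ℝ), rotVec j p.2) := by
    simp [Fin.sum_univ_three]
  rw [h, e, map_sum]
  refine (Finset.abs_sum_le_sum_abs _ _).trans (Finset.sum_le_sum fun j _ => ?_)
  rw [map_smul, smul_eq_mul, abs_mul]
  exact mul_le_of_le_one_left (abs_nonneg _) (hc j)

/-! ### Functions of time and direction -/

theorem onRays_smul (g : ℝ → E3 → ℝ) (t : ℝ) (x : E3) {c : ℝ} (hc : 0 < c) :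
    onRays g (t, c • x) = onRays g (t, x) := by
  simp only [onRays, norm_smul, Real.norm_eq_abs, abs_of_pos hc, smul_smul, mul_inv]
  congr 2
  field_simp

/-- Euler's identity in degree zero: the function is constant along `c ↦ (t, c x)`. -/
theorem fderiv_onRays_radial {g : ℝ → E3 → ℝ} {p : ℝ × E3}
    (hg : DifferentiableAt ℝ (onRays g) p) : fderiv ℝ (onRays g) p (0, p.2) = 0 := by
  have hc : HasDerivAt (fun c : ℝ => (p.1, c • p.2)) ((0 : ℝ), p.2) 1 := by
    have := (hasDerivAt_id (1 : ℝ)).smul_const p.2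
    simp only [one_smul] at this
    exact (hasDerivAt_const (1 : ℝ) p.1).prodMk this
  have h1 : HasFDerivAt (onRays g) (fderiv ℝ (onRays g) p) (p.1, (1 : ℝ) • p.2) := by
    rw [one_smul]; exact hg.hasFDerivAt
  have h2 := h1.comp_hasDerivAt (1 : ℝ) hc
  have h3 : (onRays g ∘ fun c : ℝ => (p.1, c • p.2)) =ᶠ[nhds 1] fun _ => onRays g p := by
    filter_upwards [lt_mem_nhds (zero_lt_one (α := ℝ))] with c hc
    exact onRays_smul g p.1 p.2 hc
  exact (h2.congr_of_eventuallyEq h3.symm).unique (hasDerivAt_const _ _)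

theorem hasFDerivAt_norm_inv {x : E3} (hx : x ≠ 0) :
    HasFDerivAt (fun y : E3 => ‖y‖⁻¹) (-(‖x‖ ^ 3)⁻¹ • innerSL ℝ x) x := by
  have hn : ‖x‖ ≠ 0 := norm_ne_zero_iff.2 hx
  have h1 : HasFDerivAt (fun y : E3 => Real.sqrt (‖y‖ ^ 2))
      ((1 / (2 * Real.sqrt (‖x‖ ^ 2))) • (2 • (innerSL ℝ x).comp (ContinuousLinearMap.id ℝ E3))) x :=
    ((hasFDerivAt_id x).norm_sq).sqrt (by simpa using hx)
  have h2 := (hasDerivAt_inv (x := Real.sqrt (‖x‖ ^ 2)) (by simpa using hx)).comp_hasFDerivAt x h1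
  have e : (fun y : E3 => ‖y‖⁻¹) = Inv.inv ∘ fun y : E3 => Real.sqrt (‖y‖ ^ 2) := by
    ext y; simp
  rw [e]
  refine h2.congr_fderiv ?_
  ext v
  simp
  field_simp

/-- Derivatives of a function that vanishes on the surface `r = σ(t, ω)`. -/
theorem tangential_derivatives {σ : ℝ → E3 → ℝ} {f : ℝ × E3 → ℝ} {p : ℝ × E3} (hp : p.2 ≠ 0)
    (hσ : DifferentiableAt ℝ (onRays σ) p) (hf : DifferentiableAt ℝ f p)
    (hr : onRays σ p = ‖p.2‖)
    (h0 : ∀ᶠ q in nhds p, f (q.1, (onRays σ q * ‖q.2‖⁻¹) • q.2) = 0) :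
    dt f p + dt (onRays σ) p * dr f p = 0 ∧
      ∀ k, dZ k f p + dZ k (onRays σ) p * dr f p = 0 := by
  have hn : ‖p.2‖ ≠ 0 := norm_ne_zero_iff.2 hp
  have hs : HasFDerivAt (fun q : ℝ × E3 => onRays σ q * ‖q.2‖⁻¹) _ p :=
    hσ.hasFDerivAt.mul (HasFDerivAt.comp (g := fun y : E3 => ‖y‖⁻¹) p (hasFDerivAt_norm_inv hp) hasFDerivAt_snd)
  have hΨ : HasFDerivAt (fun q : ℝ × E3 => (q.1, (onRays σ q * ‖q.2‖⁻¹) • q.2)) _ p :=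
    hasFDerivAt_fst.prodMk (hs.smul hasFDerivAt_snd)
  have hfix : (p.1, (onRays σ p * ‖p.2‖⁻¹) • p.2) = p := by
    rw [hr, mul_inv_cancel₀ hn, one_smul]
  have hf' : HasFDerivAt f (fderiv ℝ f p) (p.1, (onRays σ p * ‖p.2‖⁻¹) • p.2) := by
    rw [hfix]; exact hf.hasFDerivAt
  have hcomp := HasFDerivAt.comp p hf' hΨ
  have huniq := (hcomp.congr_of_eventuallyEq (f₁ := fun _ => (0 : ℝ))
    (h0.mono fun q hq => hq.symm)).unique (hasFDerivAt_const (0 : ℝ) p)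
  -- In directions orthogonal to `x` the normalization `|x|⁻¹` has zero derivative, so only the
  -- variation of `σ` contributes, and it moves the point radially.
  have hval : ∀ v : ℝ × E3, inner ℝ p.2 v.2 = 0 →
      fderiv ℝ f p v + fderiv ℝ (onRays σ) p v * dr f p = 0 := by
    intro v hv
    have h := congrArg (fun L => L v) huniq
    simp only [ContinuousLinearMap.comp_apply, ContinuousLinearMap.prod_apply,
      _root_.add_apply, _root_.smul_apply,
      ContinuousLinearMap.smulRight_apply, _root_.zero_apply,
      ContinuousLinearMap.coe_fst', ContinuousLinearMap.coe_snd', innerSL_apply_apply, hv, hr,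
      smul_zero, zero_add, mul_inv_cancel₀ hn, one_smul] at h
    rw [← h, dr]
    have e : ∀ c : ℝ, (v.1, v.2 + (‖p.2‖⁻¹ • c) • p.2) =
        v + c • ((0 : ℝ), ‖p.2‖⁻¹ • p.2) := by
      intro c
      ext1
      · simp
      · simp [smul_smul, mul_comm]
    rw [e, map_add, map_smul, smul_eq_mul]
  exact ⟨hval (1, 0) (by simp), fun k => hval (0, rotVec k p.2) (inner_rotVec k p.2)⟩

theorem hasDerivAt_onRays_time {g : ℝ → E3 → ℝ} {t : ℝ} {y : E3} {c : ℝ} (hc : 0 < c)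
    (hy : ‖y‖ = 1) (hg : DifferentiableAt ℝ (onRays g) (t, c • y)) :
    HasDerivAt (fun s => g s y) (dt (onRays g) (t, c • y)) t := by
  have h1 : HasDerivAt (fun s : ℝ => (s, c • y)) ((1 : ℝ), (0 : E3)) t :=
    (hasDerivAt_id t).prodMk (hasDerivAt_const t _)
  have h2 := HasFDerivAt.comp_hasDerivAt t hg.hasFDerivAt h1
  refine h2.congr_of_eventuallyEq (Filter.Eventually.of_forall fun s => ?_)
  rw [Function.comp_apply, onRays_smul g s y hc]
  simp [onRays, hy]

/-! ### The transport operator on the piston side -/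

/-- The vector field of the operator `𝓑_σ`. -/
noncomputable def wallField (σ : ℝ → E3 → ℝ) (p : ℝ × E3) : ℝ × E3 :=
  (0, ‖p.2‖⁻¹ • p.2 - ∑ i, ((‖p.2‖ ^ 2)⁻¹ * dZ i (onRays σ) p) • rotVec i p.2)

theorem fderiv_sum_rotVec (f : ℝ × E3 → ℝ) (p : ℝ × E3) (c : Fin 3 → ℝ) :
    fderiv ℝ f p (0, ∑ i, c i • rotVec i p.2) = ∑ i, c i * dZ i f p := by
  have e : ((0 : ℝ), ∑ j, c j • rotVec j p.2) = ∑ j, c j • ((0 : ℝ), rotVec j p.2) := by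
    simp [Fin.sum_univ_three]
  rw [e, map_sum]
  exact Finset.sum_congr rfl fun i _ => by rw [map_smul, smul_eq_mul, dZ]

theorem wallOp_eq_fderiv (σ : ℝ → E3 → ℝ) (f : ℝ × E3 → ℝ) (p : ℝ × E3) :
    wallOp σ f p = fderiv ℝ f p (wallField σ p) := by
  have e : wallField σ p = (0, ‖p.2‖⁻¹ • p.2) -
      (0, ∑ i, ((‖p.2‖ ^ 2)⁻¹ * dZ i (onRays σ) p) • rotVec i p.2) := by
    simp [wallField]
  rw [e, map_sub, fderiv_sum_rotVec, wallOp, dr, Finset.mul_sum]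
  congr 1
  exact Finset.sum_congr rfl fun i _ => by ring

theorem inner_wallField {σ : ℝ → E3 → ℝ} {p : ℝ × E3} (hp : p.2 ≠ 0) :
    inner ℝ p.2 (wallField σ p).2 = ‖p.2‖ := by
  have hn : ‖p.2‖ ≠ 0 := norm_ne_zero_iff.2 hp
  simp only [wallField, inner_sub_right, inner_smul_right, inner_sum, inner_rotVec,
    real_inner_self_eq_norm_sq, mul_zero, Finset.sum_const_zero, sub_zero]
  field_simp

/-- `σ` has no radial derivative, so the field acts on it as `-r⁻² ∑ (Z_i σ)²`. As the field raises
`r` at unit rate, `r - σ` grows at rate at least one and can serve as a barrier. -/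
theorem fderiv_onRays_wallField {σ : ℝ → E3 → ℝ} {p : ℝ × E3}
    (hσ : DifferentiableAt ℝ (onRays σ) p) : fderiv ℝ (onRays σ) p (wallField σ p) ≤ 0 := by
  have h : dr (onRays σ) p = 0 := by
    have e : ((0 : ℝ), ‖p.2‖⁻¹ • p.2) = ‖p.2‖⁻¹ • ((0 : ℝ), p.2) := by simp
    rw [dr, e, map_smul, fderiv_onRays_radial hσ, smul_zero]
  rw [← wallOp_eq_fderiv, wallOp, h, zero_sub, neg_nonpos]
  exact mul_nonneg (by positivity) (Finset.sum_nonneg fun i _ => mul_self_nonneg _)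

theorem hasDerivAt_norm_along {x v : E3} (hx : x ≠ 0) :
    HasDerivAt (fun h : ℝ => ‖x + h • v‖) (‖x‖⁻¹ * inner ℝ x v) 0 := by
  have h1 : HasDerivAt (fun h : ℝ => x + h • v) v 0 := by
    simpa using ((hasDerivAt_id (0 : ℝ)).smul_const v).const_add x
  have h2 := h1.norm_sq.sqrt (by simpa using hx)
  simp only [zero_smul, add_zero, Real.sqrt_sq (norm_nonneg _)] at h2
  refine h2.congr_deriv ?_
  have hn : ‖x‖ ≠ 0 := norm_ne_zero_iff.2 hx
  field_simp

theorem eventually_lt_of_hasDerivAt_pos {m : ℝ → ℝ} {m' : ℝ} (h : HasDerivAt m m' 0)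
    (hm : 0 < m') : ∀ᶠ s in nhdsWithin 0 (Ioi 0), m 0 < m s := by
  have h1 := hasDerivAt_iff_tendsto_slope.1 h
  have h2 := (h1.mono_left (nhdsWithin_mono 0 (fun x (hx : 0 < x) => hx.ne'))).eventually
    (lt_mem_nhds hm)
  filter_upwards [h2, self_mem_nhdsWithin] with s hs hs0
  rw [slope_def_field, sub_zero, lt_div_iff₀ hs0] at hs
  linarith

/-- A comparison principle for the transport operator `𝓑_σ` at a fixed time. -/
theorem wallField_comparison {σ : ℝ → E3 → ℝ} {F : ℝ × E3 → ℝ} {t R B κ c : ℝ} (hc : 0 < c)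
    (hσc : ∀ x : E3, x ≠ 0 → c ≤ onRays σ (t, x))
    (hσd : ∀ x : E3, x ≠ 0 → DifferentiableAt ℝ (onRays σ) (t, x))
    (hF : ∀ x : E3, x ≠ 0 → onRays σ (t, x) ≤ ‖x‖ → ‖x‖ ≤ R → DifferentiableAt ℝ F (t, x))
    (hin : ∀ x : E3, x ≠ 0 → onRays σ (t, x) < ‖x‖ → ‖x‖ ≤ R →
      fderiv ℝ F (t, x) (wallField σ (t, x)) ≤ κ)
    (hbd : ∀ x : E3, x ≠ 0 → onRays σ (t, x) = ‖x‖ → ‖x‖ ≤ R → F (t, x) ≤ B)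
    (hκ : 0 ≤ κ) {x : E3} (hx : x ≠ 0) (hσx : onRays σ (t, x) ≤ ‖x‖) (hxR : ‖x‖ ≤ R) :
    F (t, x) ≤ B + κ * (‖x‖ - onRays σ (t, x)) := by
  -- A slope strictly above `κ` makes the barrier strict; the limit `κ' → κ` is taken at the end.
  have main : ∀ κ' > κ, F (t, x) ≤ B + κ' * (‖x‖ - onRays σ (t, x)) := by
    intro κ' hκ'
    -- The condition `c ≤ ‖y‖` removes the origin, where functions of the direction are singular,
    -- and costs nothing because `c ≤ σ`.
    set K : Set E3 := {y | c ≤ ‖y‖ ∧ onRays σ (t, y) ≤ ‖y‖ ∧ ‖y‖ ≤ R} with hK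
    have hne : ∀ y ∈ K, y ≠ 0 := fun y hy => norm_pos_iff.1 (hc.trans_le hy.1)
    have hσcont : ∀ y : E3, y ≠ 0 → ContinuousAt (fun z => onRays σ (t, z)) y := fun y hy =>
      ContinuousAt.comp (f := fun z : E3 => (t, z)) (hσd y hy).continuousAt
        (by fun_prop)
    have hKc : IsCompact K := by
      refine Metric.isCompact_of_isClosed_isBounded ?_
        ((Metric.isBounded_closedBall (x := (0 : E3)) (r := R)).subset
          fun y hy => by simpa using hy.2.2)
      have h1 : IsClosed {y : E3 | c ≤ ‖y‖} := isClosed_le continuous_const continuous_norm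
      have h2 : ContinuousOn (fun y : E3 => ‖y‖ - onRays σ (t, y)) {y : E3 | c ≤ ‖y‖} :=
        fun y hy => (continuous_norm.continuousAt.sub
          (hσcont y (norm_pos_iff.1 (hc.trans_le hy)))).continuousWithinAt
      have h3 := h2.preimage_isClosed_of_isClosed h1 (isClosed_Ici (a := (0 : ℝ)))
      have h4 : IsClosed {y : E3 | ‖y‖ ≤ R} := isClosed_le continuous_norm continuous_const
      have h5 : K = {y : E3 | c ≤ ‖y‖} ∩ (fun y => ‖y‖ - onRays σ (t, y)) ⁻¹' Ici 0 ∩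
          {y : E3 | ‖y‖ ≤ R} := by
        ext y
        simp [hK, and_assoc]
      rw [h5]
      exact h3.inter h4
    have hwc : ContinuousOn (fun y => F (t, y) - κ' * (‖y‖ - onRays σ (t, y))) K := by
      intro y hy
      refine (ContinuousAt.sub ?_ (continuousAt_const.mul
        (continuous_norm.continuousAt.sub (hσcont y (hne y hy))))).continuousWithinAt
      exact ContinuousAt.comp (f := fun z : E3 => (t, z))
        (hF y (hne y hy) hy.2.1 hy.2.2).continuousAt (by fun_prop)
    have hxK : x ∈ K := ⟨(hσc x hx).trans hσx, hσx, hxR⟩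
    obtain ⟨y, hy, hmax⟩ := hKc.exists_isMaxOn ⟨x, hxK⟩ hwc
    have hy0 := hne y hy
    have hxy : F (t, x) - κ' * (‖x‖ - onRays σ (t, x)) ≤
        F (t, y) - κ' * (‖y‖ - onRays σ (t, y)) := hmax hxK
    rcases hy.2.1.eq_or_lt with heq | hlt
    · have h := hbd y hy0 heq hy.2.2
      rw [heq, sub_self, mul_zero, sub_zero] at hxy
      linarith
    -- At a maximum off the piston, moving inward against the field increases `F - κ' (r - σ)` at
    -- rate at least `κ' - κ > 0`. Since `r` decreases, the motion stays in `K` for a short time, a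
    -- contradiction.
    · exfalso
      set v : E3 := -(wallField σ (t, y)).2 with hv
      have hcurve : HasDerivAt (fun h : ℝ => (t, y + h • v)) ((0 : ℝ), v) 0 := by
        refine (hasDerivAt_const (0 : ℝ) t).prodMk ?_
        simpa using ((hasDerivAt_id (0 : ℝ)).smul_const v).const_add y
      have h00 : (t, y + (0 : ℝ) • v) = (t, y) := by simp
      have hvW : ((0 : ℝ), v) = -wallField σ (t, y) := by simp [hv, wallField]
      have hdF : HasDerivAt (fun h : ℝ => F (t, y + h • v))
          (-(fderiv ℝ F (t, y) (wallField σ (t, y)))) 0 := by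
        have h1 : HasFDerivAt F (fderiv ℝ F (t, y)) (t, y + (0 : ℝ) • v) := by
          rw [h00]; exact (hF y hy0 hy.2.1 hy.2.2).hasFDerivAt
        exact (h1.comp_hasDerivAt (0 : ℝ) hcurve).congr_deriv (by rw [hvW, map_neg])
      have hdσ : HasDerivAt (fun h : ℝ => onRays σ (t, y + h • v))
          (-(fderiv ℝ (onRays σ) (t, y) (wallField σ (t, y)))) 0 := by
        have h1 : HasFDerivAt (onRays σ) (fderiv ℝ (onRays σ) (t, y)) (t, y + (0 : ℝ) • v) := by
          rw [h00]; exact (hσd y hy0).hasFDerivAt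
        exact (h1.comp_hasDerivAt (0 : ℝ) hcurve).congr_deriv (by rw [hvW, map_neg])
      have hdn : HasDerivAt (fun h : ℝ => ‖y + h • v‖) (-1) 0 := by
        refine (hasDerivAt_norm_along hy0).congr_deriv ?_
        have hn : ‖y‖ ≠ 0 := norm_ne_zero_iff.2 hy0
        have := inner_wallField (σ := σ) (p := (t, y)) hy0
        simp only at this
        rw [hv, inner_neg_right, this]
        field_simp
      have h1 := hin y hy0 hlt hy.2.2
      have h2 := fderiv_onRays_wallField (hσd y hy0)
      have ev1 := eventually_lt_of_hasDerivAt_pos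
        (hdF.sub ((hdn.sub hdσ).const_mul κ')) (by nlinarith)
      have ev2 := eventually_lt_of_hasDerivAt_pos hdn.neg (by norm_num)
      have ev3 : ∀ᶠ s : ℝ in nhdsWithin 0 (Ioi 0),
          0 < ‖y + s • v‖ - onRays σ (t, y + s • v) := by
        have hcs := (hdn.sub hdσ).continuousAt
        refine (hcs.eventually (lt_mem_nhds (a := 0) ?_)).filter_mono nhdsWithin_le_nhds
        simpa using hlt
      have ev4 : ∀ᶠ s : ℝ in nhdsWithin 0 (Ioi 0), 0 < ‖y + s • v‖ := by
        refine (hdn.continuousAt.eventually (lt_mem_nhds (a := 0) ?_)).filter_mono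
          nhdsWithin_le_nhds
        simpa using hy0
      obtain ⟨s, h1s, h2s, h3s, h4s⟩ := (ev1.and (ev2.and (ev3.and ev4))).exists
      have hne' : y + s • v ≠ 0 := norm_pos_iff.1 h4s
      simp only [zero_smul, add_zero, Pi.neg_apply, neg_lt_neg_iff] at h2s
      have hmem : y + s • v ∈ K :=
        ⟨(hσc _ hne').trans (by linarith), by linarith, by linarith [hy.2.2]⟩
      have h5 : F (t, y + s • v) - κ' * (‖y + s • v‖ - onRays σ (t, y + s • v)) ≤
        F (t, y) - κ' * (‖y‖ - onRays σ (t, y)) := hmax hmem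
      simp only [Pi.sub_apply, zero_smul, add_zero] at h1s
      linarith
  by_contra! hcon
  have hd : 0 ≤ ‖x‖ - onRays σ (t, x) := by linarith
  set d := ‖x‖ - onRays σ (t, x)
  set e := F (t, x) - (B + κ * d) with he
  have he0 : 0 < e := by linarith
  -- With this slope the barrier exceeds the claimed bound by at most half of the assumed excess
  -- `e`.
  have h := main (κ + e / (2 * (d + 1))) (by
    have : 0 < e / (2 * (d + 1)) := by positivity
    linarith)
  have h2 : e / (2 * (d + 1)) * d ≤ e / 2 := by
    rw [div_mul_eq_mul_div, div_le_div_iff₀ (by positivity) (by norm_num)]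
    nlinarith
  nlinarith

theorem contDiffAt_wallField {σ : ℝ → E3 → ℝ} {p : ℝ × E3} (hp : p.2 ≠ 0)
    (hσ : ContDiffAt ℝ 2 (onRays σ) p) : ContDiffAt ℝ 1 (wallField σ) p := by
  have hn : ‖p.2‖ ≠ 0 := norm_ne_zero_iff.2 hp
  have hnorm : ContDiffAt ℝ 1 (fun q : ℝ × E3 => ‖q.2‖) p := contDiffAt_snd.norm ℝ hp
  refine contDiffAt_const.prodMk (((hnorm.inv hn).smul contDiffAt_snd).sub
    (ContDiffAt.sum fun i _ => ?_))
  refine (((hnorm.pow 2).inv (pow_ne_zero 2 hn)).mul (hσ.dZ (by norm_num) i)).smul ?_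
  exact (rotL i).contDiff.contDiffAt.comp p contDiffAt_snd

/-- The derivative of the transport field in a direction tangential to the spheres. -/
theorem fderiv_wallField_apply {σ : ℝ → E3 → ℝ} {p e : ℝ × E3} (hp : p.2 ≠ 0)
    (hσ : ContDiffAt ℝ 2 (onRays σ) p) (he : inner ℝ p.2 e.2 = 0) :
    fderiv ℝ (wallField σ) p e = (0, ‖p.2‖⁻¹ • e.2 - ∑ i, (‖p.2‖ ^ 2)⁻¹ •
      (fderiv ℝ (dZ i (onRays σ)) p e • rotVec i p.2 +
        dZ i (onRays σ) p • rotVec i e.2)) := by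
  have hn : ‖p.2‖ ≠ 0 := norm_ne_zero_iff.2 hp
  have hninv : HasFDerivAt (fun q : ℝ × E3 => ‖q.2‖⁻¹) _ p :=
    HasFDerivAt.comp (g := fun y : E3 => ‖y‖⁻¹) p (hasFDerivAt_norm_inv hp) hasFDerivAt_snd
  have hZ : ∀ i, HasFDerivAt (dZ i (onRays σ)) (fderiv ℝ (dZ i (onRays σ)) p) p := fun i =>
    ((hσ.dZ (n := 1) (by norm_num) i).differentiableAt (by norm_num)).hasFDerivAt
  have hR : ∀ i, HasFDerivAt (fun q : ℝ × E3 => rotVec i q.2) _ p := fun i =>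
    (rotL i).hasFDerivAt.comp p hasFDerivAt_snd
  have hsum : HasFDerivAt (fun q : ℝ × E3 => ∑ i, ((‖q.2‖⁻¹ ^ 2) * dZ i (onRays σ) q) •
      rotVec i q.2) _ p := HasFDerivAt.fun_sum fun i _ => ((hninv.pow 2).mul (hZ i)).smul (hR i)
  have hV := (hasFDerivAt_const (0 : ℝ) p).prodMk ((hninv.smul hasFDerivAt_snd).sub hsum)
  have hV' : HasFDerivAt (wallField σ) _ p := hV.congr_of_eventuallyEq
    (Filter.Eventually.of_forall fun q => by simp [wallField])
  rw [hV'.fderiv]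
  simp only [ContinuousLinearMap.prod_apply, _root_.zero_apply, Prod.mk.injEq, true_and,
    _root_.sub_apply, _root_.add_apply, _root_.smul_apply, ContinuousLinearMap.smulRight_apply,
    ContinuousLinearMap.comp_apply, ContinuousLinearMap.coe_snd', innerSL_apply_apply, he,
    smul_zero, zero_smul, add_zero, _root_.sum_apply]
  congr 1
  refine Finset.sum_congr rfl fun i _ => ?_
  simp only [Pi.mul_apply, inv_pow, rotL_apply, smul_eq_mul]
  module

/-! ### Bounds on the piston -/

/-- `b` is smooth and `b - b₀`, with its first and second weighted derivatives, is at most `δ`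
for `t ≥ 1`. -/
structure IsPistonClose (b₀ δ : ℝ) (b : ℝ → E3 → ℝ) : Prop where
  smooth : ∀ p : ℝ × E3, 0 < p.1 → p.2 ≠ 0 → ContDiffAt ℝ ∞ (onRays b) p
  speed : ∀ p : ℝ × E3, 1 ≤ p.1 → p.2 ≠ 0 → |onRays b p - b₀| ≤ δ
  time : ∀ p : ℝ × E3, 1 ≤ p.1 → p.2 ≠ 0 → |p.1 * dt (onRays b) p| ≤ δ
  time_time : ∀ p : ℝ × E3, 1 ≤ p.1 → p.2 ≠ 0 → |p.1 ^ 2 * dt (dt (onRays b)) p| ≤ δ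
  angular : ∀ p : ℝ × E3, 1 ≤ p.1 → p.2 ≠ 0 → ∀ i, |dZ i (onRays b) p| ≤ δ
  angular_angular : ∀ p : ℝ × E3, 1 ≤ p.1 → p.2 ≠ 0 → ∀ i k, |dZ k (dZ i (onRays b)) p| ≤ δ
  time_angular : ∀ p : ℝ × E3, 1 ≤ p.1 → p.2 ≠ 0 → ∀ i, |p.1 * dt (dZ i (onRays b)) p| ≤ δ

theorem two_le_infty : (2 : WithTop ℕ∞) ≤ ∞ := WithTop.coe_le_coe.2 (le_top : (2 : ℕ∞) ≤ ⊤)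

theorem dZ_sub_const (i : Fin 3) (g : ℝ × E3 → ℝ) (c : ℝ) :
    dZ i (fun q => g q - c) = dZ i g := by
  ext p; simp [dZ, fderiv_sub_const]

theorem dt_sub_const (g : ℝ × E3 → ℝ) (c : ℝ) : dt (fun q => g q - c) = dt g := by
  ext p; simp [dt, fderiv_sub_const]

/-- Only derivatives of total order at most two matter. The hypothesis controls products of
rotations in one order; the opposite order is reached through the commutator, whence `3 * N₁`. -/
theorem exists_isPistonClose (b₀ : ℝ) (K : ℕ → (Fin 3 → ℕ) → ℝ) : ∃ N : ℝ, 0 < N ∧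
    ∀ ε : ℝ, 0 < ε → ∀ b, IsPistonSpeed b₀ ε K b → IsPistonClose b₀ (N * ε) b := by
  set N₀ : ℝ := ∑ k₀ ∈ Finset.range 3, |K k₀ 0| with hN₀
  set N₁ : ℝ := ∑ k₀ ∈ Finset.range 2, ∑ i, |K k₀ (Pi.single i 1)| with hN₁
  set N₂ : ℝ := ∑ i, ∑ j, |K 0 (Pi.single i 1 + Pi.single j 1)| with hN₂
  have h0 : ∀ k₀ < 3, |K k₀ 0| ≤ N₀ := fun k₀ hk =>
    Finset.single_le_sum (f := fun k₀ => |K k₀ 0|) (fun _ _ => abs_nonneg _)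
      (Finset.mem_range.2 hk)
  have h1 : ∀ k₀ < 2, ∀ i, |K k₀ (Pi.single i 1)| ≤ N₁ := fun k₀ hk i =>
    (Finset.single_le_sum (f := fun i => |K k₀ (Pi.single i 1)|) (fun _ _ => abs_nonneg _)
      (Finset.mem_univ i)).trans
    (Finset.single_le_sum (f := fun k₀ => ∑ i, |K k₀ (Pi.single i 1)|)
      (fun _ _ => Finset.sum_nonneg fun _ _ => abs_nonneg _) (Finset.mem_range.2 hk))
  have h2 : ∀ i j, |K 0 (Pi.single i 1 + Pi.single j 1)| ≤ N₂ := fun i j =>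
    (Finset.single_le_sum (f := fun j => |K 0 (Pi.single i 1 + Pi.single j 1)|)
      (fun _ _ => abs_nonneg _) (Finset.mem_univ j)).trans
    (Finset.single_le_sum (f := fun i => ∑ j, |K 0 (Pi.single i 1 + Pi.single j 1)|)
      (fun _ _ => Finset.sum_nonneg fun _ _ => abs_nonneg _) (Finset.mem_univ i))
  have hN₀0 : 0 ≤ N₀ := Finset.sum_nonneg fun _ _ => abs_nonneg _
  have hN₁0 : 0 ≤ N₁ := Finset.sum_nonneg fun _ _ => Finset.sum_nonneg fun _ _ => abs_nonneg _
  have hN₂0 : 0 ≤ N₂ := Finset.sum_nonneg fun _ _ => Finset.sum_nonneg fun _ _ => abs_nonneg _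
  clear_value N₀ N₁ N₂
  refine ⟨N₀ + 3 * N₁ + N₂ + 1, by positivity, fun ε hε b hb => ?_⟩
  have key : ∀ (k₀ : ℕ) (k : Fin 3 → ℕ) (N : ℝ) (p : ℝ × E3), 1 ≤ p.1 → p.2 ≠ 0 → |K k₀ k| ≤ N →
      |p.1 ^ k₀ * (dt^[k₀] ((dZ 0)^[k 0] ((dZ 1)^[k 1] ((dZ 2)^[k 2] fun q => onRays b q - b₀)))) p|
        ≤ N * ε := by
    intro k₀ k N p ht hp hN
    have hb := hb.bound k₀ k p (by linarith) hp
    have hpow : 0 < (1 + p.1) ^ k₀ := by positivity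
    have hpow' : p.1 ^ k₀ ≤ (1 + p.1) ^ k₀ := pow_le_pow_left₀ (by linarith) (by linarith) _
    rw [le_div_iff₀ hpow] at hb
    rw [abs_mul, abs_of_nonneg (by positivity : 0 ≤ p.1 ^ k₀)]
    refine (mul_le_mul_of_nonneg_right hpow' (abs_nonneg _)).trans ?_
    rw [mul_comm]
    exact hb.trans (mul_le_mul_of_nonneg_right ((le_abs_self _).trans hN) hε.le)
  have hsm : ∀ p : ℝ × E3, 1 ≤ p.1 → p.2 ≠ 0 → ContDiffAt ℝ 2 (onRays b) p := fun p ht hp =>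
    (hb.smooth p (by linarith) hp).of_le two_le_infty
  have hang : ∀ p : ℝ × E3, 1 ≤ p.1 → p.2 ≠ 0 → ∀ i, |dZ i (onRays b) p| ≤ N₁ * ε := by
    intro p ht hp i
    have h := key 0 (Pi.single i 1) N₁ p ht hp (h1 0 (by norm_num) i)
    fin_cases i <;> simpa [dZ_sub_const] using h
  have hdiag : ∀ p : ℝ × E3, 1 ≤ p.1 → p.2 ≠ 0 → ∀ i k, k ≤ i →
      |dZ k (dZ i (onRays b)) p| ≤ N₂ * ε := by
    intro p ht hp i k hki
    have h := key 0 (Pi.single i 1 + Pi.single k 1) N₂ p ht hp (h2 i k)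
    fin_cases i <;> fin_cases k <;> first
      | exact absurd hki (by decide)
      | simpa [dZ_sub_const] using h
  refine ⟨hb.smooth, fun p ht hp => ?_, fun p ht hp => ?_, fun p ht hp => ?_, fun p ht hp i => ?_,
    fun p ht hp i k => ?_, fun p ht hp i => ?_⟩
  · have h := key 0 0 N₀ p ht hp (h0 0 (by norm_num))
    simp only [pow_zero, one_mul, Pi.zero_apply, Function.iterate_zero, id_eq] at h
    exact h.trans (by gcongr; linarith)
  · have h := key 1 0 N₀ p ht hp (h0 1 (by norm_num))
    simp only [pow_one, Pi.zero_apply, Function.iterate_zero, Function.iterate_one, id_eq,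
      dt_sub_const] at h
    exact h.trans (by gcongr; linarith)
  · have h := key 2 0 N₀ p ht hp (h0 2 (by norm_num))
    simp only [Pi.zero_apply, Function.iterate_zero, Function.iterate_succ,
      Function.comp_apply, id_eq, dt_sub_const] at h
    exact h.trans (by gcongr; linarith)
  · exact (hang p ht hp i).trans (by gcongr; linarith)
  · rcases le_total k i with hki | hik
    · exact (hdiag p ht hp i k hki).trans (by gcongr; linarith)
    · have e1 := hdiag p ht hp k i hik
      have e2 := abs_fderiv_commutator_le (onRays b) p i k
      have e3 : ∑ j, |dZ j (onRays b) p| ≤ 3 * (N₁ * ε) := by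
        refine (Finset.sum_le_sum fun j _ => hang p ht hp j).trans ?_
        simp
      rw [dZ_dZ_comm (hsm p ht hp) i k]
      refine (abs_add_le _ _).trans ?_
      nlinarith
  · have h := key 1 (Pi.single i 1) N₁ p ht hp (h1 1 (by norm_num) i)
    have h' : |p.1 * dt (dZ i (onRays b)) p| ≤ N₁ * ε := by
      fin_cases i <;> simpa [dZ_sub_const] using h
    exact h'.trans (by gcongr; linarith)

section Piston

variable {b₀ δ : ℝ} {b : ℝ → E3 → ℝ}

theorem onRays_pistonPath (b : ℝ → E3 → ℝ) (p : ℝ × E3) :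
    onRays (pistonPath b) p = p.1 * onRays b p := rfl

theorem IsPistonClose.contDiffAt_path (hb : IsPistonClose b₀ δ b) {p : ℝ × E3} (ht : 0 < p.1)
    (hp : p.2 ≠ 0) : ContDiffAt ℝ ∞ (onRays (pistonPath b)) p :=
  contDiffAt_fst.mul (hb.smooth p ht hp)

theorem IsPistonClose.eventually_pos {p : ℝ × E3} (ht : 0 < p.1) (hp : p.2 ≠ 0) :
    ∀ᶠ q in nhds p, 0 < q.1 ∧ q.2 ≠ 0 :=
  (continuous_fst.continuousAt.eventually (lt_mem_nhds ht)).and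
    (continuous_snd.continuousAt.eventually_ne hp)

theorem IsPistonClose.dZ_path (hb : IsPistonClose b₀ δ b) {p : ℝ × E3} (ht : 0 < p.1)
    (hp : p.2 ≠ 0) (i : Fin 3) :
    dZ i (onRays (pistonPath b)) p = p.1 * dZ i (onRays b) p := by
  have h := hasFDerivAt_fst.mul ((hb.smooth p ht hp).differentiableAt (by simp)).hasFDerivAt
  have h' : HasFDerivAt (onRays (pistonPath b)) _ p := h
  simp [dZ, h'.fderiv]

theorem IsPistonClose.dt_path (hb : IsPistonClose b₀ δ b) {p : ℝ × E3} (ht : 0 < p.1)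
    (hp : p.2 ≠ 0) :
    dt (onRays (pistonPath b)) p = onRays b p + p.1 * dt (onRays b) p := by
  have h := hasFDerivAt_fst.mul ((hb.smooth p ht hp).differentiableAt (by simp)).hasFDerivAt
  have h' : HasFDerivAt (onRays (pistonPath b)) _ p := h
  simp [dt, h'.fderiv, add_comm]

theorem IsPistonClose.hasFDerivAt_dZ_path (hb : IsPistonClose b₀ δ b) {p : ℝ × E3} (ht : 0 < p.1)
    (hp : p.2 ≠ 0) (i : Fin 3) :
    HasFDerivAt (dZ i (onRays (pistonPath b)))
      (p.1 • fderiv ℝ (dZ i (onRays b)) p +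
        dZ i (onRays b) p • ContinuousLinearMap.fst ℝ ℝ E3) p := by
  have h := hasFDerivAt_fst.mul
    (((hb.smooth p ht hp).dZ (n := 1) (by norm_num; exact two_le_infty) i).differentiableAt
      (by norm_num)).hasFDerivAt
  exact h.congr_of_eventuallyEq ((IsPistonClose.eventually_pos ht hp).mono fun q hq =>
    hb.dZ_path hq.1 hq.2 i)

theorem IsPistonClose.path_bounds (hb : IsPistonClose b₀ δ b) {p : ℝ × E3} (ht : 1 ≤ p.1)
    (hp : p.2 ≠ 0) :
    (∀ i, |dZ i (onRays (pistonPath b)) p| ≤ p.1 * δ) ∧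
    (∀ i k, |dZ k (dZ i (onRays (pistonPath b))) p| ≤ p.1 * δ) ∧
    (∀ i, |dt (dZ i (onRays (pistonPath b))) p| ≤ 2 * δ) ∧
    |dt (onRays (pistonPath b)) p| ≤ |b₀| + 2 * δ := by
  have h0 : 0 < p.1 := by linarith
  refine ⟨fun i => ?_, fun i k => ?_, fun i => ?_, ?_⟩
  · rw [hb.dZ_path h0 hp, abs_mul, abs_of_pos h0]
    exact mul_le_mul_of_nonneg_left (hb.angular p ht hp i) h0.le
  · have e : dZ k (dZ i (onRays (pistonPath b))) p = p.1 * dZ k (dZ i (onRays b)) p := by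
      rw [dZ, (hb.hasFDerivAt_dZ_path h0 hp i).fderiv]
      simp [dZ]
    rw [e, abs_mul, abs_of_pos h0]
    exact mul_le_mul_of_nonneg_left (hb.angular_angular p ht hp i k) h0.le
  · have e : dt (dZ i (onRays (pistonPath b))) p =
        p.1 * dt (dZ i (onRays b)) p + dZ i (onRays b) p := by
      rw [dt, (hb.hasFDerivAt_dZ_path h0 hp i).fderiv]
      simp [dt]
    rw [e]
    refine (abs_add_le _ _).trans ?_
    linarith [hb.time_angular p ht hp i, hb.angular p ht hp i]
  · rw [hb.dt_path h0 hp]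
    refine (abs_add_le _ _).trans ?_
    have h1 := hb.time p ht hp
    have h2 := hb.speed p ht hp
    have h3 : |onRays b p| ≤ |b₀| + |onRays b p - b₀| := by
      simpa using abs_add_le b₀ (onRays b p - b₀)
    linarith

end Piston

/-! ### Bounds on the corrector -/

namespace Background

variable {G : Gas} {b₀ : ℝ} (bg : Background G b₀)

/-- The datum of the transport problem of the corrector, multiplied by `t`, as a function of
`σ / t` and `∂_t σ - σ / t`. -/
noncomputable def wallDatum (z : ℝ × ℝ) : ℝ := (z.1 + z.2 - bg.u z.1) / bg.profile z.1

/-- Near the piston `|û - b₀| ≤ 3 |z.1 - b₀|` because `û'(b₀) = -2`, so the numerator is at most `5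
δ`. By continuity `|φ̂|` stays above half of `(s₀ - b₀) û(s₀)`. The bound on the datum is thus
explicit, while `L` is a continuity constant of the background. -/
theorem exists_wallDatum_bounds (hb : 0 < b₀) : ∃ d : ℝ, 0 < d ∧ ∃ L : ℝ, 0 ≤ L ∧
    ∀ z : ℝ × ℝ, |z.1 - b₀| ≤ d → |z.2| ≤ d →
      DifferentiableAt ℝ bg.wallDatum z ∧ ‖fderiv ℝ bg.wallDatum z‖ ≤ L ∧
      ∀ δ, |z.1 - b₀| ≤ δ → |z.2| ≤ δ →
        |bg.wallDatum z| ≤ 10 * δ / ((bg.s₀ - b₀) * bg.u bg.s₀) := by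
  have hu0 := bg.u_pos hb bg.shock_mem
  have hs0 : 0 < bg.s₀ - b₀ := sub_pos.2 bg.b₀_lt_s₀
  have hprod : 0 < (bg.s₀ - b₀) * bg.u bg.s₀ := mul_pos hs0 hu0
  have hpw := bg.profile_wall_le hb
  have hwall := bg.mem_Ioo_of_mem_Icc bg.wall_mem
  have hcu : ContDiffAt ℝ 1 (fun z : ℝ × ℝ => bg.u z.1) (b₀, 0) :=
    (bg.contDiffAt_u hb bg.wall_mem).comp (b₀, (0 : ℝ)) contDiffAt_fst
  have hcp : ContDiffAt ℝ 1 (fun z : ℝ × ℝ => bg.profile z.1) (b₀, 0) :=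
    (bg.contDiffAt_profile hwall).comp (b₀, (0 : ℝ)) contDiffAt_fst
  have hP : ContDiffAt ℝ 1 bg.wallDatum (b₀, 0) :=
    ((contDiffAt_fst.add contDiffAt_snd).sub hcu).div hcp (by dsimp only; linarith)
  have e1 : ∀ᶠ z in nhds ((b₀ : ℝ), (0 : ℝ)), DifferentiableAt ℝ bg.wallDatum z :=
    (hP.eventually (by simp)).mono fun z hz => hz.differentiableAt (by norm_num)
  have e2 : ∀ᶠ z in nhds ((b₀ : ℝ), (0 : ℝ)),
      ‖fderiv ℝ bg.wallDatum z‖ < ‖fderiv ℝ bg.wallDatum (b₀, 0)‖ + 1 :=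
    (hP.fderiv_right (m := 0) (by norm_num)).continuousAt.norm.eventually
      (gt_mem_nhds (lt_add_one _))
  have e3 : ∀ᶠ z in nhds ((b₀ : ℝ), (0 : ℝ)),
      bg.profile z.1 < -((bg.s₀ - b₀) * bg.u bg.s₀) / 2 :=
    hcp.continuousAt.eventually (gt_mem_nhds (by dsimp only; linarith))
  have e4 : ∀ᶠ z in nhds ((b₀ : ℝ), (0 : ℝ)), ‖bg.u z.1 - bg.u b₀‖ ≤ 3 * ‖z.1 - b₀‖ := by
    have h := (bg.hasDerivAt_u_wall hb).isLittleO.bound (c := 1) one_pos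
    have h' : ∀ᶠ x in nhds b₀, ‖bg.u x - bg.u b₀‖ ≤ 3 * ‖x - b₀‖ := by
      filter_upwards [h] with x hx
      simp only [Real.norm_eq_abs, smul_eq_mul, one_mul] at hx ⊢
      have h1 : bg.u x - bg.u b₀ = (bg.u x - bg.u b₀ - (x - b₀) * -2) + (x - b₀) * -2 := by ring
      rw [h1]
      refine (abs_add_le _ _).trans ?_
      rw [abs_mul, abs_neg, abs_two]
      linarith
    exact (continuousAt_fst (p := (b₀, (0 : ℝ)))).eventually h'
  obtain ⟨d, hd, hball⟩ := Metric.eventually_nhds_iff_ball.1 (e1.and (e2.and (e3.and e4)))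
  refine ⟨d / 2, by positivity, ‖fderiv ℝ bg.wallDatum (b₀, 0)‖ + 1, by positivity,
    fun z h1 h2 => ?_⟩
  have hz : z ∈ Metric.ball ((b₀ : ℝ), (0 : ℝ)) d := by
    rw [Metric.mem_ball, Prod.dist_eq, Real.dist_eq, Real.dist_eq, sub_zero]
    exact max_lt (by linarith) (by linarith)
  obtain ⟨f1, f2, f3, f4⟩ := hball z hz
  refine ⟨f1, f2.le, fun δ hδ1 hδ2 => ?_⟩
  simp only [Real.norm_eq_abs, bg.wall] at f4
  have hneg : bg.profile z.1 < 0 := by linarith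
  rw [wallDatum, abs_div, abs_of_neg hneg, div_le_div_iff₀ (by linarith) hprod]
  have hnum : |z.1 + z.2 - bg.u z.1| ≤ 5 * δ := by
    have : z.1 + z.2 - bg.u z.1 = (z.1 - b₀) + z.2 - (bg.u z.1 - b₀) := by ring
    rw [this]
    have := abs_sub (z.1 - b₀ + z.2) (bg.u z.1 - b₀)
    have := abs_add_le (z.1 - b₀) z.2
    linarith
  have hδ0 : 0 ≤ δ := (abs_nonneg _).trans hδ1
  nlinarith [mul_le_mul_of_nonneg_right hnum hprod.le]

/-- `t` times the datum of the transport problem of the corrector. -/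
noncomputable def wallSource (b : ℝ → E3 → ℝ) (p : ℝ × E3) : ℝ :=
  bg.wallDatum (onRays b p, p.1 * dt (onRays b) p)

end Background

/-! ### Transport equations for the derivatives of the corrector -/

section Corrector

variable {G : Gas} {b₀ δ : ℝ} {bg : Background G b₀} {b : ℝ → E3 → ℝ} {f : ℝ × E3 → ℝ}

theorem IsPistonClose.le_path (hb : IsPistonClose b₀ δ b) (hδ : δ ≤ b₀ / 2) {p : ℝ × E3}
    (ht : 1 ≤ p.1) (hp : p.2 ≠ 0) : p.1 * (b₀ / 2) ≤ onRays (pistonPath b) p := by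
  have h := (abs_le.1 (hb.speed p ht hp)).1
  rw [onRays_pistonPath]
  exact mul_le_mul_of_nonneg_left (by linarith) (by linarith)

theorem IsCorrector.fderiv_wallField (hf : IsCorrector bg (pistonPath b) f)
    (hb : IsPistonClose b₀ δ b) {p : ℝ × E3} (ht : 0 < p.1) (hp : p.2 ≠ 0)
    (hr : onRays (pistonPath b) p ≤ ‖p.2‖) :
    fderiv ℝ f p (wallField (pistonPath b) p) = p.1⁻¹ * bg.wallSource b p := by
  have h := hf.transport p ht hp hr
  have e : onRays (pistonPath b) p / p.1 = onRays b p := by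
    rw [onRays_pistonPath]; field_simp
  rw [wallOp_eq_fderiv, e, hb.dt_path ht hp] at h
  rw [h, Background.wallSource, Background.wallDatum]
  simp only [div_eq_mul_inv, mul_inv]
  ring

/-- Chain rule. The factor 2 in the last bound comes from `t ∂_t (t ∂_t b) = t ∂_t b + t² ∂_t² b`.
-/
theorem IsPistonClose.wallSource_bounds (hb : IsPistonClose b₀ δ b) {d L : ℝ} (hδ : δ ≤ d)
    (hL : ∀ z : ℝ × ℝ, |z.1 - b₀| ≤ d → |z.2| ≤ d →
      DifferentiableAt ℝ bg.wallDatum z ∧ ‖fderiv ℝ bg.wallDatum z‖ ≤ L ∧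
      ∀ δ, |z.1 - b₀| ≤ δ → |z.2| ≤ δ →
        |bg.wallDatum z| ≤ 10 * δ / ((bg.s₀ - b₀) * bg.u bg.s₀))
    {p : ℝ × E3} (ht : 1 ≤ p.1) (hp : p.2 ≠ 0) :
    DifferentiableAt ℝ (bg.wallSource b) p ∧
    |bg.wallSource b p| ≤ 10 * δ / ((bg.s₀ - b₀) * bg.u bg.s₀) ∧
    (∀ k, |dZ k (bg.wallSource b) p| ≤ L * δ) ∧
    |p.1 * dt (bg.wallSource b) p| ≤ L * (2 * δ) := by
  have h0 : 0 < p.1 := by linarith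
  have h1 := hb.speed p ht hp
  have h2 := hb.time p ht hp
  obtain ⟨f1, f2, f3⟩ := hL (onRays b p, p.1 * dt (onRays b) p) (h1.trans hδ) (h2.trans hδ)
  have hβ := ((hb.smooth p h0 hp).differentiableAt (by simp)).hasFDerivAt
  have hβt := (((hb.smooth p h0 hp).dt (n := 1)
    (by norm_num; exact two_le_infty)).differentiableAt (by norm_num)).hasFDerivAt
  have hin : HasFDerivAt (fun q : ℝ × E3 => (onRays b q, q.1 * dt (onRays b) q)) _ p :=
    hβ.prodMk (hasFDerivAt_fst.mul hβt)
  have hN : HasFDerivAt (bg.wallSource b) _ p := HasFDerivAt.comp p f1.hasFDerivAt hin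
  have hL0 : 0 ≤ L := (norm_nonneg _).trans f2
  have hbd : ∀ (z : ℝ × ℝ) (c : ℝ), |z.1| ≤ c → |z.2| ≤ c →
      |fderiv ℝ bg.wallDatum (onRays b p, p.1 * dt (onRays b) p) z| ≤ L * c := by
    intro z c hz1 hz2
    refine (ContinuousLinearMap.le_opNorm _ _).trans (mul_le_mul f2 ?_ (norm_nonneg _) hL0)
    exact max_le hz1 hz2
  have hδ0 : 0 ≤ δ := (abs_nonneg _).trans h1
  refine ⟨hN.differentiableAt, f3 δ h1 h2, fun k => ?_, ?_⟩
  · rw [dZ, hN.fderiv, ContinuousLinearMap.comp_apply]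
    refine hbd _ _ ?_ ?_
    · simpa [dZ] using hb.angular p ht hp k
    · have h3 := hb.time_angular p ht hp k
      rw [dt_dZ_comm ((hb.smooth p h0 hp).of_le two_le_infty)] at h3
      simpa [dZ] using h3
  · rw [dt, hN.fderiv, ContinuousLinearMap.comp_apply]
    rw [← smul_eq_mul, ← map_smul]
    refine hbd _ _ ?_ ?_
    · have : |p.1 * dt (onRays b) p| ≤ 2 * δ := by linarith
      simpa [dt] using this
    · have h4 := hb.time_time p ht hp
      have h5 : |p.1 * (p.1 * dt (dt (onRays b)) p + dt (onRays b) p)| ≤ 2 * δ := by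
        have : p.1 * (p.1 * dt (dt (onRays b)) p + dt (onRays b) p) =
          p.1 ^ 2 * dt (dt (onRays b)) p + p.1 * dt (onRays b) p := by ring
        rw [this]
        exact (abs_add_le _ _).trans (by linarith)
      simpa [dt] using h5

theorem IsCorrector.eventually_transport (hf : IsCorrector bg (pistonPath b) f)
    (hb : IsPistonClose b₀ δ b) {p : ℝ × E3} (ht : 0 < p.1) (hp : p.2 ≠ 0)
    (hr : onRays (pistonPath b) p < ‖p.2‖) :
    (fun q => fderiv ℝ f q (wallField (pistonPath b) q)) =ᶠ[nhds p]
      fun q => q.1⁻¹ * bg.wallSource b q := by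
  have h1 : ∀ᶠ q in nhds p, 0 < ‖q.2‖ - onRays (pistonPath b) q :=
    (continuous_snd.continuousAt.norm.sub (hb.contDiffAt_path ht hp).continuousAt).eventually
      (lt_mem_nhds (sub_pos.2 hr))
  filter_upwards [h1, IsPistonClose.eventually_pos ht hp] with q hq1 hq2
  exact hf.fderiv_wallField hb hq2.1 hq2.2 (by linarith)

/-- Rotations commute with `∂_r` and with `r`, so commuting `Z_k` with the field leaves only `Z_k
Z_i σ` and the brackets `[Z_i, Z_k]`. Every such term is an angular derivative of `f` with a small
coefficient built from `σ`. -/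
theorem IsCorrector.fderiv_dZ_wallField (hf : IsCorrector bg (pistonPath b) f)
    (hb : IsPistonClose b₀ δ b) {p : ℝ × E3} (ht : 0 < p.1) (hp : p.2 ≠ 0)
    (hr : onRays (pistonPath b) p < ‖p.2‖) (hN : DifferentiableAt ℝ (bg.wallSource b) p)
    (k : Fin 3) :
    fderiv ℝ (dZ k f) p (wallField (pistonPath b) p) = p.1⁻¹ * dZ k (bg.wallSource b) p +
      ∑ i, (‖p.2‖ ^ 2)⁻¹ * (dZ k (dZ i (onRays (pistonPath b))) p * dZ i f p +
        dZ i (onRays (pistonPath b)) p *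
          fderiv ℝ f p (0, rotVec i (rotVec k p.2) - rotVec k (rotVec i p.2))) := by
  have hσ : ContDiffAt ℝ 2 (onRays (pistonPath b)) p :=
    (hb.contDiffAt_path ht hp).of_le two_le_infty
  have hV := (contDiffAt_wallField hp hσ).differentiableAt (by norm_num)
  have hcomm := fderiv_fderiv_apply_comm ((hf.smooth p ht hp hr.le).of_le two_le_infty) hV
    (rotField k).differentiableAt
  rw [(hf.eventually_transport hb ht hp hr).fderiv_eq] at hcomm
  have hprod : HasFDerivAt (fun q : ℝ × E3 => q.1⁻¹ * bg.wallSource b q) _ p :=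
    (HasFDerivAt.comp (g := Inv.inv) p (hasDerivAt_inv ht.ne').hasFDerivAt
      hasFDerivAt_fst).mul hN.hasFDerivAt
  rw [hprod.fderiv, ContinuousLinearMap.fderiv, fderiv_wallField_apply hp hσ
    (inner_rotVec k p.2)] at hcomm
  refine hcomm.trans ?_
  congr 1
  · simp [dZ]
  · have hk : rotVec k (wallField (pistonPath b) p).2 = ‖p.2‖⁻¹ • rotVec k p.2 -
        ∑ i, ((‖p.2‖ ^ 2)⁻¹ * dZ i (onRays (pistonPath b)) p) • rotVec k (rotVec i p.2) := by
      simp only [← rotL_apply k, wallField, map_sub, map_smul, map_sum]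
    have hvec : rotField k (wallField (pistonPath b) p) - ((0 : ℝ), ‖p.2‖⁻¹ • rotVec k p.2 -
        ∑ i, (‖p.2‖ ^ 2)⁻¹ •
          (fderiv ℝ (dZ i (onRays (pistonPath b))) p (rotField k p) • rotVec i p.2 +
            dZ i (onRays (pistonPath b)) p • rotVec i (rotVec k p.2))) =
        ∑ i, (‖p.2‖ ^ 2)⁻¹ • (dZ k (dZ i (onRays (pistonPath b))) p • ((0 : ℝ), rotVec i p.2) +
          dZ i (onRays (pistonPath b)) p •
            ((0 : ℝ), rotVec i (rotVec k p.2) - rotVec k (rotVec i p.2))) := by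
      rw [rotField_apply, hk]
      simp only [Fin.sum_univ_three]
      refine Prod.ext (by simp) ?_
      simp only [Prod.mk_sub_mk, Prod.snd_add, Prod.smul_snd, dZ, rotField_apply]
      module
    refine (congrArg (fderiv ℝ f p) hvec).trans ?_
    simp only [map_sum, map_smul, map_add, smul_eq_mul]
    rfl

/-- The time derivative only sees the coefficients `Z_i σ` of the field, so the coupling is to `Z_i
f` alone. Hence angular derivatives are estimated before `∂_t f`. -/
theorem IsCorrector.fderiv_dt_wallField (hf : IsCorrector bg (pistonPath b) f)
    (hb : IsPistonClose b₀ δ b) {p : ℝ × E3} (ht : 0 < p.1) (hp : p.2 ≠ 0)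
    (hr : onRays (pistonPath b) p < ‖p.2‖) (hN : DifferentiableAt ℝ (bg.wallSource b) p) :
    fderiv ℝ (dt f) p (wallField (pistonPath b) p) =
      p.1⁻¹ * dt (bg.wallSource b) p - (p.1 ^ 2)⁻¹ * bg.wallSource b p +
      ∑ i, (‖p.2‖ ^ 2)⁻¹ * (dt (dZ i (onRays (pistonPath b))) p * dZ i f p) := by
  have hσ : ContDiffAt ℝ 2 (onRays (pistonPath b)) p :=
    (hb.contDiffAt_path ht hp).of_le two_le_infty
  have hV := (contDiffAt_wallField hp hσ).differentiableAt (by norm_num)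
  have hcomm := fderiv_fderiv_apply_comm ((hf.smooth p ht hp hr.le).of_le two_le_infty) hV
    (X := fun _ => ((1 : ℝ), (0 : E3))) (differentiableAt_const _)
  rw [(hf.eventually_transport hb ht hp hr).fderiv_eq] at hcomm
  have hprod : HasFDerivAt (fun q : ℝ × E3 => q.1⁻¹ * bg.wallSource b q) _ p :=
    (HasFDerivAt.comp (g := Inv.inv) p (hasDerivAt_inv ht.ne').hasFDerivAt
      hasFDerivAt_fst).mul hN.hasFDerivAt
  have h0 : ∀ i, rotVec i 0 = 0 := fun i => map_zero (rotL i)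
  have hc0 : fderiv ℝ (fun _ : ℝ × E3 => ((1 : ℝ), (0 : E3))) p = 0 := by simp
  rw [hprod.fderiv, hc0, fderiv_wallField_apply hp hσ (by simp)] at hcomm
  refine hcomm.trans ?_
  congr 1
  · simp [dt]
    ring
  · have hvec : (0 : ℝ × E3 →L[ℝ] ℝ × E3) (wallField (pistonPath b) p) -
        ((0 : ℝ), ‖p.2‖⁻¹ • (0 : E3) - ∑ i, (‖p.2‖ ^ 2)⁻¹ •
          (fderiv ℝ (dZ i (onRays (pistonPath b))) p (1, 0) • rotVec i p.2 +
            dZ i (onRays (pistonPath b)) p • rotVec i 0)) =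
        ∑ i, (‖p.2‖ ^ 2)⁻¹ •
          (dt (dZ i (onRays (pistonPath b))) p • ((0 : ℝ), rotVec i p.2)) := by
      simp only [Fin.sum_univ_three, h0, _root_.zero_apply]
      refine Prod.ext (by simp) ?_
      simp only [Prod.snd_sub, Prod.snd_zero, Prod.snd_add, Prod.smul_snd, dt]
      module
    refine (congrArg (fderiv ℝ f p) hvec).trans ?_
    simp only [map_sum, map_smul, smul_eq_mul]
    rfl

/-- Since `f = 0` on the piston, all derivatives are multiples of `∂_r f` there. The transport
equation becomes `∂_r f (1 + r⁻² ∑ (Z_i σ)²) = wallSource / t`, and the bracket is at least one. -/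
theorem IsCorrector.wall_derivatives (hf : IsCorrector bg (pistonPath b) f)
    (hb : IsPistonClose b₀ δ b) {p : ℝ × E3} (ht : 1 ≤ p.1)
    (hp : p.2 ≠ 0) (hr : onRays (pistonPath b) p = ‖p.2‖) :
    |dr f p| ≤ p.1⁻¹ * |bg.wallSource b p| ∧
    dt f p = -(dt (onRays (pistonPath b)) p * dr f p) ∧
    ∀ k, dZ k f p = -(dZ k (onRays (pistonPath b)) p * dr f p) := by
  have h0 : 0 < p.1 := by linarith
  have hn : 0 < ‖p.2‖ := norm_pos_iff.2 hp
  have hσ := (hb.contDiffAt_path h0 hp).differentiableAt (by simp)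
  have hev : ∀ᶠ q in nhds p,
      f (q.1, (onRays (pistonPath b) q * ‖q.2‖⁻¹) • q.2) = 0 := by
    have h1 : ∀ᶠ q in nhds p, 0 < onRays (pistonPath b) q :=
      hσ.continuousAt.eventually (lt_mem_nhds (by rw [hr]; exact hn))
    filter_upwards [h1, IsPistonClose.eventually_pos h0 hp] with q hq1 hq2
    have hqn : 0 < ‖q.2‖ := norm_pos_iff.2 hq2.2
    refine hf.wall _ hq2.1 (smul_ne_zero (by positivity) hq2.2) ?_
    rw [onRays_smul _ _ _ (by positivity)]
    simp only [norm_smul, norm_mul, norm_inv, Real.norm_eq_abs, abs_of_pos hq1, abs_norm]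
    field_simp
  obtain ⟨e1, e2⟩ := tangential_derivatives hp hσ
    ((hf.smooth p h0 hp hr.le).differentiableAt (by simp)) hr hev
  refine ⟨?_, by linarith, fun k => by linarith [e2 k]⟩
  have htr := hf.fderiv_wallField hb h0 hp hr.le
  rw [← wallOp_eq_fderiv, wallOp] at htr
  have hsum : dr f p * (1 + 1 / ‖p.2‖ ^ 2 * ∑ i, dZ i (onRays (pistonPath b)) p ^ 2) =
      p.1⁻¹ * bg.wallSource b p := by
    rw [← htr]
    have : ∀ i, dZ i f p = -(dZ i (onRays (pistonPath b)) p * dr f p) := fun i => by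
      linarith [e2 i]
    simp only [this, Fin.sum_univ_three]
    ring
  have h1 : 0 ≤ 1 / ‖p.2‖ ^ 2 * ∑ i, dZ i (onRays (pistonPath b)) p ^ 2 :=
    mul_nonneg (by positivity) (Finset.sum_nonneg fun _ _ => sq_nonneg _)
  have h2 : |dr f p| * (1 + 1 / ‖p.2‖ ^ 2 * ∑ i, dZ i (onRays (pistonPath b)) p ^ 2) =
      p.1⁻¹ * |bg.wallSource b p| := by
    rw [← abs_of_nonneg (by linarith :
      0 ≤ 1 + 1 / ‖p.2‖ ^ 2 * ∑ i, dZ i (onRays (pistonPath b)) p ^ 2), ← abs_mul, hsum, abs_mul,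
      abs_of_pos (inv_pos.2 h0)]
  nlinarith [abs_nonneg (dr f p)]

end Corrector

/-! ### Bounds on the corrector by comparison -/

section CorrectorBounds

variable {G : Gas} {b₀ δ : ℝ} {bg : Background G b₀} {b : ℝ → E3 → ℝ} {f : ℝ × E3 → ℝ}

/-- `F` is bounded, up to its values on the piston, by a bound of `𝓑_σ F`. -/
theorem IsPistonClose.comparison (hb : IsPistonClose b₀ δ b) (hb0 : 0 < b₀) (hδ : δ ≤ b₀ / 2)
    {s : ℝ} (hδs : b₀ - δ ≥ b₀ - s / 2) {F : ℝ × E3 → ℝ} {t κ B : ℝ} {x : E3}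
    (ht : 1 ≤ t)
    (hF : ∀ x : E3, x ≠ 0 → onRays (pistonPath b) (t, x) ≤ ‖x‖ → DifferentiableAt ℝ F (t, x))
    (hin : ∀ y : E3, y ≠ 0 → onRays (pistonPath b) (t, y) < ‖y‖ → ‖y‖ ≤ ‖x‖ →
      fderiv ℝ F (t, y) (wallField (pistonPath b) (t, y)) ≤ κ / t)
    (hbd : ∀ x : E3, x ≠ 0 → onRays (pistonPath b) (t, x) = ‖x‖ → F (t, x) ≤ B)
    (hκ : 0 ≤ κ) (hx : x ≠ 0) (hσx : onRays (pistonPath b) (t, x) ≤ ‖x‖)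
    (hxR : ‖x‖ ≤ t * (b₀ + s + s / 2)) : F (t, x) ≤ B + 2 * κ * s := by
  have h0 : 0 < t := by linarith
  have h := wallField_comparison (σ := pistonPath b) (F := F) (t := t) (R := ‖x‖) (B := B)
    (κ := κ / t) (c := t * (b₀ / 2)) (by positivity)
    (fun y hy => hb.le_path hδ (p := (t, y)) ht hy)
    (fun y hy => (hb.contDiffAt_path (p := (t, y)) h0 hy).differentiableAt (by simp))
    (fun y hy h1 _ => hF y hy h1) hin
    (fun y hy h1 _ => hbd y hy h1) (by positivity) hx hσx le_rfl
  refine h.trans (add_le_add_right ?_ B)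
  have h1 := (abs_le.1 (hb.speed (t, x) ht hx)).1
  have h2 : t * (b₀ - s / 2) ≤ onRays (pistonPath b) (t, x) := by
    rw [onRays_pistonPath]
    exact mul_le_mul_of_nonneg_left (by linarith) h0.le
  -- The layer reaches from `t (b₀ - s/2)` to `t (b₀ + 3 s/2)`; its thickness `2 s t` cancels the
  -- decay of the source.
  calc κ / t * (‖x‖ - onRays (pistonPath b) (t, x)) ≤ κ / t * (t * (2 * s)) := by
        refine mul_le_mul_of_nonneg_left ?_ (by positivity)
        linarith
    _ = 2 * κ * s := by field_simp

theorem IsPistonClose.inv_sq_le (hb : IsPistonClose b₀ δ b) (hb0 : 0 < b₀) (hδ : δ ≤ b₀ / 2)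
    {p : ℝ × E3} (ht : 1 ≤ p.1) (hp : p.2 ≠ 0) (hr : onRays (pistonPath b) p ≤ ‖p.2‖) :
    (‖p.2‖ ^ 2)⁻¹ ≤ 4 / b₀ ^ 2 / p.1 ^ 2 := by
  have h0 : 0 < p.1 := by linarith
  have h1 := (hb.le_path hδ ht hp).trans hr
  have h2 : (p.1 * (b₀ / 2)) ^ 2 ≤ ‖p.2‖ ^ 2 := pow_le_pow_left₀ (by positivity) h1 2
  refine (inv_anti₀ (by positivity) h2).trans (le_of_eq ?_)
  field_simp
  norm_num

theorem IsCorrector.abs_value_le (hf : IsCorrector bg (pistonPath b) f) (hb : IsPistonClose b₀ δ b)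
    (hb0 : 0 < b₀) (hδ0 : 0 ≤ δ) (hδ : δ ≤ b₀ / 2) {s N : ℝ} (hs : δ ≤ s / 2)
    (hN : ∀ p : ℝ × E3, 1 ≤ p.1 → p.2 ≠ 0 → |bg.wallSource b p| ≤ N * δ) (hN0 : 0 ≤ N)
    {p : ℝ × E3} (ht : 1 ≤ p.1) (hp : p.2 ≠ 0) (hr : onRays (pistonPath b) p ≤ ‖p.2‖)
    (hR : ‖p.2‖ ≤ p.1 * (b₀ + s + s / 2)) : |f p| ≤ 2 * (N * δ) * s := by
  obtain ⟨t, x⟩ := p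
  simp only at ht hp hR hr
  have h0 : 0 < t := by linarith
  have hd : ∀ y : E3, y ≠ 0 → onRays (pistonPath b) (t, y) ≤ ‖y‖ → DifferentiableAt ℝ f (t, y) :=
    fun y hy h1 => (hf.smooth (t, y) h0 hy h1).differentiableAt (by simp)
  have hin : ∀ y : E3, y ≠ 0 → onRays (pistonPath b) (t, y) ≤ ‖y‖ →
      |fderiv ℝ f (t, y) (wallField (pistonPath b) (t, y))| ≤ N * δ / t := by
    intro y hy h1
    rw [hf.fderiv_wallField hb (p := (t, y)) h0 hy h1, abs_mul, abs_of_pos (inv_pos.2 h0),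
      inv_mul_eq_div]
    exact div_le_div_of_nonneg_right (hN (t, y) ht hy) h0.le
  rw [abs_le']
  constructor
  · have h := hb.comparison hb0 hδ (s := s) (by linarith) (F := f) (κ := N * δ) (B := 0) ht hd
      (fun y hy h1 _ => (abs_le.1 (hin y hy h1.le)).2)
      (fun y hy h1 => (hf.wall (t, y) h0 hy h1).le) (by positivity) hp hr hR
    linarith
  · have h := hb.comparison hb0 hδ (s := s) (by linarith) (F := fun q => -f q) (κ := N * δ) (B := 0)
      ht (fun y hy h1 => (hd y hy h1).neg)
      (fun y hy h1 _ => by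
        rw [fderiv_fun_neg, _root_.neg_apply]
        linarith [(abs_le.1 (hin y hy h1.le)).1])
      (fun y hy h1 => by rw [hf.wall (t, y) h0 hy h1, neg_zero]) (by positivity) hp hr hR
    linarith

/-- The `Z_k f` solve a coupled system, and passing to `log (1 + ∑ (Z_k f)²)` turns Gronwall growth
into a bounded rate to which the comparison applies. The boundary value `log 4` reflects three
squares, each at most one. Boundedness without smallness suffices: later these derivatives carry a
factor `δ` or `φ̂(s₀ + ξ)`. -/
theorem IsCorrector.abs_dZ_le (hf : IsCorrector bg (pistonPath b) f) (hb : IsPistonClose b₀ δ b)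
    (hb0 : 0 < b₀) (hδ0 : 0 ≤ δ) (hδ : δ ≤ b₀ / 2) (hδ1 : δ ≤ 1) {s N L : ℝ} (hs : δ ≤ s / 2)
    (hNd : ∀ p : ℝ × E3, 1 ≤ p.1 → p.2 ≠ 0 → DifferentiableAt ℝ (bg.wallSource b) p)
    (hN : ∀ p : ℝ × E3, 1 ≤ p.1 → p.2 ≠ 0 → |bg.wallSource b p| ≤ N * δ) (hN1 : N * δ ≤ 1)
    (hZ : ∀ p : ℝ × E3, 1 ≤ p.1 → p.2 ≠ 0 → ∀ k, |dZ k (bg.wallSource b) p| ≤ L * δ)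
    (hL0 : 0 ≤ L)
    {p : ℝ × E3} (ht : 1 ≤ p.1) (hp : p.2 ≠ 0) (hr : onRays (pistonPath b) p ≤ ‖p.2‖)
    (hR : ‖p.2‖ ≤ p.1 * (b₀ + s + s / 2)) (k : Fin 3) :
    |dZ k f p| ≤ Real.exp (Real.log 4 + 2 * (4 * L + 96 / b₀ ^ 2) * s) := by
  obtain ⟨t, x⟩ := p
  simp only at ht hp hR hr
  have h0 : 0 < t := by linarith
  have hs0 : 0 ≤ s := by linarith
  have hsm : ∀ y : E3, y ≠ 0 → onRays (pistonPath b) (t, y) ≤ ‖y‖ → ∀ k,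
      DifferentiableAt ℝ (dZ k f) (t, y) := fun y hy h1 k =>
    (((hf.smooth (t, y) h0 hy h1).of_le two_le_infty).dZ (n := 1)
      (by norm_num) k).differentiableAt (by norm_num)
  set F : ℝ × E3 → ℝ := fun q => Real.log (1 + ∑ k, dZ k f q ^ 2) with hF
  have hq0 : ∀ q, 0 ≤ ∑ k, dZ k f q ^ 2 := fun q => Finset.sum_nonneg fun _ _ => sq_nonneg _
  have hFd : ∀ y : E3, y ≠ 0 → onRays (pistonPath b) (t, y) ≤ ‖y‖ →
      HasFDerivAt F ((1 + ∑ k, dZ k f (t, y) ^ 2)⁻¹ •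
        ∑ k, (2 * dZ k f (t, y)) • fderiv ℝ (dZ k f) (t, y)) (t, y) := by
    intro y hy h1
    have h2 : HasFDerivAt (fun q => 1 + ∑ k, dZ k f q ^ 2)
        (∑ k, (2 * dZ k f (t, y)) • fderiv ℝ (dZ k f) (t, y)) (t, y) := by
      refine (HasFDerivAt.fun_sum fun k _ => ?_).const_add 1
      refine ((hsm y hy h1 k).hasFDerivAt.pow 2).congr_fderiv ?_
      simp
    exact h2.log (by linarith [hq0 (t, y)])
  have hcomp := hb.comparison hb0 hδ (s := s) (by linarith) (F := F)
    (κ := 4 * L + 96 / b₀ ^ 2) (B := Real.log 4) ht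
    (fun y hy h1 => (hFd y hy h1).differentiableAt) ?_ ?_ (by positivity) hp hr hR
  · have h1 : 1 + ∑ k, dZ k f (t, x) ^ 2 ≤
        Real.exp (Real.log 4 + 2 * (4 * L + 96 / b₀ ^ 2) * s) := by
      rw [← Real.exp_log (by linarith [hq0 (t, x)] : 0 < 1 + ∑ k, dZ k f (t, x) ^ 2)]
      exact Real.exp_le_exp.2 hcomp
    have h2 : dZ k f (t, x) ^ 2 ≤ ∑ k, dZ k f (t, x) ^ 2 :=
      Finset.single_le_sum (f := fun k => dZ k f (t, x) ^ 2) (fun _ _ => sq_nonneg _)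
        (Finset.mem_univ k)
    have h3 : |dZ k f (t, x)| ≤ 1 + dZ k f (t, x) ^ 2 := by
      rw [← sq_abs]; nlinarith [sq_nonneg (|dZ k f (t, x)| - 1)]
    linarith
  · intro y hy h1 _
    rw [(hFd y hy h1.le).fderiv]
    have hbr := fun k => hf.fderiv_dZ_wallField hb (p := (t, y)) h0 hy h1 (hNd (t, y) ht hy) k
    obtain ⟨b1, b2, -, -⟩ := hb.path_bounds (p := (t, y)) ht hy
    have hinv := hb.inv_sq_le hb0 hδ (p := (t, y)) ht hy h1.le
    have hcm := fun i k => abs_fderiv_commutator_le f (t, y) i k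
    simp only at hbr b1 b2 hinv hcm
    set S := ∑ j, |dZ j f (t, y)| with hS
    have hS0 : 0 ≤ S := Finset.sum_nonneg fun _ _ => abs_nonneg _
    have hVk : ∀ k, |fderiv ℝ (dZ k f) (t, y) (wallField (pistonPath b) (t, y))| ≤
        (L + 16 / b₀ ^ 2 * S) * δ / t := by
      intro k
      rw [hbr k]
      refine (abs_add_le _ _).trans ?_
      have e1 : |t⁻¹ * dZ k (bg.wallSource b) (t, y)| ≤ L * δ / t := by
        rw [abs_mul, abs_of_pos (inv_pos.2 h0), inv_mul_eq_div]
        exact div_le_div_of_nonneg_right (hZ (t, y) ht hy k) h0.le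
      have e2 : |∑ i, (‖y‖ ^ 2)⁻¹ * (dZ k (dZ i (onRays (pistonPath b))) (t, y) * dZ i f (t, y) +
          dZ i (onRays (pistonPath b)) (t, y) *
          fderiv ℝ f (t, y) (0, rotVec i (rotVec k y) - rotVec k (rotVec i y)))| ≤
          4 / b₀ ^ 2 / t ^ 2 * (t * δ * (4 * S)) := by
        have : ∀ i, |(‖y‖ ^ 2)⁻¹ * (dZ k (dZ i (onRays (pistonPath b))) (t, y) * dZ i f (t, y) +
          dZ i (onRays (pistonPath b)) (t, y) *
          fderiv ℝ f (t, y) (0, rotVec i (rotVec k y) - rotVec k (rotVec i y)))| ≤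
          4 / b₀ ^ 2 / t ^ 2 * (t * δ * |dZ i f (t, y)| + t * δ * S) := by
          intro i
          rw [abs_mul, abs_of_nonneg (by positivity : 0 ≤ (‖y‖ ^ 2)⁻¹)]
          refine mul_le_mul hinv ((abs_add_le _ _).trans ?_) (abs_nonneg _) (by positivity)
          rw [abs_mul, abs_mul]
          exact add_le_add (mul_le_mul_of_nonneg_right (b2 i k) (abs_nonneg _))
            (mul_le_mul (b1 i) (hcm i k) (abs_nonneg _) (by positivity))
        refine (Finset.abs_sum_le_sum_abs _ _).trans ((Finset.sum_le_sum fun i _ => this i).trans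
          (le_of_eq ?_))
        rw [hS]
        simp only [Fin.sum_univ_three]
        ring
      refine (add_le_add e1 e2).trans (le_of_eq ?_)
      field_simp
      ring
    rw [_root_.smul_apply, smul_eq_mul, inv_mul_le_iff₀ (by linarith [hq0 (t, y)])]
    simp only [_root_.sum_apply, _root_.smul_apply, smul_eq_mul]
    have e3 : ∑ k, 2 * dZ k f (t, y) * fderiv ℝ (dZ k f) (t, y) (wallField (pistonPath b) (t, y)) ≤
        2 * S * ((L + 16 / b₀ ^ 2 * S) * δ / t) := by
      rw [hS, Finset.mul_sum, Finset.sum_mul]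
      refine Finset.sum_le_sum fun k _ => (le_abs_self _).trans ?_
      rw [abs_mul, abs_mul, abs_two]
      exact mul_le_mul_of_nonneg_left (hVk k) (by positivity)
    have hSq : S ^ 2 ≤ 3 * ∑ k, dZ k f (t, y) ^ 2 := by
      have := sq_sum_le_card_mul_sum_sq (s := Finset.univ) (f := fun j => |dZ j f (t, y)|)
      simpa [hS] using this
    have hX := hq0 (t, y)
    set X := ∑ k, dZ k f (t, y) ^ 2
    have hS1 : S ≤ 2 * (1 + X) := by nlinarith [sq_nonneg (S - 1)]
    -- From `S ≤ 2 (1 + X)` and `S² ≤ 3 X`; division by `1 + X` then gives a rate independent of the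
    -- solution.
    have e4 : 2 * S * (L + 16 / b₀ ^ 2 * S) ≤ (1 + X) * (4 * L + 96 / b₀ ^ 2) := by
      have g1 : S * L ≤ 2 * (1 + X) * L := mul_le_mul_of_nonneg_right hS1 hL0
      have g2 : 16 / b₀ ^ 2 * S ^ 2 ≤ 16 / b₀ ^ 2 * (3 * (1 + X)) :=
        mul_le_mul_of_nonneg_left (by linarith) (by positivity)
      have g3 : 96 / b₀ ^ 2 = 2 * 3 * (16 / b₀ ^ 2) := by ring
      rw [g3]
      nlinarith
    refine e3.trans ?_
    rw [mul_div_assoc', mul_div_assoc']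
    refine div_le_div_of_nonneg_right ?_ h0.le
    rw [← mul_assoc]
    have : 0 ≤ (1 + X) * (4 * L + 96 / b₀ ^ 2) := by positivity
    nlinarith
  · intro y hy h1
    obtain ⟨w1, -, w3⟩ := hf.wall_derivatives hb (p := (t, y)) ht hy h1
    obtain ⟨b1, -, -, -⟩ := hb.path_bounds (p := (t, y)) ht hy
    simp only at w1 w3 b1
    have hk : ∀ k, dZ k f (t, y) ^ 2 ≤ 1 := by
      intro k
      rw [← sq_abs, w3 k, abs_neg, abs_mul]
      have e1 : |dZ k (onRays (pistonPath b)) (t, y)| * |dr f (t, y)| ≤ 1 := by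
        calc _ ≤ t * δ * (t⁻¹ * (N * δ)) := mul_le_mul (b1 k)
              (w1.trans (mul_le_mul_of_nonneg_left (hN (t, y) ht hy) (by positivity)))
              (abs_nonneg _) (by positivity)
          _ = δ * (N * δ) := by field_simp
          _ ≤ 1 * 1 := mul_le_mul hδ1 hN1
              ((abs_nonneg _).trans (hN (t, y) ht hy)) zero_le_one
          _ = 1 := one_mul 1
      exact pow_le_one₀ (by positivity) e1
    refine Real.log_le_log (by linarith [hq0 (t, y)]) ?_
    have := Finset.sum_le_sum (s := Finset.univ) fun k _ => hk k
    simp only [Finset.sum_const, Finset.card_univ, Fintype.card_fin, nsmul_eq_mul, mul_one,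
      Nat.cast_ofNat] at this
    linarith

/-- The coupling coefficients `∂_t Z_i σ` are `O(δ)`, so bounded `Z_i f` still yield a small `t ∂_t
f`. On the piston `∂_t f = -∂_t σ ∂_r f` with `|∂_t σ| ≤ 2 b₀`. -/
theorem IsCorrector.abs_dt_le (hf : IsCorrector bg (pistonPath b) f) (hb : IsPistonClose b₀ δ b)
    (hb0 : 0 < b₀) (hδ0 : 0 ≤ δ) (hδ : δ ≤ b₀ / 2) {s N L A : ℝ} (hs : δ ≤ s / 2)
    (hNd : ∀ p : ℝ × E3, 1 ≤ p.1 → p.2 ≠ 0 → DifferentiableAt ℝ (bg.wallSource b) p)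
    (hN : ∀ p : ℝ × E3, 1 ≤ p.1 → p.2 ≠ 0 → |bg.wallSource b p| ≤ N * δ) (hN0 : 0 ≤ N)
    (hT : ∀ p : ℝ × E3, 1 ≤ p.1 → p.2 ≠ 0 → |p.1 * dt (bg.wallSource b) p| ≤ L * (2 * δ))
    (hL0 : 0 ≤ L) (hA0 : 0 ≤ A)
    (hA : ∀ p : ℝ × E3, 1 ≤ p.1 → p.2 ≠ 0 → onRays (pistonPath b) p ≤ ‖p.2‖ →
      ‖p.2‖ ≤ p.1 * (b₀ + s + s / 2) → ∀ k, |dZ k f p| ≤ A)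
    {p : ℝ × E3} (ht : 1 ≤ p.1) (hp : p.2 ≠ 0) (hr : onRays (pistonPath b) p ≤ ‖p.2‖)
    (hR : ‖p.2‖ ≤ p.1 * (b₀ + s + s / 2)) :
    |p.1 * dt f p| ≤ (2 * b₀ * N + 2 * (2 * L + N + 24 / b₀ ^ 2 * A) * s) * δ := by
  obtain ⟨t, x⟩ := p
  simp only at ht hp hR hr ⊢
  have h0 : 0 < t := by linarith
  have hs0 : 0 ≤ s := by linarith
  set F : ℝ × E3 → ℝ := fun q => t * dt f q with hF
  have hd : ∀ y : E3, y ≠ 0 → onRays (pistonPath b) (t, y) ≤ ‖y‖ →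
      HasFDerivAt F (t • fderiv ℝ (dt f) (t, y)) (t, y) := fun y hy h1 =>
    ((((hf.smooth (t, y) h0 hy h1).of_le two_le_infty).dt (n := 1)
      (by norm_num)).differentiableAt (by norm_num)).hasFDerivAt.const_mul t
  have hdist : ∀ y : E3, ‖y‖ ≤ ‖x‖ → ‖y‖ ≤ t * (b₀ + s + s / 2) := fun y hy => hy.trans hR
  have hin : ∀ y : E3, y ≠ 0 → onRays (pistonPath b) (t, y) < ‖y‖ →
      ‖y‖ ≤ t * (b₀ + s + s / 2) →
      |t * fderiv ℝ (dt f) (t, y) (wallField (pistonPath b) (t, y))| ≤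
        (2 * L + N + 24 / b₀ ^ 2 * A) * δ / t := by
    intro y hy h1 hyR
    rw [hf.fderiv_dt_wallField hb (p := (t, y)) h0 hy h1 (hNd (t, y) ht hy)]
    obtain ⟨-, -, b3, -⟩ := hb.path_bounds (p := (t, y)) ht hy
    have hinv := hb.inv_sq_le hb0 hδ (p := (t, y)) ht hy h1.le
    have hAy := hA (t, y) ht hy h1.le hyR
    have hTy := hT (t, y) ht hy
    have hNy := hN (t, y) ht hy
    simp only at b3 hinv hAy hTy hNy ⊢
    have e2 : |∑ i, (‖y‖ ^ 2)⁻¹ * (dt (dZ i (onRays (pistonPath b))) (t, y) * dZ i f (t, y))| ≤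
        4 / b₀ ^ 2 / t ^ 2 * (6 * δ * A) := by
      have : ∀ i, |(‖y‖ ^ 2)⁻¹ * (dt (dZ i (onRays (pistonPath b))) (t, y) * dZ i f (t, y))| ≤
          4 / b₀ ^ 2 / t ^ 2 * (2 * δ * A) := by
        intro i
        rw [abs_mul, abs_of_nonneg (by positivity : 0 ≤ (‖y‖ ^ 2)⁻¹), abs_mul]
        exact mul_le_mul hinv (mul_le_mul (b3 i) (hAy i) (abs_nonneg _) (by positivity))
          (by positivity) (by positivity)
      refine (Finset.abs_sum_le_sum_abs _ _).trans ((Finset.sum_le_sum fun i _ => this i).trans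
        (le_of_eq ?_))
      simp only [Fin.sum_univ_three]
      ring
    have e0 : ∀ a c d : ℝ, t * (t⁻¹ * a - (t ^ 2)⁻¹ * c + d) = (t * a - c + t ^ 2 * d) / t := by
      intro a c d; field_simp
    rw [e0, abs_div, abs_of_pos h0]
    refine div_le_div_of_nonneg_right ?_ h0.le
    refine (abs_add_le _ _).trans ?_
    have e3 := abs_sub (t * dt (bg.wallSource b) (t, y)) (bg.wallSource b (t, y))
    have e4 : |t ^ 2 * ∑ i, (‖y‖ ^ 2)⁻¹ *
        (dt (dZ i (onRays (pistonPath b))) (t, y) * dZ i f (t, y))| ≤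
        24 / b₀ ^ 2 * A * δ := by
      rw [abs_mul, abs_of_pos (by positivity : 0 < t ^ 2)]
      refine (mul_le_mul_of_nonneg_left e2 (by positivity)).trans (le_of_eq ?_)
      field_simp
      ring
    linarith
  have hbd : ∀ y : E3, y ≠ 0 → onRays (pistonPath b) (t, y) = ‖y‖ →
      |t * dt f (t, y)| ≤ 2 * b₀ * N * δ := by
    intro y hy h1
    obtain ⟨w1, w2, -⟩ := hf.wall_derivatives hb (p := (t, y)) ht hy h1
    obtain ⟨-, -, -, b4⟩ := hb.path_bounds (p := (t, y)) ht hy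
    simp only at w1 w2 b4
    rw [w2, abs_mul, abs_neg, abs_mul, abs_of_pos h0]
    rw [abs_of_pos hb0] at b4
    calc _ ≤ t * ((2 * b₀) * (t⁻¹ * (N * δ))) := by
          refine mul_le_mul_of_nonneg_left (mul_le_mul (by linarith)
            (w1.trans (mul_le_mul_of_nonneg_left (hN (t, y) ht hy) (by positivity)))
            (abs_nonneg _) (by positivity)) h0.le
      _ = 2 * b₀ * N * δ := by field_simp
  have hκ0 : 0 ≤ (2 * L + N + 24 / b₀ ^ 2 * A) * δ := by positivity
  rw [abs_le']
  constructor
  · have h := hb.comparison hb0 hδ (s := s) (by linarith) (F := F) ht (fun y hy h1 => (hd y hy h1).differentiableAt)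
      (fun y hy h1 h2 => by
        rw [(hd y hy h1.le).fderiv, _root_.smul_apply, smul_eq_mul]
        exact (abs_le.1 (hin y hy h1 (hdist y h2))).2)
      (fun y hy h1 => (abs_le.1 (hbd y hy h1)).2) hκ0 hp hr hR
    simp only [hF] at h
    linarith
  · have h := hb.comparison hb0 hδ (s := s) (by linarith) (F := fun q => -F q) ht (fun y hy h1 => (hd y hy h1).differentiableAt.neg)
      (fun y hy h1 h2 => by
        rw [fderiv_fun_neg, (hd y hy h1.le).fderiv, _root_.neg_apply, _root_.smul_apply,
          smul_eq_mul]
        linarith [(abs_le.1 (hin y hy h1 (hdist y h2))).1])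
      (fun y hy h1 => (neg_le.1 (abs_le.1 (hbd y hy h1)).1)) hκ0 hp hr hR
    simp only [hF] at h
    linarith

/-- The value bound is `2 s N δ` with `N = 10/(s û(s₀))`: the thickness `s = s₀ - b₀` cancels,
leaving `20/û(s₀)`. Only this bound enters the final constant; `L` may depend on the background. -/
theorem exists_corrector_bounds (bg : Background G b₀) (hb0 : 0 < b₀) :
    ∃ δ₁ : ℝ, 0 < δ₁ ∧ ∃ L : ℝ, 0 < L ∧ ∀ (δ : ℝ) (b : ℝ → E3 → ℝ) (f : ℝ × E3 → ℝ),
      0 ≤ δ → δ ≤ δ₁ → IsPistonClose b₀ δ b → IsCorrector bg (pistonPath b) f →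
      ∀ p : ℝ × E3, 1 ≤ p.1 → p.2 ≠ 0 → onRays (pistonPath b) p ≤ ‖p.2‖ →
      ‖p.2‖ ≤ p.1 * (bg.s₀ + (bg.s₀ - b₀) / 2) →
      |f p| ≤ 20 / bg.u bg.s₀ * δ ∧ |p.1 * dt f p| ≤ L * δ ∧ (∀ k, |dZ k f p| ≤ L) ∧
        |p.1 * dr f p| ≤ L * δ := by
  obtain ⟨d, hd, L, hL0, hL⟩ := bg.exists_wallDatum_bounds hb0
  have hu0 := bg.u_pos hb0 bg.shock_mem
  set s := bg.s₀ - b₀ with hs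
  have hs0 : 0 < s := sub_pos.2 bg.b₀_lt_s₀
  set N := 10 / (s * bg.u bg.s₀) with hN
  have hN0 : 0 < N := by positivity
  set A := Real.exp (Real.log 4 + 2 * (4 * L + 96 / b₀ ^ 2) * s)
  have hA0 : 0 < A := Real.exp_pos _
  set L₁ := 2 * b₀ * N + 2 * (2 * L + N + 24 / b₀ ^ 2 * A) * s with hL₁
  have hL₁0 : 0 < L₁ := by positivity
  refine ⟨min (min d (b₀ / 2)) (min (min (s / 2) 1) (1 / N)), by positivity,
    L₁ + A + (N + 12 / b₀ ^ 2 * A), by positivity, fun δ b f hδ0 hδ hb hf p ht hp hr hR => ?_⟩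
  simp only [le_min_iff] at hδ
  obtain ⟨⟨hδd, hδb⟩, ⟨hδs, hδ1⟩, hδN⟩ := hδ
  have hW := fun (q : ℝ × E3) (h1 : 1 ≤ q.1) (h2 : q.2 ≠ 0) => hb.wallSource_bounds hδd hL h1 h2
  have hWN : ∀ q : ℝ × E3, 1 ≤ q.1 → q.2 ≠ 0 → |bg.wallSource b q| ≤ N * δ := fun q h1 h2 => by
    refine (hW q h1 h2).2.1.trans (le_of_eq ?_)
    rw [hN]; ring
  have hR' : ‖p.2‖ ≤ p.1 * (b₀ + s + s / 2) := by
    have : b₀ + s + s / 2 = bg.s₀ + s / 2 := by rw [hs]; ring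
    rwa [this]
  have hZ := fun (q : ℝ × E3) (h1 : 1 ≤ q.1) (h2 : q.2 ≠ 0)
      (h3 : onRays (pistonPath b) q ≤ ‖q.2‖) (h4 : ‖q.2‖ ≤ q.1 * (b₀ + s + s / 2)) k =>
    hf.abs_dZ_le hb hb0 hδ0 hδb hδ1 hδs (fun q h1 h2 => (hW q h1 h2).1) hWN
      (by rw [le_div_iff₀ hN0] at hδN; linarith) (fun q h1 h2 => (hW q h1 h2).2.2.1) hL0 h1 h2 h3
      h4 k
  have h0 : 0 < p.1 := by linarith
  refine ⟨?_, ?_, fun k => ?_, ?_⟩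
  · refine (hf.abs_value_le hb hb0 hδ0 hδb hδs hWN hN0.le ht hp hr hR').trans (le_of_eq ?_)
    rw [hN]
    field_simp
    ring
  · refine (hf.abs_dt_le hb hb0 hδ0 hδb hδs (fun q h1 h2 => (hW q h1 h2).1) hWN hN0.le
      (fun q h1 h2 => (hW q h1 h2).2.2.2) hL0 hA0.le hZ ht hp hr hR').trans ?_
    refine mul_le_mul_of_nonneg_right ?_ hδ0
    rw [← hL₁]
    have : 0 ≤ 12 / b₀ ^ 2 * A := by positivity
    linarith
  · refine (hZ p ht hp hr hR' k).trans ?_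
    have : 0 ≤ 12 / b₀ ^ 2 * A := by positivity
    linarith
  · have htr := hf.fderiv_wallField hb h0 hp hr
    rw [← wallOp_eq_fderiv, wallOp] at htr
    -- The radial derivative is recovered algebraically from the transport equation.
    have e : p.1 * dr f p = bg.wallSource b p +
        p.1 * ((‖p.2‖ ^ 2)⁻¹ * ∑ i, dZ i (onRays (pistonPath b)) p * dZ i f p) := by
      have : dr f p = p.1⁻¹ * bg.wallSource b p +
        (‖p.2‖ ^ 2)⁻¹ * ∑ i, dZ i (onRays (pistonPath b)) p * dZ i f p := by
        rw [← htr, one_div]; ring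
      rw [this]
      field_simp
    obtain ⟨b1, -, -, -⟩ := hb.path_bounds ht hp
    have hinv := hb.inv_sq_le hb0 hδb ht hp hr
    have hsum : |∑ i, dZ i (onRays (pistonPath b)) p * dZ i f p| ≤ 3 * (p.1 * δ * A) := by
      refine (Finset.abs_sum_le_sum_abs _ _).trans ((Finset.sum_le_sum fun i _ => ?_).trans
        (le_of_eq (by simp : ∑ _ : Fin 3, p.1 * δ * A = 3 * (p.1 * δ * A))))
      rw [abs_mul]
      exact mul_le_mul (b1 i) (hZ p ht hp hr hR' i) (abs_nonneg _) (by positivity)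
    rw [e]
    refine (abs_add_le _ _).trans ?_
    have h2 : |p.1 * ((‖p.2‖ ^ 2)⁻¹ * ∑ i, dZ i (onRays (pistonPath b)) p * dZ i f p)| ≤
        12 / b₀ ^ 2 * A * δ := by
      rw [abs_mul, abs_mul, abs_of_pos h0, abs_of_nonneg (by positivity : 0 ≤ (‖p.2‖ ^ 2)⁻¹)]
      refine (mul_le_mul_of_nonneg_left (mul_le_mul hinv hsum (abs_nonneg _) (by positivity))
        h0.le).trans (le_of_eq ?_)
      field_simp
      ring
    have h3 := hWN p ht hp
    have h4 : 0 ≤ (L₁ + A) * δ := by positivity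
    linarith

end CorrectorBounds

/-! ### The linearized shock polar -/

namespace Background

variable {G : Gas} {b₀ : ℝ} (bg : Background G b₀)

/-- The jump conditions, as an equation for `(∂_t Φ, ∂_r Φ, r⁻² ∑ (Z_k Φ)²)` on the shock. -/
noncomputable def jump (G : Gas) (z : ℝ × ℝ × ℝ) : ℝ :=
  G.enthalpyInv (G.enthalpy G.ρ₀ - z.1 - (z.2.1 ^ 2 + z.2.2) / 2) * (z.2.1 ^ 2 + z.2.2 + z.1) -
    G.ρ₀ * z.1

theorem jump_background :
    jump G (-(bg.s₀ * bg.u bg.s₀), bg.u bg.s₀, 0) = 0 := by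
  have hρ := bg.ρ_pos _ (bg.mem_Ioo_of_mem_Icc bg.shock_mem)
  have h := bg.enthalpy_shock
  have e : G.enthalpy G.ρ₀ - -(bg.s₀ * bg.u bg.s₀) - (bg.u bg.s₀ ^ 2 + 0) / 2 =
      G.enthalpy (bg.ρ bg.s₀) := by rw [h]; ring
  simp only [jump]
  rw [e, G.enthalpyInv_enthalpy hρ]
  linear_combination -bg.u bg.s₀ * bg.rh_mass

/-- The derivative of `h⁻¹` at `h(ρ)` is `ρ/c²`, and the energy condition rewrites `Q` as `û² - s₀
û`; this identifies the first two coefficients. The value of `B₃` is immaterial, since its argument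
is quadratically small on the shock. -/
theorem exists_hasFDerivAt_jump : ∃ (F' : ℝ × ℝ × ℝ →L[ℝ] ℝ) (B₃ : ℝ),
    HasFDerivAt (jump G) F' (-(bg.s₀ * bg.u bg.s₀), bg.u bg.s₀, 0) ∧
    ∀ z, F' z = bg.B₂ * z.1 + bg.B₁ * z.2.1 + B₃ * z.2.2 := by
  have hρ := bg.ρ_pos _ (bg.mem_Ioo_of_mem_Icc bg.shock_mem)
  have hen := bg.enthalpy_shock
  set z₀ : ℝ × ℝ × ℝ := (-(bg.s₀ * bg.u bg.s₀), bg.u bg.s₀, 0) with hz₀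
  have h1 : HasFDerivAt (fun z : ℝ × ℝ × ℝ => z.1)
      (ContinuousLinearMap.fst ℝ ℝ (ℝ × ℝ)) z₀ := hasFDerivAt_fst
  have h2 : HasFDerivAt (fun z : ℝ × ℝ × ℝ => z.2.1)
      ((ContinuousLinearMap.fst ℝ ℝ ℝ).comp (ContinuousLinearMap.snd ℝ ℝ (ℝ × ℝ))) z₀ :=
    hasFDerivAt_snd.fst
  have h3 : HasFDerivAt (fun z : ℝ × ℝ × ℝ => z.2.2)
      ((ContinuousLinearMap.snd ℝ ℝ ℝ).comp (ContinuousLinearMap.snd ℝ ℝ (ℝ × ℝ))) z₀ :=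
    hasFDerivAt_snd.snd
  have hn : HasFDerivAt (fun z : ℝ × ℝ × ℝ => z.2.1 ^ 2 + z.2.2) _ z₀ := (h2.pow 2).add h3
  have hE : HasFDerivAt
      (fun z : ℝ × ℝ × ℝ => G.enthalpy G.ρ₀ - z.1 - (z.2.1 ^ 2 + z.2.2) * (1 / 2)) _ z₀ :=
    (h1.const_sub _).sub (hn.mul_const (1 / 2))
  have eE : G.enthalpy G.ρ₀ - z₀.1 - (z₀.2.1 ^ 2 + z₀.2.2) * (1 / 2) =
      G.enthalpy (bg.ρ bg.s₀) := by rw [hen, hz₀]; ring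
  have hH := G.hasDerivAt_enthalpyInv hρ
  rw [← eE] at hH
  have hHE := hH.comp_hasFDerivAt z₀ hE
  have hF := (hHE.mul (hn.add h1)).sub (h1.const_mul G.ρ₀)
  have hval : G.enthalpyInv (G.enthalpy G.ρ₀ - z₀.1 - (z₀.2.1 ^ 2 + z₀.2.2) * (1 / 2)) =
      bg.ρ bg.s₀ := by rw [eE, G.enthalpyInv_enthalpy hρ]
  have hJ : HasFDerivAt (jump G) _ z₀ := hF.congr_of_eventuallyEq
    (Filter.Eventually.of_forall fun z => by simp [jump, div_eq_mul_inv])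
  refine ⟨_, bg.ρ bg.s₀ - bg.ρ bg.s₀ / G.soundSq (bg.ρ bg.s₀) *
    (bg.u bg.s₀ ^ 2 - bg.s₀ * bg.u bg.s₀) / 2, hJ, fun z => ?_⟩
  have hQ : bg.u bg.s₀ ^ 2 / 2 - G.enthalpy (bg.ρ bg.s₀) + G.enthalpy G.ρ₀ =
      bg.u bg.s₀ ^ 2 - bg.s₀ * bg.u bg.s₀ := by rw [hen]; ring
  simp only [Function.comp_apply, hval]
  simp [hz₀, B₁, B₂, hQ]
  ring

/-- The speed of the shock, up to terms of higher order, as a function of `∂_t Φ`. -/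
theorem exists_shockSpeed_bound (hb : 0 < b₀) {η : ℝ} (hη : 0 < η) :
    ∃ d : ℝ, 0 < d ∧ ∃ C : ℝ, 0 ≤ C ∧ ∀ a v m : ℝ, |a + bg.s₀ * bg.u bg.s₀| ≤ d →
      |v - bg.u bg.s₀| ≤ d → 0 ≤ m → m ≤ d → jump G (a, v, m) = 0 → 0 < v ∧
      |-a / v - bg.s₀ + bg.polarCoeff / bg.u bg.s₀ * (a + bg.s₀ * bg.u bg.s₀)| ≤
        η * |a + bg.s₀ * bg.u bg.s₀| + C * m := by
  obtain ⟨F', B₃, hF, hF'⟩ := bg.exists_hasFDerivAt_jump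
  have hB₁ := bg.B₁_pos hb
  have hu0 := bg.u_pos hb bg.shock_mem
  have hs0 : 0 < bg.s₀ := hb.trans bg.b₀_lt_s₀
  set k₁ := 2 / bg.B₁ * (|bg.B₂| + bg.B₁) with hk₁
  set k₂ := 2 / bg.B₁ * (|B₃| + bg.B₁) with hk₂
  have hk₁0 : 0 ≤ k₁ := by positivity
  have hk₂0 : 0 ≤ k₂ := by positivity
  -- The first entry lets `B₁ |dv|` absorb the nonlinear remainder; the second keeps the error of
  -- the solved relation below `η/2`.
  set η₁ := min (bg.B₁ / 2) (η / 2 / (bg.s₀ / bg.u bg.s₀ / bg.B₁ * (1 + k₁))) with hη₁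
  have hη₁0 : 0 < η₁ := by positivity
  have hev := hF.isLittleO.bound hη₁0
  obtain ⟨d₁, hd₁, hball⟩ := Metric.eventually_nhds_iff_ball.1 hev
  set d₂ := η / 2 / ((1 + bg.s₀ * k₁) * (2 / bg.u bg.s₀ ^ 2)) with hd₂
  have hd₂0 : 0 < d₂ := by positivity
  refine ⟨min (d₁ / 2) (min d₂ (bg.u bg.s₀ / 2)), by positivity,
    bg.s₀ * k₂ * (1 / bg.u bg.s₀) + bg.s₀ / bg.u bg.s₀ / bg.B₁ * (η₁ * (1 + k₂) + |B₃|),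
    by positivity, fun a v m ha hv hm0 hm hJ => ?_⟩
  simp only [le_min_iff] at ha hv hm
  obtain ⟨ha1, -⟩ := ha
  obtain ⟨hv1, hv2, hv3⟩ := hv
  set u₀ := bg.u bg.s₀ with hu₀
  set s₀ := bg.s₀
  set da := a + s₀ * u₀ with hda
  set dv := v - u₀ with hdv
  have hv0 : u₀ / 2 ≤ v := by have := (abs_le.1 hv3).1; linarith
  have hvp : 0 < v := by linarith
  refine ⟨hvp, ?_⟩
  have hlin : |bg.B₂ * da + bg.B₁ * dv + B₃ * m| ≤ η₁ * (|da| + |dv| + m) := by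
    have hmem : (a, v, m) ∈ Metric.ball (-(s₀ * u₀), u₀, (0 : ℝ)) d₁ := by
      rw [Metric.mem_ball, Prod.dist_eq, Prod.dist_eq]
      simp only [Real.dist_eq, sub_neg_eq_add, sub_zero]
      rw [abs_of_nonneg hm0]
      exact max_lt (by linarith) (max_lt (by linarith) (by linarith [hm.1]))
    have h := hball _ hmem
    rw [hJ, bg.jump_background, hF'] at h
    simp only [Prod.mk_sub_mk, sub_neg_eq_add, sub_zero, zero_sub, norm_neg, Real.norm_eq_abs] at h
    refine h.trans (mul_le_mul_of_nonneg_left ?_ hη₁0.le)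
    rw [Prod.norm_def, Prod.norm_def]
    simp only [Real.norm_eq_abs, abs_of_nonneg hm0]
    refine max_le ?_ (max_le ?_ ?_)
    · linarith [abs_nonneg dv]
    · linarith [abs_nonneg da]
    · linarith [abs_nonneg da, abs_nonneg dv]
  have hdvle : |dv| ≤ k₁ * |da| + k₂ * m := by
    have h1 : bg.B₁ * |dv| ≤ |bg.B₂ * da + bg.B₁ * dv + B₃ * m| + |bg.B₂| * |da| + |B₃| * m := by
      have e : bg.B₁ * dv = (bg.B₂ * da + bg.B₁ * dv + B₃ * m) - bg.B₂ * da - B₃ * m := by ring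
      rw [← abs_of_pos hB₁, ← abs_mul, abs_of_pos hB₁, e, ← abs_mul, ← abs_of_nonneg hm0,
        ← abs_mul, abs_of_nonneg hm0]
      have g1 := abs_sub (bg.B₂ * da + bg.B₁ * dv + B₃ * m - bg.B₂ * da) (B₃ * m)
      have g2 := abs_sub (bg.B₂ * da + bg.B₁ * dv + B₃ * m) (bg.B₂ * da)
      ring_nf at g1 g2 ⊢
      linarith
    have h2 : η₁ * (|da| + |dv| + m) ≤ bg.B₁ / 2 * (|da| + |dv| + m) :=
      mul_le_mul_of_nonneg_right (min_le_left _ _) (by positivity)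
    have h3 : bg.B₁ * |dv| ≤ bg.B₁ * (k₁ * |da| + k₂ * m) := by
      have : bg.B₁ * (k₁ * |da| + k₂ * m) =
          2 * (|bg.B₂| + bg.B₁) * |da| + 2 * (|B₃| + bg.B₁) * m := by
        rw [hk₁, hk₂]; field_simp
      rw [this]
      nlinarith [mul_nonneg hB₁.le (abs_nonneg da), mul_nonneg hB₁.le hm0]
    exact le_of_mul_le_mul_left h3 hB₁
  have hpol : |dv + bg.B₂ / bg.B₁ * da| ≤
      1 / bg.B₁ * (η₁ * ((1 + k₁) * |da| + (1 + k₂) * m) + |B₃| * m) := by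
    have e : dv + bg.B₂ / bg.B₁ * da =
        1 / bg.B₁ * ((bg.B₂ * da + bg.B₁ * dv + B₃ * m) - B₃ * m) := by
      field_simp; ring
    rw [e, abs_mul, abs_of_pos (by positivity : 0 < 1 / bg.B₁)]
    refine mul_le_mul_of_nonneg_left ((abs_sub _ _).trans ?_) (by positivity)
    rw [abs_mul B₃, abs_of_nonneg hm0]
    refine add_le_add (hlin.trans (mul_le_mul_of_nonneg_left ?_ hη₁0.le)) le_rfl
    linarith
  -- An exact identity: a term quadratic in `(da, dv)` minus the residual of the linearized
  -- relation.
  have e : -a / v - s₀ + bg.polarCoeff / u₀ * da =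
      (da + s₀ * dv) * (dv / (v * u₀)) - s₀ / u₀ * (dv + bg.B₂ / bg.B₁ * da) := by
    have ha : a = da - s₀ * u₀ := by rw [hda]; ring
    have hv' : dv = v - u₀ := hdv
    have hpc : bg.polarCoeff = 1 - s₀ * (bg.B₂ / bg.B₁) := rfl
    rw [ha, hv', hpc]
    generalize bg.B₂ / bg.B₁ = r
    field_simp
    ring
  have h1 : |dv / (v * u₀)| ≤ 2 / u₀ ^ 2 * |dv| := by
    rw [abs_div, abs_of_pos (mul_pos hvp hu0), div_le_iff₀ (mul_pos hvp hu0)]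
    have : 2 / u₀ ^ 2 * |dv| * (u₀ / 2 * u₀) ≤ 2 / u₀ ^ 2 * |dv| * (v * u₀) :=
      mul_le_mul_of_nonneg_left (mul_le_mul_of_nonneg_right hv0 hu0.le) (by positivity)
    refine le_trans (le_of_eq ?_) this
    field_simp
  have h2 : |da + s₀ * dv| ≤ (1 + s₀ * k₁) * |da| + s₀ * k₂ * m := by
    refine (abs_add_le _ _).trans ?_
    rw [abs_mul, abs_of_pos hs0]
    nlinarith [mul_le_mul_of_nonneg_left hdvle hs0.le]
  have h3 : |dv / (v * u₀)| ≤ η / 2 / (1 + s₀ * k₁) := by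
    refine h1.trans ((mul_le_mul_of_nonneg_left hv2 (by positivity)).trans (le_of_eq ?_))
    rw [hd₂]
    field_simp
  have h3' : |dv / (v * u₀)| ≤ 1 / u₀ := by
    refine h1.trans ((mul_le_mul_of_nonneg_left hv3 (by positivity)).trans (le_of_eq ?_))
    field_simp
  rw [e]
  refine (abs_sub _ _).trans ?_
  rw [abs_mul, abs_mul (s₀ / u₀), abs_of_pos (by positivity : 0 < s₀ / u₀)]
  have h4 : |da + s₀ * dv| * |dv / (v * u₀)| ≤ η / 2 * |da| + s₀ * k₂ * (1 / u₀) * m := by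
    refine (mul_le_mul_of_nonneg_right h2 (abs_nonneg _)).trans ?_
    rw [add_mul]
    refine add_le_add ?_ ?_
    · refine (mul_le_mul_of_nonneg_left h3 (by positivity)).trans (le_of_eq ?_)
      field_simp
    · refine (mul_le_mul_of_nonneg_left h3' (by positivity)).trans (le_of_eq ?_)
      ring
  have h5 : s₀ / u₀ / bg.B₁ * (1 + k₁) * η₁ ≤ η / 2 := by
    have : 0 < s₀ / u₀ / bg.B₁ * (1 + k₁) := by positivity
    have h6 : η₁ ≤ η / 2 / (s₀ / u₀ / bg.B₁ * (1 + k₁)) := min_le_right _ _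
    rw [le_div_iff₀ this] at h6
    linarith
  have h7 : s₀ / u₀ * |dv + bg.B₂ / bg.B₁ * da| ≤
      η / 2 * |da| + s₀ / u₀ / bg.B₁ * (η₁ * (1 + k₂) + |B₃|) * m := by
    refine (mul_le_mul_of_nonneg_left hpol (by positivity)).trans ?_
    have e2 : s₀ / u₀ * (1 / bg.B₁ * (η₁ * ((1 + k₁) * |da| + (1 + k₂) * m) + |B₃| * m)) =
        s₀ / u₀ / bg.B₁ * (1 + k₁) * η₁ * |da| +
          s₀ / u₀ / bg.B₁ * (η₁ * (1 + k₂) + |B₃|) * m := by ring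
    rw [e2]
    linarith [mul_le_mul_of_nonneg_right h5 (abs_nonneg da)]
  linarith

/-- Expansion of the background potential at the shock. -/
theorem exists_profile_expansion {η : ℝ} (hη : 0 < η) : ∃ d : ℝ, 0 < d ∧ ∀ ξ : ℝ, |ξ| ≤ d →
    bg.s₀ + ξ ∈ Ioo (b₀ - bg.τ) (bg.s₀ + bg.τ) ∧
    |bg.profile (bg.s₀ + ξ) - bg.u bg.s₀ * ξ| ≤ η * |ξ| ∧
    |bg.u (bg.s₀ + ξ) - bg.u bg.s₀ - bg.shockSlope * ξ| ≤ η * |ξ| := by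
  have hs := bg.mem_Ioo_of_mem_Icc bg.shock_mem
  have e1 : ∀ᶠ s in nhds bg.s₀, s ∈ Ioo (b₀ - bg.τ) (bg.s₀ + bg.τ) := isOpen_Ioo.mem_nhds hs
  have e2 := (bg.hasDerivAt_profile hs).isLittleO.bound hη
  have e3 := bg.hasDerivAt_u_shock.isLittleO.bound hη
  obtain ⟨d, hd, hball⟩ := Metric.eventually_nhds_iff_ball.1 (e1.and (e2.and e3))
  refine ⟨d / 2, by positivity, fun ξ hξ => ?_⟩
  obtain ⟨f1, f2, f3⟩ := hball (bg.s₀ + ξ) (by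
    rw [Metric.mem_ball, Real.dist_eq, add_sub_cancel_left]; linarith)
  simp only [add_sub_cancel_left, Real.norm_eq_abs, smul_eq_mul, bg.profile_shock, sub_zero] at f2 f3
  exact ⟨f1, by rwa [mul_comm], by rwa [mul_comm bg.shockSlope]⟩

theorem hasFDerivAt_norm {x : E3} (hx : x ≠ 0) :
    HasFDerivAt (fun y : E3 => ‖y‖) (‖x‖⁻¹ • innerSL ℝ x) x := by
  have h1 := ((hasFDerivAt_id x).norm_sq).sqrt (by simpa using hx)
  have e : (fun y : E3 => ‖y‖) = fun y : E3 => Real.sqrt (‖y‖ ^ 2) := by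
    ext y; simp
  rw [e]
  refine h1.congr_fderiv ?_
  ext v
  simp
  field_simp

theorem potential_derivatives {p : ℝ × E3} (ht : 0 < p.1) (hp : p.2 ≠ 0)
    (hs : ‖p.2‖ / p.1 ∈ Ioo (b₀ - bg.τ) (bg.s₀ + bg.τ)) :
    DifferentiableAt ℝ bg.potential p ∧
    dt bg.potential p = bg.profile (‖p.2‖ / p.1) - ‖p.2‖ / p.1 * bg.u (‖p.2‖ / p.1) ∧
    dr bg.potential p = bg.u (‖p.2‖ / p.1) ∧ ∀ k, dZ k bg.potential p = 0 := by
  have hn : ‖p.2‖ ≠ 0 := norm_ne_zero_iff.2 hp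
  have h1 : HasFDerivAt (fun q : ℝ × E3 => ‖q.2‖) _ p :=
    HasFDerivAt.comp (g := fun y : E3 => ‖y‖) p (hasFDerivAt_norm hp) hasFDerivAt_snd
  have h2 : HasFDerivAt (fun q : ℝ × E3 => q.1⁻¹) _ p :=
    HasFDerivAt.comp (g := Inv.inv) p (hasDerivAt_inv ht.ne').hasFDerivAt hasFDerivAt_fst
  have h3 : HasFDerivAt (fun q : ℝ × E3 => ‖q.2‖ * q.1⁻¹) _ p := h1.mul h2
  have h4 : HasFDerivAt (fun q : ℝ × E3 => bg.profile (‖q.2‖ * q.1⁻¹)) _ p :=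
    HasFDerivAt.comp (g := bg.profile) (f := fun q : ℝ × E3 => ‖q.2‖ * q.1⁻¹) p
      (bg.hasDerivAt_profile (s := ‖p.2‖ * p.1⁻¹) hs).hasFDerivAt h3
  have h5 : HasFDerivAt bg.potential _ p := hasFDerivAt_fst.mul h4
  refine ⟨h5.differentiableAt, ?_, ?_, fun k => ?_⟩
  · rw [dt, h5.fderiv]
    simp [div_eq_mul_inv]
    field_simp
    ring
  · rw [dr, h5.fderiv]
    simp [div_eq_mul_inv]
    field_simp
  · rw [dZ, h5.fderiv]
    simp [inner_rotVec]

theorem modifiedPotential_derivatives {f : ℝ × E3 → ℝ} {p : ℝ × E3} (ht : 0 < p.1) (hp : p.2 ≠ 0)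
    (hs : ‖p.2‖ / p.1 ∈ Ioo (b₀ - bg.τ) (bg.s₀ + bg.τ)) (hf : DifferentiableAt ℝ f p) :
    DifferentiableAt ℝ (modifiedPotential bg f) p ∧
    dt (modifiedPotential bg f) p =
      (1 + f p) * (bg.profile (‖p.2‖ / p.1) - ‖p.2‖ / p.1 * bg.u (‖p.2‖ / p.1)) +
        p.1 * dt f p * bg.profile (‖p.2‖ / p.1) ∧
    dr (modifiedPotential bg f) p =
      (1 + f p) * bg.u (‖p.2‖ / p.1) + p.1 * dr f p * bg.profile (‖p.2‖ / p.1) ∧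
    ∀ k, dZ k (modifiedPotential bg f) p = p.1 * dZ k f p * bg.profile (‖p.2‖ / p.1) := by
  obtain ⟨d1, d2, d3, d4⟩ := bg.potential_derivatives ht hp hs
  have h : HasFDerivAt (modifiedPotential bg f) _ p :=
    (hf.hasFDerivAt.const_add 1).mul d1.hasFDerivAt
  have hgen : ∀ e, fderiv ℝ (modifiedPotential bg f) p e = (1 + f p) * fderiv ℝ bg.potential p e +
      p.1 * fderiv ℝ f p e * bg.profile (‖p.2‖ / p.1) := by
    intro e
    rw [h.fderiv]
    simp [potential]
    ring
  refine ⟨h.differentiableAt, ?_, ?_, fun k => ?_⟩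
  · rw [dt, hgen, ← dt, d2, dt]
  · rw [dr, hgen, ← dr, d3, dr]
  · rw [dZ, hgen, ← dZ, d4, mul_zero, zero_add, dZ]

theorem exists_smallness (s : Finset ℝ) {d : ℝ} (hd : 0 < d) :
    ∃ ε₀ : ℝ, 0 < ε₀ ∧ ε₀ ≤ 1 ∧ ∀ ε, 0 < ε → ε < ε₀ → ∀ c ∈ s, c * ε ≤ d := by
  refine ⟨min 1 (d / (1 + ∑ c ∈ s, |c|)), ?_, min_le_left _ _, fun ε hε hlt c hc => ?_⟩
  · have : 0 ≤ ∑ c ∈ s, |c| := Finset.sum_nonneg fun _ _ => abs_nonneg _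
    positivity
  · have h0 : 0 ≤ ∑ c ∈ s, |c| := Finset.sum_nonneg fun _ _ => abs_nonneg _
    have h1 : |c| ≤ ∑ c ∈ s, |c| :=
      Finset.single_le_sum (f := fun c => |c|) (fun _ _ => abs_nonneg _) hc
    have h2 : ε < d / (1 + ∑ c ∈ s, |c|) := hlt.trans_le (min_le_right _ _)
    rw [lt_div_iff₀ (by linarith)] at h2
    nlinarith [le_abs_self c]

set_option maxHeartbeats 1000000 in
/-- The linearized shock polar for a perturbation of the background flow: `D` and `R` stand for
the derivatives `∂_t` and `∂_r` of the perturbation, `ξ` for that of the shock, `f`, `ft`, `fr` for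
the corrector and its weighted derivatives, and `W`, `m` for angular derivatives. -/
theorem exists_perturbedShockSpeed_bound (hb : 0 < b₀)
    (hκ : bg.polarCoeff ∈ Icc (1 / 4 : ℝ) (1 / 2)) (hsu : bg.s₀ ≤ 2 * bg.u bg.s₀)
    {η N M L : ℝ} (hη : 0 < η) (hN : 0 < N) (hM : 0 < M) (hL : 0 < L) :
    ∃ ε₀ : ℝ, 0 < ε₀ ∧ ∃ C : ℝ, 0 ≤ C ∧ ∀ ε, 0 < ε → ε < ε₀ → ∀ ξ f : ℝ, |ξ| ≤ M * ε →
      |f| ≤ 20 / bg.u bg.s₀ * (N * ε) →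
      bg.s₀ + ξ ∈ Ioo (b₀ - bg.τ) (bg.s₀ + bg.τ) ∧
      bg.s₀ / 2 ≤ bg.s₀ + ξ ∧ |ξ| ≤ (bg.s₀ - b₀) / 2 ∧
      (1 + |f|) * |bg.profile (bg.s₀ + ξ)| ≤ (1 + η) * bg.u bg.s₀ * |ξ| ∧
      ∀ D R ft fr W m : ℝ, |D| ≤ M * ε → |R| ≤ M * ε → |ft| ≤ L * (N * ε) → |fr| ≤ L * (N * ε) →
        0 ≤ W → W ≤ 2 * M * ε → 0 ≤ m →
        m ≤ 2 * W ^ 2 + 24 * L ^ 2 / bg.s₀ ^ 2 * bg.profile (bg.s₀ + ξ) ^ 2 →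
        ∀ a v, a = D + ((1 + f) * (bg.profile (bg.s₀ + ξ) - (bg.s₀ + ξ) * bg.u (bg.s₀ + ξ)) +
          ft * bg.profile (bg.s₀ + ξ)) →
        v = R + ((1 + f) * bg.u (bg.s₀ + ξ) + fr * bg.profile (bg.s₀ + ξ)) →
        jump G (a, v, m) = 0 → 0 < v ∧
        |-a / v - bg.s₀ + bg.polarCoeff / bg.u bg.s₀ * (D - bg.s₀ * bg.shockSlope * ξ)| ≤
          η * (|D| + |ξ|) + C * ε * W + 120 * N * ε := by
  have hu0 := bg.u_pos hb bg.shock_mem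
  have hs0 : 0 < bg.s₀ := hb.trans bg.b₀_lt_s₀
  have hsb : 0 < bg.s₀ - b₀ := sub_pos.2 bg.b₀_lt_s₀
  set u := bg.u bg.s₀
  set s₀ := bg.s₀
  set u₁ := bg.shockSlope
  set ηA := min η (min (η / (4 * (s₀ * |u₁| + 1))) (1 / u)) with hηA
  have hηA0 : 0 < ηA := by positivity
  obtain ⟨d, hd, C, hC, hspeed⟩ := bg.exists_shockSpeed_bound hb hηA0
  -- Chosen so that `3/(2 û) * 2 lam = η/4`.
  set lam := η * u / 12 with hlam
  have hlam0 : 0 < lam := by positivity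
  set x := min 1 η / 4 with hx
  have hx0 : 0 < x := by positivity
  set ηB := min (min 1 (lam / (2 * (1 + s₀)))) (u * x) with hηB
  have hηB0 : 0 < ηB := by positivity
  obtain ⟨d', hd', hprof⟩ := bg.exists_profile_expansion hηB0
  set C₃ := 24 * L ^ 2 / s₀ ^ 2 * (u + 1) ^ 2 with hC₃
  have hC₃0 : 0 ≤ C₃ := by positivity
  set K₁ := M + (|u₁| + 1) * M + 20 / u * N * (u + (|u₁| + 1) * M) + L * N * (u + 1) * M with hK₁
  set K₂ := M + s₀ * |u₁| * M + 2 * lam * M + 40 * s₀ * N with hK₂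
  obtain ⟨ε₁, hε₁, hε₁', hsm⟩ := exists_smallness {M, K₁, K₂, 8 * M ^ 2 + C₃ * M ^ 2}
    (d := min (min d d') (min ((s₀ - b₀) / 2) (s₀ / 2))) (by positivity)
  obtain ⟨ε₂, hε₂, -, hsm'⟩ := exists_smallness {20 / u * N, 2 * (|u₁| + 1) * M, L * N * (u + 1),
    (s₀ * |u₁| + lam) * M, 4 * (C * C₃ * M)}
    (d := min (min x lam) (min (s₀ * u) η)) (by positivity)
  refine ⟨min ε₁ ε₂, by positivity, 4 * C * M, by positivity, fun ε hε hlt ξ f hξ hf => ?_⟩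
  have hε1 := hsm ε hε (hlt.trans_le (min_le_left _ _))
  have hε2 := hsm' ε hε (hlt.trans_le (min_le_right _ _))
  have hεone : ε ≤ 1 := (hlt.trans_le (min_le_left _ _)).le.trans hε₁'
  simp only [Finset.mem_insert, Finset.mem_singleton, forall_eq_or_imp, forall_eq, le_min_iff]
    at hε1 hε2
  obtain ⟨⟨⟨-, i1⟩, i2, i3⟩, ⟨⟨i4, -⟩, -⟩, ⟨⟨i5, -⟩, -⟩, ⟨⟨i6, -⟩, -⟩⟩ := hε1
  obtain ⟨⟨⟨j1, -⟩, -⟩, ⟨⟨-, j2⟩, -⟩, ⟨⟨-, j3⟩, -⟩, ⟨-, j4, -⟩, ⟨-, -, j5⟩⟩ := hε2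
  obtain ⟨hmem, hP, hU⟩ := hprof ξ (hξ.trans i1)
  set P := bg.profile (s₀ + ξ)
  set U := bg.u (s₀ + ξ)
  have hηB1 : ηB ≤ 1 := (min_le_left _ _).trans (min_le_left _ _)
  have hηB2 : ηB * (2 * (1 + s₀)) ≤ lam := by
    rw [← le_div_iff₀ (by positivity)]; exact (min_le_left _ _).trans (min_le_right _ _)
  have hηB3 : ηB ≤ u * x := min_le_right _ _
  have hξ0 := abs_nonneg ξ
  have hPle : |P| ≤ (u + ηB) * |ξ| := by
    have e : P = (P - u * ξ) + u * ξ := by ring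
    rw [e]
    refine (abs_add_le _ _).trans ?_
    rw [abs_mul, abs_of_pos hu0]
    linarith
  have hPle' : |P| ≤ (u + 1) * |ξ| :=
    hPle.trans (mul_le_mul_of_nonneg_right (by linarith) hξ0)
  have hfx : |f| ≤ x := hf.trans (by linarith)
  refine ⟨hmem, ?_, hξ.trans i2, ?_, ?_⟩
  · have := (abs_le.1 (hξ.trans i3)).1
    linarith
  · have hx4 : x ≤ 1 / 4 := by rw [hx]; linarith [min_le_left 1 η]
    have hx5 : x ≤ η / 4 := by rw [hx]; linarith [min_le_right 1 η]
    calc (1 + |f|) * |P| ≤ (1 + x) * ((u + u * x) * |ξ|) := by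
          refine mul_le_mul (by linarith) (hPle.trans
            (mul_le_mul_of_nonneg_right (by linarith) hξ0)) (abs_nonneg _) (by linarith)
      _ = (1 + x) * (1 + x) * (u * |ξ|) := by ring
      _ ≤ (1 + η) * (u * |ξ|) := by
          refine mul_le_mul_of_nonneg_right ?_ (by positivity)
          nlinarith
      _ = (1 + η) * u * |ξ| := by ring
  intro D R ft fr W m hD hR hft hfr hW0 hW hm0 hm a v ha hv hJ
  have hUu : |U - u| ≤ (|u₁| + 1) * |ξ| := by
    have e : U - u = (U - u - u₁ * ξ) + u₁ * ξ := by ring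
    rw [e]
    refine (abs_add_le _ _).trans ?_
    rw [abs_mul]
    have := mul_le_mul_of_nonneg_right hηB1 hξ0
    linarith
  have hUu' : |U - u| ≤ (|u₁| + 1) * (M * ε) :=
    hUu.trans (mul_le_mul_of_nonneg_left hξ (by positivity))
  -- The first order parts `û ξ` of `P` and of `ξ U` cancel, so only `s₀ û' ξ` remains and becomes
  -- the damping term.
  have he1 : |P - (s₀ + ξ) * U + s₀ * u + s₀ * u₁ * ξ| ≤ lam * |ξ| := by
    have e : P - (s₀ + ξ) * U + s₀ * u + s₀ * u₁ * ξ =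
        (P - u * ξ) - s₀ * (U - u - u₁ * ξ) - ξ * (U - u) := by ring
    rw [e]
    have g1 := abs_sub (P - u * ξ - s₀ * (U - u - u₁ * ξ)) (ξ * (U - u))
    have g2 := abs_sub (P - u * ξ) (s₀ * (U - u - u₁ * ξ))
    rw [abs_mul] at g1
    rw [abs_mul s₀, abs_of_pos hs0] at g2
    have g3 := mul_le_mul_of_nonneg_left hU hs0.le
    have g4 := mul_le_mul_of_nonneg_left hUu' hξ0
    have g5 := mul_le_mul_of_nonneg_right hηB2 hξ0
    have g6 := mul_le_mul_of_nonneg_right j2 hξ0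
    linarith
  have hPsU : |P - (s₀ + ξ) * U| ≤ 2 * s₀ * u := by
    have e : P - (s₀ + ξ) * U = (P - (s₀ + ξ) * U + s₀ * u + s₀ * u₁ * ξ) - s₀ * u₁ * ξ - s₀ * u :=
      by ring
    rw [e]
    have g1 := abs_sub (P - (s₀ + ξ) * U + s₀ * u + s₀ * u₁ * ξ - s₀ * u₁ * ξ) (s₀ * u)
    have g2 := abs_sub (P - (s₀ + ξ) * U + s₀ * u + s₀ * u₁ * ξ) (s₀ * u₁ * ξ)
    rw [abs_of_pos (mul_pos hs0 hu0)] at g1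
    rw [abs_mul (s₀ * u₁), abs_mul s₀, abs_of_pos hs0] at g2
    have g3 : (s₀ * |u₁| + lam) * |ξ| ≤ (s₀ * |u₁| + lam) * (M * ε) :=
      mul_le_mul_of_nonneg_left hξ (by positivity)
    linarith
  set E := (P - (s₀ + ξ) * U + s₀ * u + s₀ * u₁ * ξ) + f * (P - (s₀ + ξ) * U) + ft * P with hE
  have hEa : a + s₀ * u = D - s₀ * u₁ * ξ + E := by rw [ha, hE]; ring
  have hEle : |E| ≤ 2 * lam * |ξ| + 40 * s₀ * N * ε := by
    have g1 := abs_add_three (P - (s₀ + ξ) * U + s₀ * u + s₀ * u₁ * ξ) (f * (P - (s₀ + ξ) * U))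
      (ft * P)
    rw [abs_mul f, abs_mul ft] at g1
    -- The only contribution not controlled by `D`, `ξ` or `W`: the value of the corrector times the
    -- background `∂_t Φ̂`.
    have g2 : |f| * |P - (s₀ + ξ) * U| ≤ 20 / u * (N * ε) * (2 * s₀ * u) :=
      mul_le_mul hf hPsU (abs_nonneg _) (by positivity)
    have g3 : 20 / u * (N * ε) * (2 * s₀ * u) = 40 * s₀ * N * ε := by field_simp; ring
    have g4 : |ft| * |P| ≤ L * (N * ε) * ((u + 1) * |ξ|) :=
      mul_le_mul hft hPle' (abs_nonneg _) (by positivity)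
    have g5 : L * N * (u + 1) * ε * |ξ| ≤ lam * |ξ| := mul_le_mul_of_nonneg_right j3 hξ0
    linarith
  have hda : |a + s₀ * u| ≤ |D| + s₀ * |u₁| * |ξ| + |E| := by
    rw [hEa]
    refine (abs_add_le _ _).trans ?_
    have := abs_sub D (s₀ * u₁ * ξ)
    rw [abs_mul, abs_mul, abs_of_pos hs0] at this
    linarith
  have had : |a + s₀ * u| ≤ d := by
    refine hda.trans (le_trans ?_ i5)
    have g1 : s₀ * |u₁| * |ξ| ≤ s₀ * |u₁| * (M * ε) := mul_le_mul_of_nonneg_left hξ (by positivity)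
    have g2 : 2 * lam * |ξ| ≤ 2 * lam * (M * ε) := mul_le_mul_of_nonneg_left hξ (by positivity)
    rw [hK₂]
    linarith
  have hvd : |v - u| ≤ d := by
    have e : v - u = R + (U - u) + f * U + fr * P := by rw [hv]; ring
    rw [e]
    refine le_trans ?_ i4
    have g1 := abs_add_le (R + (U - u) + f * U) (fr * P)
    have g2 := abs_add_three R (U - u) (f * U)
    rw [abs_mul] at g1 g2
    have hUle : |U| ≤ u + (|u₁| + 1) * M := by
      have e : U = u + (U - u) := by ring
      rw [e]
      refine (abs_add_le _ _).trans ?_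
      rw [abs_of_pos hu0]
      have : (|u₁| + 1) * (M * ε) ≤ (|u₁| + 1) * M := by
        rw [← mul_assoc]
        exact mul_le_of_le_one_right (by positivity) hεone
      linarith
    have g3 : |f| * |U| ≤ 20 / u * (N * ε) * (u + (|u₁| + 1) * M) :=
      mul_le_mul hf hUle (abs_nonneg _) (by positivity)
    have hξM : |ξ| ≤ M := hξ.trans (mul_le_of_le_one_right hM.le hεone)
    have g4 : |fr| * |P| ≤ L * (N * ε) * ((u + 1) * M) :=
      mul_le_mul hfr (hPle'.trans (mul_le_mul_of_nonneg_left hξM (by positivity)))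
        (abs_nonneg _) (by positivity)
    rw [hK₁]
    linarith
  -- Quadratic terms become linear with a small factor, by `W ≤ 2 M ε` and `|ξ| ≤ M ε`.
  have hm' : m ≤ 4 * M * ε * W + C₃ * M * ε * |ξ| := by
    refine hm.trans (add_le_add ?_ ?_)
    · have := mul_le_mul_of_nonneg_right hW hW0
      linarith
    · have g1 : P ^ 2 ≤ ((u + 1) * |ξ|) ^ 2 := by
        rw [← sq_abs]; exact pow_le_pow_left₀ (abs_nonneg _) hPle' 2
      have g2 : 24 * L ^ 2 / s₀ ^ 2 * P ^ 2 ≤ C₃ * |ξ| ^ 2 := by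
        refine (mul_le_mul_of_nonneg_left g1 (by positivity)).trans (le_of_eq ?_)
        rw [hC₃]; ring
      have g3 : |ξ| ^ 2 ≤ M * ε * |ξ| := by
        rw [sq]; exact mul_le_mul_of_nonneg_right hξ hξ0
      have g4 := mul_le_mul_of_nonneg_left g3 hC₃0
      linarith
  have hmd : m ≤ d := by
    refine le_trans ?_ i6
    have hξM : |ξ| ≤ M := hξ.trans (mul_le_of_le_one_right hM.le hεone)
    have hWM : W ≤ 2 * M := hW.trans (mul_le_of_le_one_right (by positivity) hεone)
    have g1 : 4 * M * ε * W ≤ 4 * M * ε * (2 * M) := mul_le_mul_of_nonneg_left hWM (by positivity)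
    have g2 : C₃ * M * ε * |ξ| ≤ C₃ * M * ε * M := mul_le_mul_of_nonneg_left hξM (by positivity)
    linarith
  obtain ⟨hvp, hmain⟩ := hspeed a v m had hvd hm0 hmd hJ
  refine ⟨hvp, ?_⟩
  have e : -a / v - s₀ + bg.polarCoeff / u * (D - s₀ * u₁ * ξ) =
      (-a / v - s₀ + bg.polarCoeff / u * (a + s₀ * u)) - bg.polarCoeff / u * E := by
    rw [hEa]; ring
  have hk0 : 0 ≤ bg.polarCoeff / u := div_nonneg (by linarith [hκ.1]) hu0.le
  have hk1 : bg.polarCoeff / u ≤ 1 / 2 / u := div_le_div_of_nonneg_right hκ.2 hu0.le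
  have hA1 : ηA ≤ η := min_le_left _ _
  have hA2 : ηA * (4 * (s₀ * |u₁| + 1)) ≤ η := by
    rw [← le_div_iff₀ (by positivity)]; exact (min_le_right _ _).trans (min_le_left _ _)
  have hA3 : ηA ≤ 1 / u := (min_le_right _ _).trans (min_le_right _ _)
  rw [e]
  refine (abs_sub _ _).trans ?_
  rw [abs_mul, abs_of_nonneg hk0]
  -- Here `120 = (3/2) * 40 * 2`, the last factor being the bound on `s₀/û(s₀)`.
  have h1 : (ηA + bg.polarCoeff / u) * |E| ≤ η / 4 * |ξ| + 120 * N * ε := by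
    have g0 : ηA + bg.polarCoeff / u ≤ 3 / 2 / u := by
      have : (3 : ℝ) / 2 / u = 1 / u + 1 / 2 / u := by ring
      linarith
    calc _ ≤ 3 / 2 / u * (2 * lam * |ξ| + 40 * s₀ * N * ε) :=
          mul_le_mul g0 hEle (abs_nonneg _) (by positivity)
      _ = η / 4 * |ξ| + 60 * N * ε * (s₀ / u) := by
          rw [hlam]; field_simp; ring
      _ ≤ η / 4 * |ξ| + 60 * N * ε * 2 := by
          have : s₀ / u ≤ 2 := by rw [div_le_iff₀ hu0]; exact hsu
          have := mul_le_mul_of_nonneg_left this (by positivity : 0 ≤ 60 * N * ε)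
          linarith
      _ = _ := by ring
  have h2 : ηA * |a + s₀ * u| ≤ η * |D| + η / 4 * |ξ| + ηA * |E| := by
    refine (mul_le_mul_of_nonneg_left hda hηA0.le).trans ?_
    have g1 : ηA * |D| ≤ η * |D| := mul_le_mul_of_nonneg_right hA1 (abs_nonneg _)
    have g2 : ηA * (s₀ * |u₁|) ≤ η / 4 := by linarith
    have g3 := mul_le_mul_of_nonneg_right g2 hξ0
    linarith
  have h3 : C * m ≤ 4 * C * M * ε * W + η / 4 * |ξ| := by
    refine (mul_le_mul_of_nonneg_left hm' hC).trans ?_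
    have g1 : C * C₃ * M * ε ≤ η / 4 := by linarith
    have g2 := mul_le_mul_of_nonneg_right g1 hξ0
    linarith
  have h4 : 0 ≤ η * |ξ| := by positivity
  linarith

end Background

/-! ### The perturbation on the shock surface -/

section Shock

variable {G : Gas} {b₀ : ℝ}

theorem IsShockSolution.mem_shockDomain {σ ζ : ℝ → E3 → ℝ} {T : ℝ} {Φ : ℝ × E3 → ℝ}
    (hsol : IsShockSolution G σ T ζ Φ) {t : ℝ} (ht : t ∈ Icc 1 T) {y : E3} (hy : ‖y‖ = 1)
    (hpos : 0 < ζ t y) : (t, ζ t y • y) ∈ shockDomain σ ζ T ∧ ‖ζ t y • y‖ = ζ t y ∧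
      onRays ζ (t, ζ t y • y) = ζ t y := by
  have hn : ‖ζ t y • y‖ = ζ t y := by
    rw [norm_smul, hy, mul_one, Real.norm_eq_abs, abs_of_pos hpos]
  have hr : ∀ g : ℝ → E3 → ℝ, onRays g (t, ζ t y • y) = g t y := fun g => by
    rw [onRays_smul g t y hpos]; simp [onRays, hy]
  refine ⟨⟨ht, ?_, ?_, ?_⟩, hn, hr ζ⟩
  · exact norm_pos_iff.1 (by rw [hn]; exact hpos)
  · rw [hr, hn]; exact (hsol.ahead t ht y hy).le
  · rw [hr, hn]

/-- The jump conditions on the shock in terms of `∂_t Φ`, `∂_r Φ` and the angular derivatives. -/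
theorem IsShockSolution.jump_eq_zero {σ ζ : ℝ → E3 → ℝ} {T : ℝ} {Φ : ℝ × E3 → ℝ}
    (hsol : IsShockSolution G σ T ζ Φ) (hpos : ∀ t ∈ Icc 1 T, ∀ y : E3, ‖y‖ = 1 → 0 < ζ t y)
    {p : ℝ × E3} (ht : p.1 ∈ Ioo 1 T) (hp : p ∈ shockDomain σ ζ T) (hr : ‖p.2‖ = onRays ζ p) :
    Background.jump G (dt Φ p, dr Φ p, 1 / ‖p.2‖ ^ 2 * ∑ k, dZ k Φ p ^ 2) = 0 ∧
      dt Φ p + dt (onRays ζ) p * dr Φ p = 0 := by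
  have hp0 := hp.2.1
  have hζ := (hsol.regular_ζ p (Ioo_subset_Icc_self ht) hp0).differentiableAt (by norm_num)
  have hΦ := (hsol.regular_Φ p hp).differentiableAt (by norm_num)
  have hev : ∀ᶠ q in nhds p, Φ (q.1, (onRays ζ q * ‖q.2‖⁻¹) • q.2) = 0 := by
    have h1 : ∀ᶠ q : ℝ × E3 in nhds p, q.1 ∈ Ioo 1 T :=
      continuous_fst.continuousAt.eventually (isOpen_Ioo.mem_nhds ht)
    filter_upwards [h1, continuous_snd.continuousAt.eventually_ne hp0] with q hq hq0
    have hqn : 0 < ‖q.2‖ := norm_pos_iff.2 hq0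
    have hy : ‖‖q.2‖⁻¹ • q.2‖ = 1 := by
      rw [norm_smul, norm_inv, norm_norm, inv_mul_cancel₀ hqn.ne']
    obtain ⟨m1, m2, m3⟩ := hsol.mem_shockDomain (Ioo_subset_Icc_self hq) hy
      (hpos _ (Ioo_subset_Icc_self hq) _ hy)
    have h := hsol.continuity _ m1 (by rw [m2, m3])
    rwa [smul_smul] at h
  obtain ⟨e1, e2⟩ := tangential_derivatives hp0 hζ hΦ hr.symm hev
  refine ⟨?_, e1⟩
  have hRH := hsol.rankineHugoniot p hp hr
  have hden : G.density Φ p = G.enthalpyInv (G.enthalpy G.ρ₀ - dt Φ p -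
      (dr Φ p ^ 2 + 1 / ‖p.2‖ ^ 2 * ∑ k, dZ k Φ p ^ 2) / 2) := by
    rw [Gas.density, sum_dx_sq Φ hp0]
  simp only [Background.jump]
  rw [← hden]
  set ρ := G.density Φ p
  have hsum : ∑ i, dZ i (onRays ζ) p * dZ i Φ p * dr Φ p = -∑ k, dZ k Φ p ^ 2 := by
    rw [← Finset.sum_neg_distrib]
    refine Finset.sum_congr rfl fun k _ => ?_
    linear_combination dZ k Φ p * e2 k
  rw [← Finset.sum_mul] at hsum
  -- The Rankine-Hugoniot condition times `∂_r Φ`, with `∂_t ζ` and `Z_k ζ` eliminated by the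
  -- tangential identities.
  linear_combination dr Φ p * hRH + (ρ - G.ρ₀) * e1 + 1 / ‖p.2‖ ^ 2 * ρ * hsum

theorem abs_fderiv_le_of_norm_le {f : ℝ × E3 → ℝ} {p e : ℝ × E3} {B c : ℝ}
    (hf : ‖fderiv ℝ f p‖ ≤ B) (he : ‖e‖ ≤ c) : |fderiv ℝ f p e| ≤ B * c :=
  (ContinuousLinearMap.le_opNorm _ _).trans
    (mul_le_mul hf he (norm_nonneg _) ((norm_nonneg _).trans hf))

theorem norm_fderiv_bounds {f : ℝ × E3 → ℝ} {p : ℝ × E3} {B : ℝ} (hp : p.2 ≠ 0)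
    (hf : ‖fderiv ℝ f p‖ ≤ B) : |dt f p| ≤ B ∧ |dr f p| ≤ B ∧
      Real.sqrt (1 / ‖p.2‖ ^ 2 * ∑ k, dZ k f p ^ 2) ≤ 2 * B := by
  have hn : 0 < ‖p.2‖ := norm_pos_iff.2 hp
  have hB : 0 ≤ B := (norm_nonneg _).trans hf
  refine ⟨?_, ?_, ?_⟩
  · rw [← mul_one B]
    exact abs_fderiv_le_of_norm_le hf (by simp [Prod.norm_def])
  · rw [← mul_one B]
    refine abs_fderiv_le_of_norm_le hf ?_
    simp [Prod.norm_def, norm_smul, hn.ne']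
  · refine Real.sqrt_le_iff.2 ⟨by positivity, ?_⟩
    have hk : ∀ k, dZ k f p ^ 2 ≤ (B * ‖p.2‖) ^ 2 := fun k => by
      rw [← sq_abs]
      refine pow_le_pow_left₀ (abs_nonneg _) (abs_fderiv_le_of_norm_le hf ?_) 2
      simpa [Prod.norm_def] using norm_rotVec_le k p.2
    have h := Finset.sum_le_sum (s := Finset.univ) fun k _ => hk k
    simp only [Finset.sum_const, Finset.card_univ, Fintype.card_fin, nsmul_eq_mul,
      Nat.cast_ofNat] at h
    rw [one_div, inv_mul_le_iff₀ (by positivity)]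
    nlinarith [sq_nonneg (B * ‖p.2‖)]

theorem Background.contDiffAt_potential (bg : Background G b₀) {p : ℝ × E3} (ht : 0 < p.1)
    (hp : p.2 ≠ 0) (hs : ‖p.2‖ / p.1 ∈ Ioo (b₀ - bg.τ) (bg.s₀ + bg.τ)) :
    ContDiffAt ℝ 1 bg.potential p := by
  have h1 : ContDiffAt ℝ 1 (fun q : ℝ × E3 => ‖q.2‖ / q.1) p :=
    (contDiffAt_snd.norm ℝ hp).div contDiffAt_fst ht.ne'
  exact contDiffAt_fst.mul (ContDiffAt.comp (g := bg.profile) p (bg.contDiffAt_profile hs) h1)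

/-- The pointwise inequalities on the shock surface. -/
theorem Background.exists_shock_inequality (bg : Background G b₀) (hb0 : 0 < b₀)
    (hκ : bg.polarCoeff ∈ Icc (1 / 4 : ℝ) (1 / 2)) (hsu : bg.s₀ ≤ 2 * bg.u bg.s₀)
    {η N M : ℝ} (hη : 0 < η) (hN : 0 < N) (hM : 0 < M) :
    ∃ ε₀ : ℝ, 0 < ε₀ ∧ ∃ C : ℝ, 0 ≤ C ∧ ∀ ε, 0 < ε → ε < ε₀ →
    ∀ b, IsPistonClose b₀ (N * ε) b → ∀ f, IsCorrector bg (pistonPath b) f →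
    ∀ (T : ℝ) (ζ : ℝ → E3 → ℝ) (Φ : ℝ × E3 → ℝ), IsShockSolution G (pistonPath b) T ζ Φ →
    (∀ p ∈ shockDomain (pistonPath b) ζ T,
      |pertShock bg ζ p| + ∑ l ∈ Finset.range 2, p.1 ^ l *
        (‖iteratedFDeriv ℝ (l + 1) (pertPotential bg f Φ) p‖
          + ‖iteratedFDeriv ℝ (l + 1) (pertShock bg ζ) p‖) ≤ M * ε) →
    ∀ t ∈ Icc 1 T, ∀ y : E3, ‖y‖ = 1 → ∀ p, p = (t, ζ t y • y) →
      0 < ζ t y ∧ p ∈ shockDomain (pistonPath b) ζ T ∧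
      ContDiffAt ℝ 1 (pertPotential bg f Φ) p ∧
      |pertPotential bg f Φ p| ≤ (1 + η) * bg.u bg.s₀ * |ζ t y - bg.s₀ * t| ∧
      (t ∈ Ioo 1 T → |dt (onRays ζ) p - bg.s₀ + bg.polarCoeff / bg.u bg.s₀ *
        (dt (pertPotential bg f Φ) p - bg.s₀ * bg.shockSlope * ((ζ t y - bg.s₀ * t) / t))| ≤
        η * (|dt (pertPotential bg f Φ) p| + |(ζ t y - bg.s₀ * t) / t|) +
        C * ε * Real.sqrt (1 / ‖p.2‖ ^ 2 * ∑ k, dZ k (pertPotential bg f Φ) p ^ 2) +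
        120 * N * ε) := by
  obtain ⟨δ₁, hδ₁, L, hL, hcorr⟩ := exists_corrector_bounds bg hb0
  obtain ⟨ε₁, hε₁, C, hC, hspeed⟩ :=
    bg.exists_perturbedShockSpeed_bound hb0 hκ hsu hη hN hM (L := L) hL
  refine ⟨min ε₁ (min (δ₁ / N) (b₀ / 2 / N)), by positivity, C, hC, fun ε hε hlt b hb f hf T ζ Φ hsol
    hbound t ht y hy p hpe => ?_⟩
  simp only [lt_min_iff] at hlt
  obtain ⟨hlt1, hlt2, hlt3⟩ := hlt
  rw [lt_div_iff₀ hN] at hlt2 hlt3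
  have hs0 : 0 < bg.s₀ := hb0.trans bg.b₀_lt_s₀
  have hpos : ∀ t ∈ Icc 1 T, ∀ y : E3, ‖y‖ = 1 → 0 < ζ t y := by
    intro t ht y hy
    have h1 := hb.le_path (p := (t, y)) (by linarith) ht.1 (norm_pos_iff.1 (by rw [hy]; norm_num))
    have h2 := hsol.ahead t ht y hy
    have h3 : onRays (pistonPath b) (t, y) = pistonPath b t y := by simp [onRays, hy]
    rw [h3] at h1
    have : 0 < t * (b₀ / 2) := by have := ht.1; positivity
    simp only at h1
    linarith
  have hζ := hpos t ht y hy
  obtain ⟨hmem, hn, hrζ⟩ := hsol.mem_shockDomain ht hy hζ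
  rw [← hpe] at hmem hrζ
  have hp1 : p.1 = t := by rw [hpe]
  have hn' : ‖p.2‖ = ζ t y := by rw [hpe]; exact hn
  have h0 : 0 < t := by linarith [ht.1]
  have hp0 := hmem.2.1
  have hbd := hbound p hmem
  simp only [Finset.sum_range_succ, Finset.sum_range_zero, zero_add, pow_zero, one_mul, pow_one]
    at hbd
  rw [norm_iteratedFDeriv_one, norm_iteratedFDeriv_one] at hbd
  have hnn : 0 ≤ p.1 * (‖iteratedFDeriv ℝ (1 + 1) (pertPotential bg f Φ) p‖ +
      ‖iteratedFDeriv ℝ (1 + 1) (pertShock bg ζ) p‖) := by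
    rw [hp1]; positivity
  have hξb : |pertShock bg ζ p| ≤ M * ε := by
    linarith [norm_nonneg (fderiv ℝ (pertPotential bg f Φ) p),
      norm_nonneg (fderiv ℝ (pertShock bg ζ) p)]
  have hDb : ‖fderiv ℝ (pertPotential bg f Φ) p‖ ≤ M * ε := by
    linarith [abs_nonneg (pertShock bg ζ p), norm_nonneg (fderiv ℝ (pertShock bg ζ) p)]
  have hξe : pertShock bg ζ p = (ζ t y - bg.s₀ * t) / t := by
    rw [pertShock, hrζ, hp1]; field_simp
  rw [hξe] at hξb
  set ξ := (ζ t y - bg.s₀ * t) / t with hξ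
  have hse : ‖p.2‖ / p.1 = bg.s₀ + ξ := by
    rw [hn', hp1, hξ]; field_simp; ring
  -- The bounds on the corrector need the point to lie in the layer. The part of the estimate that
  -- locates `ξ` does not involve the corrector, so it is first applied with `f = 0`.
  have hξs : |ξ| ≤ M * ε → bg.s₀ + ξ ∈ Ioo (b₀ - bg.τ) (bg.s₀ + bg.τ) ∧ |ξ| ≤ (bg.s₀ - b₀) / 2 :=
    fun h => by
      obtain ⟨g1, -, g3, -⟩ := hspeed ε hε hlt1 ξ 0 h (by
        have := bg.u_pos hb0 bg.shock_mem
        rw [abs_zero]; positivity)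
      exact ⟨g1, g3⟩
  obtain ⟨hI, hξ2⟩ := hξs hξb
  have hR : ‖p.2‖ ≤ p.1 * (bg.s₀ + (bg.s₀ - b₀) / 2) := by
    rw [← div_le_iff₀' (by rw [hp1]; exact h0), hse]
    linarith [(abs_le.1 hξ2).2]
  obtain ⟨hf0, hft, hfZ, hfr⟩ := hcorr (N * ε) b f (by positivity) (by linarith) hb hf p
    (by rw [hp1]; exact ht.1) hp0 hmem.2.2.1 hR
  obtain ⟨-, hs2, -, hφ, hmain⟩ := hspeed ε hε hlt1 ξ (f p) hξb hf0
  have hpt : 0 < p.1 := by rw [hp1]; exact h0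
  have hfs := hf.smooth p hpt hp0 hmem.2.2.1
  have hI' : ‖p.2‖ / p.1 ∈ Ioo (b₀ - bg.τ) (bg.s₀ + bg.τ) := by rw [hse]; exact hI
  obtain ⟨md, mt, mr, mZ⟩ := bg.modifiedPotential_derivatives hpt hp0 hI'
    (hfs.differentiableAt (by simp))
  rw [hse] at mt mr mZ
  have hΦd := (hsol.regular_Φ p hmem).differentiableAt (by norm_num)
  have hsub : ∀ e, fderiv ℝ Φ p e = fderiv ℝ (pertPotential bg f Φ) p e +
      fderiv ℝ (modifiedPotential bg f) p e := by
    intro e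
    have h : HasFDerivAt (pertPotential bg f Φ) _ p := hΦd.hasFDerivAt.sub md.hasFDerivAt
    rw [h.fderiv, _root_.sub_apply]
    ring
  have hdiff : ContDiffAt ℝ 1 (pertPotential bg f Φ) p :=
    ((hsol.regular_Φ p hmem).of_le (by norm_num)).sub
      ((contDiffAt_const.add (hfs.of_le (by exact_mod_cast le_top))).mul
        (bg.contDiffAt_potential hpt hp0 hI'))
  refine ⟨hζ, hmem, hdiff, ?_, fun htI => ?_⟩
  -- On the shock `φ̇ = -Φ_a`, so `φ̇` is of the size of the shock displacement.
  · have hc := hsol.continuity p hmem (by rw [hn', hrζ])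
    have e : |pertPotential bg f Φ p| = |1 + f p| * (t * |bg.profile (bg.s₀ + ξ)|) := by
      rw [pertPotential, hc, zero_sub, abs_neg, modifiedPotential, abs_mul, potential, hse, abs_mul,
        hp1, abs_of_pos h0]
    have h1 : |1 + f p| ≤ 1 + |f p| := by
      simpa using abs_add_le 1 (f p)
    have h2 : |ζ t y - bg.s₀ * t| = t * |ξ| := by
      rw [hξ, abs_div, abs_of_pos h0]; field_simp
    rw [e, h2]
    calc |1 + f p| * (t * |bg.profile (bg.s₀ + ξ)|) ≤
          (1 + |f p|) * (t * |bg.profile (bg.s₀ + ξ)|) :=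
          mul_le_mul_of_nonneg_right h1 (by positivity)
      _ = t * ((1 + |f p|) * |bg.profile (bg.s₀ + ξ)|) := by ring
      _ ≤ t * ((1 + η) * bg.u bg.s₀ * |ξ|) := mul_le_mul_of_nonneg_left hφ h0.le
      _ = _ := by ring
  · obtain ⟨hJ, hζt⟩ := hsol.jump_eq_zero hpos (by rw [hp1]; exact htI) hmem (by rw [hn', hrζ])
    obtain ⟨n1, n2, n3⟩ := norm_fderiv_bounds hp0 hDb
    set W := Real.sqrt (1 / ‖p.2‖ ^ 2 * ∑ k, dZ k (pertPotential bg f Φ) p ^ 2) with hW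
    have hpn : 0 < ‖p.2‖ := norm_pos_iff.2 hp0
    have hWsq : W ^ 2 = 1 / ‖p.2‖ ^ 2 * ∑ k, dZ k (pertPotential bg f Φ) p ^ 2 :=
      Real.sq_sqrt (mul_nonneg (by positivity) (Finset.sum_nonneg fun _ _ => sq_nonneg _))
    have hm : 1 / ‖p.2‖ ^ 2 * ∑ k, dZ k Φ p ^ 2 ≤
        2 * W ^ 2 + 24 * L ^ 2 / bg.s₀ ^ 2 * bg.profile (bg.s₀ + ξ) ^ 2 := by
      have hk : ∀ k, dZ k Φ p ^ 2 ≤ 2 * dZ k (pertPotential bg f Φ) p ^ 2 +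
          2 * (t ^ 2 * L ^ 2 * bg.profile (bg.s₀ + ξ) ^ 2) := by
        intro k
        have e : dZ k Φ p = dZ k (pertPotential bg f Φ) p +
            t * dZ k f p * bg.profile (bg.s₀ + ξ) := by
          rw [← hp1, ← mZ k]; exact hsub _
        have h1 : (t * dZ k f p * bg.profile (bg.s₀ + ξ)) ^ 2 ≤
            t ^ 2 * L ^ 2 * bg.profile (bg.s₀ + ξ) ^ 2 := by
          have h2 : dZ k f p ^ 2 ≤ L ^ 2 := by
            rw [← sq_abs]; exact pow_le_pow_left₀ (abs_nonneg _) (hfZ k) 2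
          rw [mul_pow, mul_pow]
          exact mul_le_mul_of_nonneg_right (mul_le_mul_of_nonneg_left h2 (sq_nonneg _))
            (sq_nonneg _)
        rw [e]
        linarith [sq_nonneg (dZ k (pertPotential bg f Φ) p -
          t * dZ k f p * bg.profile (bg.s₀ + ξ)), add_sq (dZ k (pertPotential bg f Φ) p)
          (t * dZ k f p * bg.profile (bg.s₀ + ξ)), sub_sq (dZ k (pertPotential bg f Φ) p)
          (t * dZ k f p * bg.profile (bg.s₀ + ξ))]
      have hsum := Finset.sum_le_sum (s := Finset.univ) fun k _ => hk k
      rw [Finset.sum_add_distrib, ← Finset.mul_sum] at hsum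
      simp only [Finset.sum_const, Finset.card_univ, Fintype.card_fin, nsmul_eq_mul,
        Nat.cast_ofNat] at hsum
      -- Since `r/t ≥ s₀/2`; with the 6 from three squares this makes the 24.
      have hrs : 1 / ‖p.2‖ ^ 2 * t ^ 2 ≤ 4 / bg.s₀ ^ 2 := by
        have e : 1 / ‖p.2‖ ^ 2 * t ^ 2 = 1 / (bg.s₀ + ξ) ^ 2 := by
          rw [← hse, hp1]; field_simp
        rw [e, show 4 / bg.s₀ ^ 2 = 1 / (bg.s₀ / 2) ^ 2 by field_simp; norm_num]
        exact one_div_le_one_div_of_le (by positivity)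
          (pow_le_pow_left₀ (by positivity) hs2 2)
      rw [hWsq]
      refine (mul_le_mul_of_nonneg_left hsum (by positivity)).trans ?_
      have := mul_le_mul_of_nonneg_right hrs
        (by positivity : 0 ≤ 6 * (L ^ 2 * bg.profile (bg.s₀ + ξ) ^ 2))
      have e2 : 4 / bg.s₀ ^ 2 * (6 * (L ^ 2 * bg.profile (bg.s₀ + ξ) ^ 2)) =
        24 * L ^ 2 / bg.s₀ ^ 2 * bg.profile (bg.s₀ + ξ) ^ 2 := by ring
      linarith
    obtain ⟨hv, hfin⟩ := hmain (dt (pertPotential bg f Φ) p) (dr (pertPotential bg f Φ) p)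
      (p.1 * dt f p) (p.1 * dr f p) W _ n1 n2 hft hfr (Real.sqrt_nonneg _) (by linarith)
      (mul_nonneg (by positivity) (Finset.sum_nonneg fun _ _ => sq_nonneg _)) hm
      (dt Φ p) (dr Φ p) (by rw [← mt]; exact hsub _) (by rw [← mr]; exact hsub _) hJ
    have e : dt (onRays ζ) p = -dt Φ p / dr Φ p := by
      rw [eq_div_iff hv.ne']; linarith
    rw [e]
    exact hfin

end Shock

/-! ### A weighted inequality in one variable -/

/-- A Hardy-type inequality for a function with a damped first order equation. -/
theorem hardy_of_damped {T μ g k θ η c e : ℝ} {ψ ψ' D W : ℝ → ℝ} (hT : 1 < T) (hg : 0 < g)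
    (hμ : μ ≤ -2 - g) (hk : 0 ≤ k) (hθ : 1 / 2 ≤ θ) (hη : η ≤ 1 / 4)
    (hψ : ∀ t ∈ Icc 1 T, HasDerivAt ψ (ψ' t) t) (hψ' : ContinuousOn ψ' (Icc 1 T))
    (hD : ContinuousOn D (Icc 1 T)) (hW : ContinuousOn W (Icc 1 T))
    (h : ∀ t ∈ Ioo 1 T, |ψ' t + (k * D t + θ * (ψ t / t))| ≤
      η * (|D t| + |ψ t / t|) + c * W t + e) :
    ∫ t in (1 : ℝ)..T, t ^ (μ - 1) * ψ t ^ 2 ≤ ψ 1 ^ 2 +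
      4 * (k + η) ^ 2 / μ ^ 2 * (∫ t in (1 : ℝ)..T, t ^ (μ + 1) * D t ^ 2) +
      4 * c ^ 2 * (∫ t in (1 : ℝ)..T, t ^ (μ + 1) * W t ^ 2) + 4 * e ^ 2 / g := by
  have hm : 0 < -μ := by linarith
  have hpos : ∀ t ∈ Icc 1 T, 0 < t := fun t ht => by linarith [ht.1]
  have hψc : ContinuousOn ψ (Icc 1 T) := fun t ht => (hψ t ht).continuousAt.continuousWithinAt
  have hrpow : ∀ ν : ℝ, ContinuousOn (fun t : ℝ => t ^ ν) (Icc 1 T) := fun ν t ht =>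
    (Real.continuousAt_rpow_const t ν (Or.inl (hpos t ht).ne')).continuousWithinAt
  have hint : ∀ {F : ℝ → ℝ}, ContinuousOn F (Icc 1 T) → IntervalIntegrable F volume 1 T :=
    fun hF => by
      rw [← uIcc_of_le hT.le] at hF
      exact hF.intervalIntegrable
  have hder : ∀ t ∈ Icc 1 T, HasDerivAt (fun t => t ^ μ * ψ t ^ 2)
      (μ * t ^ (μ - 1) * ψ t ^ 2 + t ^ μ * (2 * ψ t * ψ' t)) t := by
    intro t ht
    have h1 := Real.hasDerivAt_rpow_const (p := μ) (Or.inl (hpos t ht).ne')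
    refine (h1.mul ((hψ t ht).pow 2)).congr_deriv ?_
    simp only [Pi.pow_apply, Nat.cast_ofNat, Nat.add_one_sub_one, pow_one]
  have hFc : ContinuousOn (fun t => μ * t ^ (μ - 1) * ψ t ^ 2 + t ^ μ * (2 * ψ t * ψ' t))
      (Icc 1 T) :=
    ((continuousOn_const.mul (hrpow _)).mul (hψc.pow 2)).add
      ((hrpow _).mul ((continuousOn_const.mul hψc).mul hψ'))
  have hFTC := intervalIntegral.integral_eq_sub_of_hasDerivAt
    (fun t ht => hder t (by rwa [uIcc_of_le hT.le] at ht)) (hint hFc)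
  have iX : IntervalIntegrable (fun t : ℝ => t ^ (μ - 1) * ψ t ^ 2) volume 1 T :=
    hint ((hrpow _).mul (hψc.pow 2))
  have iY : IntervalIntegrable (fun t : ℝ => t ^ (μ + 1) * D t ^ 2) volume 1 T :=
    hint ((hrpow _).mul (hD.pow 2))
  have iZ : IntervalIntegrable (fun t : ℝ => t ^ (μ + 1) * W t ^ 2) volume 1 T :=
    hint ((hrpow _).mul (hW.pow 2))
  have iE : IntervalIntegrable (fun t : ℝ => t ^ (μ + 1)) volume 1 T := hint (hrpow _)
  -- Half of the negative term `μ t^(μ-1) ψ²` is kept and the other half pays for the product of `ψ`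
  -- and `D`.
  have hpt : ∀ t ∈ Ioo 1 T, μ * t ^ (μ - 1) * ψ t ^ 2 + t ^ μ * (2 * ψ t * ψ' t) ≤
      μ / 2 * (t ^ (μ - 1) * ψ t ^ 2) + 2 / (-μ) * (k + η) ^ 2 * (t ^ (μ + 1) * D t ^ 2) +
      4 * c ^ 2 * (t ^ (μ + 1) * W t ^ 2) + 4 * e ^ 2 * t ^ (μ + 1) := by
    intro t ht
    have ht0 : 0 < t := by linarith [ht.1]
    have e1 : t ^ μ = t ^ (μ - 1) * t := by
      rw [← Real.rpow_add_one ht0.ne']; ring_nf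
    have e2 : t ^ (μ + 1) = t ^ (μ - 1) * t ^ 2 := by
      rw [← Real.rpow_natCast, ← Real.rpow_add ht0]; norm_num; ring_nf
    have hw : 0 < t ^ (μ - 1) := Real.rpow_pos_of_pos ht0 _
    rw [e1, e2]
    suffices hs : μ * ψ t ^ 2 + t * (2 * ψ t * ψ' t) ≤ μ / 2 * ψ t ^ 2 +
        2 / (-μ) * (k + η) ^ 2 * (t ^ 2 * D t ^ 2) + 4 * c ^ 2 * (t ^ 2 * W t ^ 2) +
        4 * e ^ 2 * t ^ 2 by
      have := mul_le_mul_of_nonneg_left hs hw.le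
      linarith
    have hb := h t ht
    set r := ψ' t + (k * D t + θ * (ψ t / t)) with hr
    have hψ't : ψ' t = r - k * D t - θ * (ψ t / t) := by rw [hr]; ring
    have e3 : t * (2 * ψ t * ψ' t) = 2 * ψ t * (t * r) - 2 * k * (ψ t * (t * D t)) -
        2 * θ * ψ t ^ 2 := by
      rw [hψ't]; field_simp
    have htr : t * |r| ≤ η * (t * |D t|) + η * |ψ t| + c * (t * W t) + e * t := by
      have := mul_le_mul_of_nonneg_left hb ht0.le
      have e4 : t * |ψ t / t| = |ψ t| := by rw [abs_div, abs_of_pos ht0]; field_simp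
      have e5 : t * (η * (|D t| + |ψ t / t|) + c * W t + e) =
        η * (t * |D t|) + η * (t * |ψ t / t|) + c * (t * W t) + e * t := by ring
      rw [e5, e4] at this
      exact this
    set A := |ψ t| with hA
    have hA0 : 0 ≤ A := abs_nonneg _
    have hA2 : ψ t ^ 2 = A ^ 2 := (sq_abs _).symm
    have f1 : 2 * ψ t * (t * r) ≤ 2 * A * (t * |r|) := by
      refine (le_abs_self _).trans (le_of_eq ?_)
      rw [abs_mul, abs_mul, abs_mul, abs_two, abs_of_pos ht0]
    have f2 : -(2 * k * (ψ t * (t * D t))) ≤ 2 * k * (A * (t * |D t|)) := by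
      refine (neg_le_abs _).trans (le_of_eq ?_)
      rw [abs_mul, abs_mul, abs_mul, abs_mul, abs_two, abs_of_pos ht0, abs_of_nonneg hk]
    have f3 : 2 * A * (t * |r|) ≤
        2 * A * (η * (t * |D t|) + η * A + c * (t * W t) + e * t) :=
      mul_le_mul_of_nonneg_left htr (by positivity)
    -- Young's inequality with weight `-μ/2`; after division by `-μ/2` it gives `4 (k + η)²/μ²`.
    have f4 : 2 * (k + η) * (A * (t * |D t|)) ≤
        -μ / 2 * A ^ 2 + 2 / (-μ) * (k + η) ^ 2 * (t ^ 2 * D t ^ 2) := by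
      have h1 : 0 ≤ 1 / (2 * -μ) * (-μ * A - 2 * ((k + η) * (t * |D t|))) ^ 2 := by positivity
      have h2 : 1 / (2 * -μ) * (-μ * A - 2 * ((k + η) * (t * |D t|))) ^ 2 =
          -μ / 2 * A ^ 2 - 2 * (k + η) * (A * (t * |D t|)) +
            2 / (-μ) * (k + η) ^ 2 * (t ^ 2 * |D t| ^ 2) := by
        have : μ ≠ 0 := by linarith
        field_simp
        ring
      rw [sq_abs (D t)] at h2
      linarith
    have f5 : 2 * A * (c * (t * W t)) ≤ 1 / 4 * A ^ 2 + 4 * c ^ 2 * (t ^ 2 * W t ^ 2) := by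
      linarith [sq_nonneg (1 / 2 * A - 2 * (c * (t * W t))), sub_sq (1 / 2 * A) (2 * (c * (t * W t)))]
    have f6 : 2 * A * (e * t) ≤ 1 / 4 * A ^ 2 + 4 * e ^ 2 * t ^ 2 := by
      linarith [sq_nonneg (1 / 2 * A - 2 * (e * t)), sub_sq (1 / 2 * A) (2 * (e * t))]
    -- The errors cost `2 η A² + A²/4 + A²/4 ≤ A²`, which the damping `2 θ A²` covers.
    have f7 : η * A ^ 2 ≤ 1 / 4 * A ^ 2 := mul_le_mul_of_nonneg_right hη (sq_nonneg A)
    have f8 : 1 / 2 * A ^ 2 ≤ θ * A ^ 2 := mul_le_mul_of_nonneg_right hθ (sq_nonneg A)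
    rw [e3, hA2]
    linarith
  have hmono := intervalIntegral.integral_mono_on_of_le_Ioo hT.le (hint hFc)
    ((((iX.const_mul (μ / 2)).add (iY.const_mul (2 / (-μ) * (k + η) ^ 2))).add
      (iZ.const_mul (4 * c ^ 2))).add (iE.const_mul (4 * e ^ 2))) hpt
  rw [hFTC, intervalIntegral.integral_add, intervalIntegral.integral_add,
    intervalIntegral.integral_add, intervalIntegral.integral_const_mul,
    intervalIntegral.integral_const_mul, intervalIntegral.integral_const_mul,
    intervalIntegral.integral_const_mul, Real.one_rpow, one_mul] at hmono
  rotate_left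
  · exact iX.const_mul _
  · exact iY.const_mul _
  · exact (iX.const_mul _).add (iY.const_mul _)
  · exact iZ.const_mul _
  · exact ((iX.const_mul _).add (iY.const_mul _)).add (iZ.const_mul _)
  · exact iE.const_mul _
  have hnn : ∀ F : ℝ → ℝ, 0 ≤ ∫ t in (1 : ℝ)..T, t ^ (μ + 1) * F t ^ 2 := fun F =>
    intervalIntegral.integral_nonneg hT.le fun t ht =>
      mul_nonneg (Real.rpow_nonneg (hpos t ht).le _) (sq_nonneg _)
  have hE : ∫ t in (1 : ℝ)..T, t ^ (μ + 1) ≤ 1 / g := by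
    have h0 : (0 : ℝ) ∉ uIcc 1 T := by
      rw [uIcc_of_le hT.le]; exact fun h => by linarith [h.1]
    rw [integral_rpow (Or.inr ⟨by linarith, h0⟩), Real.one_rpow]
    have h1 : 0 ≤ T ^ (μ + 1 + 1) := Real.rpow_nonneg (by linarith) _
    rw [← neg_div_neg_eq, div_le_div_iff₀ (by linarith) hg]
    nlinarith
  set X := ∫ t in (1 : ℝ)..T, t ^ (μ - 1) * ψ t ^ 2
  set Y := ∫ t in (1 : ℝ)..T, t ^ (μ + 1) * D t ^ 2 with hY
  set Z := ∫ t in (1 : ℝ)..T, t ^ (μ + 1) * W t ^ 2 with hZ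
  have hZ0 : 0 ≤ Z := hnn W
  have hTT : 0 ≤ T ^ μ * ψ T ^ 2 := mul_nonneg (Real.rpow_nonneg (by linarith) _) (sq_nonneg _)
  have hE' := mul_le_mul_of_nonneg_left hE (by positivity : 0 ≤ 4 * e ^ 2)
  have hmain : -μ / 2 * X ≤ ψ 1 ^ 2 + 2 / (-μ) * (k + η) ^ 2 * Y + 4 * c ^ 2 * Z +
      4 * e ^ 2 * (1 / g) := by linarith
  -- As `μ ≤ -2`, dividing by `-μ/2` does not enlarge the remaining terms.
  have h1 : 1 ≤ -μ / 2 := by linarith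
  have h2 : -μ / 2 * (4 * (k + η) ^ 2 / μ ^ 2 * Y) = 2 / (-μ) * (k + η) ^ 2 * Y := by
    have : μ ≠ 0 := by linarith
    field_simp
    ring
  have h3 : 0 ≤ ψ 1 ^ 2 + 4 * c ^ 2 * Z + 4 * e ^ 2 * (1 / g) := by positivity
  have h4 : -μ / 2 * X ≤ -μ / 2 * (ψ 1 ^ 2 + 4 * (k + η) ^ 2 / μ ^ 2 * Y + 4 * c ^ 2 * Z +
      4 * e ^ 2 / g) := by
    have h5 := mul_le_mul_of_nonneg_right h1 h3
    have h6 : 4 * e ^ 2 / g = 4 * e ^ 2 * (1 / g) := by ring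
    rw [h6]
    linarith
  exact le_of_mul_le_mul_left h4 (by linarith)

/-! ### Integration over the shock surface -/

theorem continuous_onRays_sphere {ζ : ℝ → E3 → ℝ} {T : ℝ}
    (hζ : ∀ p : ℝ × E3, p.1 ∈ Icc 1 T → p.2 ≠ 0 → ContDiffAt ℝ 2 (onRays ζ) p) {t : ℝ}
    (ht : t ∈ Icc 1 T) {y : E3} (hy : ‖y‖ = 1) : ContinuousAt (onRays ζ) (t, y) :=
  (hζ (t, y) ht (norm_pos_iff.1 (by rw [hy]; norm_num))).continuousAt

/-- Regularity is known only for `t ∈ [1, T]`. Clamping the time by `projIcc` makes the integrand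
jointly continuous for all times without changing the integral. -/
theorem continuous_shock_integral {ζ : ℝ → E3 → ℝ} {T : ℝ} (hT : 1 < T)
    (hζ : ∀ p : ℝ × E3, p.1 ∈ Icc 1 T → p.2 ≠ 0 → ContDiffAt ℝ 2 (onRays ζ) p)
    {g : ℝ × E3 → ℝ}
    (hg : ∀ t ∈ Icc 1 T, ∀ y : E3, ‖y‖ = 1 → ContinuousAt g (t, ζ t y • y)) :
    Continuous fun y : Metric.sphere (0 : E3) 1 =>
      ∫ t in (1 : ℝ)..T, g (t, ζ t y • (y : E3)) := by
  have hy1 : ∀ y : Metric.sphere (0 : E3) 1, ‖(y : E3)‖ = 1 := fun y => by simp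
  have hcurve : Continuous fun z : Metric.sphere (0 : E3) 1 × ℝ =>
      (((projIcc 1 T hT.le z.2 : ℝ), ζ (projIcc 1 T hT.le z.2) z.1 • (z.1 : E3)) : ℝ × E3) := by
    have hp : Continuous fun z : Metric.sphere (0 : E3) 1 × ℝ => (projIcc 1 T hT.le z.2 : ℝ) :=
      continuous_subtype_val.comp (continuous_projIcc.comp continuous_snd)
    have hy : Continuous fun z : Metric.sphere (0 : E3) 1 × ℝ => (z.1 : E3) :=
      continuous_subtype_val.comp continuous_fst
    suffices hζc : Continuous fun z : Metric.sphere (0 : E3) 1 × ℝ =>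
        ζ (projIcc 1 T hT.le z.2) z.1 from hp.prodMk (hζc.smul hy)
    have e : (fun z : Metric.sphere (0 : E3) 1 × ℝ => ζ (projIcc 1 T hT.le z.2) z.1) =
        fun z => onRays ζ ((projIcc 1 T hT.le z.2 : ℝ), (z.1 : E3)) := by
      ext z; simp [onRays]
    rw [e, continuous_iff_continuousAt]
    intro z
    exact ContinuousAt.comp (f := fun z : Metric.sphere (0 : E3) 1 × ℝ =>
      ((projIcc 1 T hT.le z.2 : ℝ), (z.1 : E3)))
      (continuous_onRays_sphere hζ (projIcc 1 T hT.le z.2).2 (hy1 z.1)) (hp.prodMk hy).continuousAt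
  have hG : Continuous fun z : Metric.sphere (0 : E3) 1 × ℝ =>
      g ((projIcc 1 T hT.le z.2 : ℝ), ζ (projIcc 1 T hT.le z.2) z.1 • (z.1 : E3)) := by
    rw [continuous_iff_continuousAt]
    intro z
    exact ContinuousAt.comp (g := g) (hg _ (projIcc 1 T hT.le z.2).2 _ (hy1 z.1)) hcurve.continuousAt
  have h := intervalIntegral.continuous_parametric_intervalIntegral_of_continuous (μ := volume)
    (a₀ := (1 : ℝ)) (f := fun (y : Metric.sphere (0 : E3) 1) (t : ℝ) =>
      g ((projIcc 1 T hT.le t : ℝ), ζ (projIcc 1 T hT.le t) y • (y : E3))) hG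
    (s := fun _ => T) continuous_const
  refine h.congr fun y => intervalIntegral.integral_congr fun t ht => ?_
  rw [uIcc_of_le hT.le] at ht
  simp only [projIcc_of_mem hT.le ht]

theorem continuousOn_shock_curve {ζ : ℝ → E3 → ℝ} {T : ℝ}
    (hζ : ∀ p : ℝ × E3, p.1 ∈ Icc 1 T → p.2 ≠ 0 → ContDiffAt ℝ 2 (onRays ζ) p)
    {g : ℝ × E3 → ℝ} {y : E3} (hy : ‖y‖ = 1)
    (hg : ∀ t ∈ Icc 1 T, ContinuousAt g (t, ζ t y • y)) :
    ContinuousOn (fun t => g (t, ζ t y • y)) (Icc 1 T) := by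
  intro t ht
  have h1 : ContinuousAt (fun t => ζ t y) t := by
    have e : (fun t => ζ t y) = fun t => onRays ζ (t, y) := by
      ext s; simp [onRays, hy]
    rw [e]
    exact ContinuousAt.comp (f := fun t : ℝ => (t, y)) (continuous_onRays_sphere hζ ht hy)
      (by fun_prop)
  exact (ContinuousAt.comp (f := fun t => (t, ζ t y • y)) (hg t ht)
    (continuousAt_id.prodMk (h1.smul continuousAt_const))).continuousWithinAt

theorem continuousAt_dt {f : ℝ × E3 → ℝ} {p : ℝ × E3} (hf : ContDiffAt ℝ 1 f p) :
    ContinuousAt (dt f) p := (hf.dt (n := 0) (by norm_num)).continuousAt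

theorem continuousAt_dZ {f : ℝ × E3 → ℝ} {p : ℝ × E3} (hf : ContDiffAt ℝ 1 f p) (k : Fin 3) :
    ContinuousAt (dZ k f) p := (hf.dZ (n := 0) (by norm_num) k).continuousAt

theorem continuousAt_angular {f : ℝ × E3 → ℝ} {p : ℝ × E3} (hf : ContDiffAt ℝ 1 f p)
    (hp : p.2 ≠ 0) : ContinuousAt (fun q => 1 / ‖q.2‖ ^ 2 * ∑ k, dZ k f q ^ 2) p := by
  refine (continuousAt_const.div (continuous_snd.continuousAt.norm.pow 2)
    (pow_ne_zero 2 (norm_ne_zero_iff.2 hp))).mul ?_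
  exact tendsto_finsetSum _ fun k _ => (continuousAt_dZ hf k).pow 2

theorem shockIntegral_nonneg {ζ : ℝ → E3 → ℝ} {T ν : ℝ} (hT : 1 < T) (g : ℝ × E3 → ℝ)
    (hg : ∀ p, 0 ≤ g p) : 0 ≤ shockIntegral ζ T fun p => p.1 ^ ν * g p :=
  integral_nonneg fun y => intervalIntegral.integral_nonneg hT.le fun t ht =>
    mul_nonneg (Real.rpow_nonneg (by linarith [ht.1]) _) (hg _)

/-! ### The Hardy-type inequality -/

variable {G : Gas} {b₀ : ℝ}

/-- Consequence of `hardy_of_damped` for a function dominated by `ψ`. -/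
theorem hardy_of_damped_of_le {T μ g k θ η c e L : ℝ} {φ ψ ψ' D W : ℝ → ℝ} (hT : 1 < T)
    (hg : 0 < g) (hμ : μ ≤ -2 - g) (hk : 0 ≤ k) (hθ : 1 / 2 ≤ θ) (hη : η ≤ 1 / 4)
    (hψ : ∀ t ∈ Icc 1 T, HasDerivAt ψ (ψ' t) t) (hψ' : ContinuousOn ψ' (Icc 1 T))
    (hD : ContinuousOn D (Icc 1 T)) (hW : ContinuousOn W (Icc 1 T))
    (h : ∀ t ∈ Ioo 1 T, |ψ' t + (k * D t + θ * (ψ t / t))| ≤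
      η * (|D t| + |ψ t / t|) + c * W t + e)
    (hφ : ContinuousOn φ (Icc 1 T)) (hφψ : ∀ t ∈ Icc 1 T, |φ t| ≤ L * |ψ t|) :
    ∫ t in (1 : ℝ)..T, t ^ (μ - 1) * φ t ^ 2 ≤ L ^ 2 * (ψ 1 ^ 2 +
      4 * (k + η) ^ 2 / μ ^ 2 * (∫ t in (1 : ℝ)..T, t ^ (μ + 1) * D t ^ 2) +
      4 * c ^ 2 * (∫ t in (1 : ℝ)..T, t ^ (μ + 1) * W t ^ 2) + 4 * e ^ 2 / g) := by
  have hmain := hardy_of_damped hT hg hμ hk hθ hη hψ hψ' hD hW h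
  refine le_trans ?_ (mul_le_mul_of_nonneg_left hmain (sq_nonneg L))
  have hpos : ∀ t ∈ Icc 1 T, 0 < t := fun t ht => by linarith [ht.1]
  have hr : ContinuousOn (fun t : ℝ => t ^ (μ - 1)) (Icc 1 T) := fun t ht =>
    (Real.continuousAt_rpow_const t _ (Or.inl (hpos t ht).ne')).continuousWithinAt
  have hψc : ContinuousOn ψ (Icc 1 T) := fun t ht => (hψ t ht).continuousAt.continuousWithinAt
  rw [← intervalIntegral.integral_const_mul]
  refine intervalIntegral.integral_mono_on hT.le
    ((hr.mul (hφ.pow 2)).intervalIntegrable_of_Icc hT.le)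
    ((continuousOn_const.mul (hr.mul (hψc.pow 2))).intervalIntegrable_of_Icc hT.le)
    fun t ht => ?_
  have h1 : φ t ^ 2 ≤ L ^ 2 * ψ t ^ 2 := by
    rw [← sq_abs (φ t), ← sq_abs (ψ t), ← mul_pow]
    exact pow_le_pow_left₀ (abs_nonneg _) (hφψ t ht) 2
  have := mul_le_mul_of_nonneg_left h1 (Real.rpow_nonneg (hpos t ht).le (μ - 1))
  linarith

/-- The choice of the loss `η` that makes the constant in the inequality at most `1 + w`. -/
theorem exists_loss {u w : ℝ} (hu : 0 < u) (hw : 0 < w) : ∃ η : ℝ, 0 < η ∧ η ≤ 1 / 4 ∧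
    ∀ κ : ℝ, 0 ≤ κ → κ ≤ 1 / 2 → ((1 + η) * u) ^ 2 * (4 * (κ / u + η) ^ 2) ≤ 1 + w := by
  set z := min 1 w / 16 with hz
  have hz0 : 0 < z := by positivity
  have hz1 : z ≤ 1 / 16 := by have := min_le_left 1 w; rw [hz]; linarith
  have hzw : z ≤ w / 16 := by have := min_le_right 1 w; rw [hz]; linarith
  -- The product equals `(1 + η)² (2 κ + 2 u η)²`. The two entries bound both bases by `1 + z`, and
  -- `(1 + z)⁴ ≤ 1 + 16 z ≤ 1 + w`.
  refine ⟨min z (z / (2 * u)), by positivity, (min_le_left _ _).trans (by linarith),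
    fun κ hκ0 hκ => ?_⟩
  set η := min z (z / (2 * u)) with hη
  have hη0 : 0 < η := by positivity
  have h1 : η ≤ z := min_le_left _ _
  have h2 : 2 * u * η ≤ z := by
    have := min_le_right z (z / (2 * u))
    rw [← hη, le_div_iff₀ (by positivity)] at this
    linarith
  have h3 : ((1 + η) * u) ^ 2 * (4 * (κ / u + η) ^ 2) =
      (1 + η) ^ 2 * (2 * κ + 2 * u * η) ^ 2 := by field_simp; ring
  have h4 : (1 + η) ^ 2 ≤ (1 + z) ^ 2 := by gcongr
  have h5 : (2 * κ + 2 * u * η) ^ 2 ≤ (1 + z) ^ 2 :=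
    pow_le_pow_left₀ (by positivity) (by linarith) 2
  rw [h3]
  calc (1 + η) ^ 2 * (2 * κ + 2 * u * η) ^ 2 ≤ (1 + z) ^ 2 * (1 + z) ^ 2 := by gcongr
    _ = 1 + z * (4 + 6 * z + 4 * z ^ 2 + z ^ 3) := by ring
    _ ≤ 1 + z * 16 := by
      have e1 : z ^ 2 ≤ 1 := pow_le_one₀ hz0.le (by linarith)
      have e2 : z ^ 3 ≤ 1 := pow_le_one₀ hz0.le (by linarith)
      have : 4 + 6 * z + 4 * z ^ 2 + z ^ 3 ≤ 16 := by linarith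
      have := mul_le_mul_of_nonneg_left this hz0.le
      linarith
    _ ≤ 1 + w := by linarith

/-- Integration over the sphere of an inequality that holds on each ray. -/
theorem shockIntegral_le_of_ray {ζ : ℝ → E3 → ℝ} {T μ a₀ a₁ a₂ : ℝ} (hT : 1 < T)
    (hζ : ∀ p : ℝ × E3, p.1 ∈ Icc 1 T → p.2 ≠ 0 → ContDiffAt ℝ 2 (onRays ζ) p)
    {φ : ℝ × E3 → ℝ}
    (hpos : ∀ t ∈ Icc 1 T, ∀ y : E3, ‖y‖ = 1 → 0 < ζ t y)
    (hφ : ∀ t ∈ Icc 1 T, ∀ y : E3, ‖y‖ = 1 → ContDiffAt ℝ 1 φ (t, ζ t y • y))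
    (h : ∀ y : E3, ‖y‖ = 1 →
      ∫ t in (1 : ℝ)..T, t ^ (μ - 1) * φ (t, ζ t y • y) ^ 2 ≤ a₀ +
        a₁ * (∫ t in (1 : ℝ)..T, t ^ (μ + 1) * dt φ (t, ζ t y • y) ^ 2) +
        a₂ * (∫ t in (1 : ℝ)..T, t ^ (μ + 1) *
          (1 / ‖ζ t y • y‖ ^ 2 * ∑ k, dZ k φ (t, ζ t y • y) ^ 2))) :
    shockIntegral ζ T (fun p => p.1 ^ (μ - 1) * φ p ^ 2) ≤
      (volume : Measure E3).toSphere.real univ * a₀ +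
      a₁ * shockIntegral ζ T (fun p => p.1 ^ (μ + 1) * dt φ p ^ 2) +
      a₂ * shockIntegral ζ T (fun p => p.1 ^ (μ + 1) * (1 / ‖p.2‖ ^ 2 * ∑ k, dZ k φ p ^ 2)) := by
  have hw : ∀ t ∈ Icc 1 T, ∀ x : E3,
      ContinuousAt (fun p : ℝ × E3 => p.1 ^ (μ + 1)) (t, x) := fun t ht x =>
    continuous_fst.continuousAt.rpow_const (Or.inl (by simp only; linarith [ht.1]))
  have hcont : ∀ g : ℝ × E3 → ℝ, (∀ t ∈ Icc 1 T, ∀ y : E3, ‖y‖ = 1 →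
      ContinuousAt g (t, ζ t y • y)) → Integrable (fun y : Metric.sphere (0 : E3) 1 =>
        ∫ t in (1 : ℝ)..T, g (t, ζ t y • (y : E3))) (volume : Measure E3).toSphere :=
    fun g hg => (continuous_shock_integral hT hζ hg).integrable_of_hasCompactSupport
      (HasCompactSupport.of_compactSpace _)
  have i1 := hcont (fun p => p.1 ^ (μ + 1) * dt φ p ^ 2) fun t ht y hy =>
    (hw t ht _).mul ((continuousAt_dt (hφ t ht y hy)).pow 2)
  have i2 := hcont (fun p => p.1 ^ (μ + 1) * (1 / ‖p.2‖ ^ 2 * ∑ k, dZ k φ p ^ 2))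
    fun t ht y hy => (hw t ht _).mul (continuousAt_angular (hφ t ht y hy)
      (norm_pos_iff.1 (by
        simp only [norm_smul, hy, mul_one]; exact norm_pos_iff.2 (hpos t ht y hy).ne')))
  have e1 := integral_add (integrable_const a₀) (i1.const_mul a₁)
  have e2 := integral_add ((integrable_const a₀).add (i1.const_mul a₁)) (i2.const_mul a₂)
  simp only [Pi.add_apply] at e2
  rw [e1, integral_const, smul_eq_mul, integral_const_mul, integral_const_mul] at e2
  refine le_trans ?_ e2.le
  refine integral_mono_of_nonneg (ae_of_all _ fun y => ?_)
    (((integrable_const _).add (i1.const_mul _)).add (i2.const_mul _))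
    (ae_of_all _ fun y => h y (by simp))
  exact intervalIntegral.integral_nonneg hT.le fun t ht =>
    mul_nonneg (Real.rpow_nonneg (by simp only; linarith [ht.1]) _) (sq_nonneg _)

/-- The Hardy-type inequality on the shock surface for one background solution. -/
theorem Background.exists_hardy_shock (bg : Background G b₀) (hb0 : 0 < b₀)
    (hκ : bg.polarCoeff ∈ Icc (1 / 4 : ℝ) (1 / 2)) (hsu : bg.s₀ ≤ 2 * bg.u bg.s₀)
    {w N M : ℝ} (hw : 0 < w) (hN : 0 < N) (hM : 0 < M) (K₀ : ℝ) {g : ℝ} (hg : 0 < g) :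
    ∃ ε₀ : ℝ, 0 < ε₀ ∧ ∀ ε, 0 < ε → ε < ε₀ →
    ∀ b, IsPistonClose b₀ (N * ε) b → ∀ f, IsCorrector bg (pistonPath b) f →
    ∀ T : ℝ, 1 < T →
    ∀ (ζ : ℝ → E3 → ℝ) (Φ : ℝ × E3 → ℝ), IsShockSolution G (pistonPath b) T ζ Φ →
    (∀ p ∈ shockDomain (pistonPath b) ζ T, p.1 = 1 →
      |pertPotential bg f Φ p| + |pertShock bg ζ p| ≤ K₀ * ε) →
    (∀ p ∈ shockDomain (pistonPath b) ζ T,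
      |pertShock bg ζ p| + ∑ l ∈ Finset.range 2, p.1 ^ l *
        (‖iteratedFDeriv ℝ (l + 1) (pertPotential bg f Φ) p‖
          + ‖iteratedFDeriv ℝ (l + 1) (pertShock bg ζ) p‖) ≤ M * ε) →
    ∀ μ : ℝ, μ ≤ -2 - g →
    shockIntegral ζ T (fun p => p.1 ^ (μ - 1) * pertPotential bg f Φ p ^ 2)
      ≤ (volume : Measure E3).toSphere.real univ *
          (4 * b₀ ^ 2 * (K₀ ^ 2 + 4 * (120 * N) ^ 2 / g) * ε ^ 2)
        + (1 + w) / μ ^ 2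
          * shockIntegral ζ T (fun p => p.1 ^ (μ + 1) * dt (pertPotential bg f Φ) p ^ 2)
        + ε * shockIntegral ζ T (fun p => p.1 ^ (μ + 1) *
            (1 / ‖p.2‖ ^ 2 * ∑ k, dZ k (pertPotential bg f Φ) p ^ 2)) := by
  have hu := bg.u_pos hb0 bg.shock_mem
  have hub : bg.u bg.s₀ ≤ b₀ := by
    have := bg.antitoneOn_u hb0 bg.wall_mem bg.shock_mem bg.b₀_lt_s₀.le
    rwa [bg.wall] at this
  obtain ⟨η, hη, hη4, hηw⟩ := exists_loss hu hw
  obtain ⟨ε₁, hε₁, C, hC, hineq⟩ := bg.exists_shock_inequality hb0 hκ hsu hη hN hM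
  -- The second entry bounds the angular coefficient `16 b₀² C² ε²` by `ε`, so `C`, which depends on
  -- `M` and the background, does not survive.
  refine ⟨min ε₁ (1 / (16 * b₀ ^ 2 * C ^ 2 + 1)), by positivity, fun ε hε hlt b hb f hf T hT ζ Φ
    hsol hinit hbound μ hμ => ?_⟩
  rw [lt_min_iff, lt_div_iff₀ (by positivity)] at hlt
  have hin := hineq ε hε hlt.1 b hb f hf T ζ Φ hsol hbound
  have hpos : ∀ t ∈ Icc 1 T, ∀ y : E3, ‖y‖ = 1 → 0 < ζ t y := fun t ht y hy =>
    (hin t ht y hy _ rfl).1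
  have hφ : ∀ t ∈ Icc 1 T, ∀ y : E3, ‖y‖ = 1 →
      ContDiffAt ℝ 1 (pertPotential bg f Φ) (t, ζ t y • y) := fun t ht y hy =>
    (hin t ht y hy _ rfl).2.2.1
  refine shockIntegral_le_of_ray hT hsol.regular_ζ hpos hφ fun y hy => ?_
  set φ := pertPotential bg f Φ with hφdef
  have h1T : (1 : ℝ) ∈ Icc 1 T := ⟨le_rfl, hT.le⟩
  have hne : ∀ t ∈ Icc 1 T, ζ t y • y ≠ 0 := fun t ht => by
    rw [← norm_pos_iff, norm_smul, hy, mul_one]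
    exact norm_pos_iff.2 (hpos t ht y hy).ne'
  have hζ2 : ∀ t ∈ Icc 1 T, ContDiffAt ℝ 2 (onRays ζ) (t, ζ t y • y) := fun t ht =>
    hsol.regular_ζ _ ht (hne t ht)
  have hcurve : ∀ {g : ℝ × E3 → ℝ}, (∀ t ∈ Icc 1 T, ContinuousAt g (t, ζ t y • y)) →
      ContinuousOn (fun t => g (t, ζ t y • y)) (Icc 1 T) := fun hg =>
    continuousOn_shock_curve hsol.regular_ζ hy hg
  have hang : ∀ t ∈ Icc 1 T, ContinuousAt (fun p : ℝ × E3 =>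
      Real.sqrt (1 / ‖p.2‖ ^ 2 * ∑ k, dZ k φ p ^ 2)) (t, ζ t y • y) := fun t ht =>
    (continuousAt_angular (hφ t ht y hy) (hne t ht)).sqrt
  have hk : 0 ≤ bg.polarCoeff / bg.u bg.s₀ := div_nonneg (by linarith [hκ.1]) hu.le
  -- The damping rate is at least `2 κ`, hence at least `1/2`.
  have hθ : 1 / 2 ≤ bg.polarCoeff / bg.u bg.s₀ * -(bg.s₀ * bg.shockSlope) := by
    have h1 := mul_le_mul_of_nonneg_left (bg.two_le_shockSlope hb0) hk
    have h2 : bg.polarCoeff / bg.u bg.s₀ * (2 * bg.u bg.s₀) = 2 * bg.polarCoeff := by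
      field_simp
    linarith [hκ.1]
  have hray := hardy_of_damped_of_le (φ := fun t => φ (t, ζ t y • y))
    (ψ := fun t => ζ t y - bg.s₀ * t)
    (ψ' := fun t => dt (onRays ζ) (t, ζ t y • y) - bg.s₀)
    (D := fun t => dt φ (t, ζ t y • y))
    (W := fun t => Real.sqrt (1 / ‖ζ t y • y‖ ^ 2 * ∑ k, dZ k φ (t, ζ t y • y) ^ 2))
    (L := (1 + η) * bg.u bg.s₀) (c := C * ε) (e := 120 * N * ε) hT hg hμ hk hθ hη4
    (fun t ht => by
      have h1 := hasDerivAt_onRays_time (hpos t ht y hy) hy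
        ((hζ2 t ht).differentiableAt (by norm_num))
      exact h1.sub (hasDerivAt_const_mul bg.s₀))
    ((hcurve fun t ht => continuousAt_dt ((hζ2 t ht).of_le (by norm_num))).sub
      continuousOn_const)
    (hcurve fun t ht => continuousAt_dt (hφ t ht y hy)) (hcurve hang)
    (fun t ht => by
      refine le_trans (le_of_eq ?_)
        ((hin t (Ioo_subset_Icc_self ht) y hy _ rfl).2.2.2.2 ht)
      congr 1
      ring)
    (hcurve fun t ht => (hφ t ht y hy).continuousAt)
    (fun t ht => (hin t ht y hy _ rfl).2.2.2.1)
  refine hray.trans ?_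
  have hW2 : ∀ t, Real.sqrt (1 / ‖ζ t y • y‖ ^ 2 * ∑ k, dZ k φ (t, ζ t y • y) ^ 2) ^ 2 =
      1 / ‖ζ t y • y‖ ^ 2 * ∑ k, dZ k φ (t, ζ t y • y) ^ 2 := fun t =>
    Real.sq_sqrt (by positivity)
  simp only [hW2]
  have hψ1 : (ζ 1 y - bg.s₀ * 1) ^ 2 ≤ (K₀ * ε) ^ 2 := by
    obtain ⟨m1, -, m3⟩ := hsol.mem_shockDomain h1T hy (hpos 1 h1T y hy)
    have h1 := hinit _ m1 rfl
    rw [pertShock, m3, div_one] at h1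
    rw [mul_one]
    refine sq_le_sq' ?_ ?_ <;>
      linarith [abs_nonneg (pertPotential bg f Φ (1, ζ 1 y • y)), le_abs_self (ζ 1 y - bg.s₀),
        neg_abs_le (ζ 1 y - bg.s₀)]
  have hint : ∀ F : ℝ → ℝ, (∀ t, 0 ≤ F t) → 0 ≤ ∫ t in (1 : ℝ)..T, t ^ (μ + 1) * F t :=
    fun F hF => intervalIntegral.integral_nonneg hT.le fun t ht =>
      mul_nonneg (Real.rpow_nonneg (by linarith [ht.1]) _) (hF t)
  have hY := hint (fun t => dt φ (t, ζ t y • y) ^ 2) fun t => sq_nonneg _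
  have hZ := hint (fun t => 1 / ‖ζ t y • y‖ ^ 2 * ∑ k, dZ k φ (t, ζ t y • y) ^ 2)
    fun t => by positivity
  set Y := ∫ t in (1 : ℝ)..T, t ^ (μ + 1) * dt φ (t, ζ t y • y) ^ 2
  set Z := ∫ t in (1 : ℝ)..T, t ^ (μ + 1) *
    (1 / ‖ζ t y • y‖ ^ 2 * ∑ k, dZ k φ (t, ζ t y • y) ^ 2)
  have hL : ((1 + η) * bg.u bg.s₀) ^ 2 ≤ 4 * b₀ ^ 2 := by
    have h1 : (1 + η) * bg.u bg.s₀ ≤ 2 * b₀ :=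
      mul_le_mul (by linarith) hub hu.le (by norm_num)
    calc ((1 + η) * bg.u bg.s₀) ^ 2 ≤ (2 * b₀) ^ 2 := pow_le_pow_left₀ (by positivity) h1 2
      _ = 4 * b₀ ^ 2 := by ring
  have hA := hηw bg.polarCoeff (by linarith [hκ.1]) hκ.2
  have t0 : ((1 + η) * bg.u bg.s₀) ^ 2 * ((ζ 1 y - bg.s₀ * 1) ^ 2 + 4 * (120 * N * ε) ^ 2 / g) ≤
      4 * b₀ ^ 2 * (K₀ ^ 2 + 4 * (120 * N) ^ 2 / g) * ε ^ 2 := by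
    calc _ ≤ 4 * b₀ ^ 2 * ((K₀ * ε) ^ 2 + 4 * (120 * N * ε) ^ 2 / g) := by gcongr
      _ = _ := by ring
  have t1 : ((1 + η) * bg.u bg.s₀) ^ 2 *
      (4 * (bg.polarCoeff / bg.u bg.s₀ + η) ^ 2 / μ ^ 2) ≤ (1 + w) / μ ^ 2 := by
    rw [← mul_div_assoc]
    exact div_le_div_of_nonneg_right hA (sq_nonneg μ)
  have t2 : ((1 + η) * bg.u bg.s₀) ^ 2 * (4 * (C * ε) ^ 2) ≤ ε := by
    calc _ ≤ 4 * b₀ ^ 2 * (4 * (C * ε) ^ 2) := by gcongr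
      _ = ε * (ε * (16 * b₀ ^ 2 * C ^ 2)) := by ring
      _ ≤ ε * 1 := by
        refine mul_le_mul_of_nonneg_left ?_ hε.le
        linarith [hlt.2]
      _ = ε := mul_one ε
  linarith [mul_le_mul_of_nonneg_right t1 hY, mul_le_mul_of_nonneg_right t2 hZ]

theorem lemma5p2 (G : Gas) :
    ∃ bMin : ℝ, 0 < bMin ∧ ∃ CO : ℝ, 0 < CO ∧
    ∀ b₀ : ℝ, bMin ≤ b₀ →
    ∀ (K : ℕ → (Fin 3 → ℕ) → ℝ) (K₀ : ℝ), ∃ C : ℝ, 0 < C ∧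
    ∀ (bg : Background G b₀) (M : ℝ), 0 < M → ∃ ε₀ : ℝ, 0 < ε₀ ∧
    ∀ ε : ℝ, 0 < ε → ε < ε₀ →
    ∀ b : ℝ → E3 → ℝ, IsPistonSpeed b₀ ε K b →
    ∀ f : ℝ × E3 → ℝ, IsCorrector bg (pistonPath b) f →
    ∀ T : ℝ, 1 < T →
    ∀ (ζ : ℝ → E3 → ℝ) (Φ : ℝ × E3 → ℝ), IsShockSolution G (pistonPath b) T ζ Φ →
    (∀ p ∈ shockDomain (pistonPath b) ζ T, p.1 = 1 →
      |pertPotential bg f Φ p| + |pertShock bg ζ p| ≤ K₀ * ε) →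
    (∀ p ∈ shockDomain (pistonPath b) ζ T,
      |pertShock bg ζ p| + ∑ l ∈ Finset.range 2, p.1 ^ l *
        (‖iteratedFDeriv ℝ (l + 1) (pertPotential bg f Φ) p‖
          + ‖iteratedFDeriv ℝ (l + 1) (pertShock bg ζ) p‖) ≤ M * ε) →
    ∀ μ : ℝ, μ < -1 - 1 / 2 * Real.sqrt ((G.γ + 7) / 2) →
    shockIntegral ζ T (fun p => p.1 ^ (μ - 1) * pertPotential bg f Φ p ^ 2)
      ≤ C * ε ^ 2
        + 1 / μ ^ 2 * (1 + CO * (b₀ ^ (-2 / (G.γ - 1)) + b₀ ^ (-2 : ℝ)))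
          * shockIntegral ζ T (fun p => p.1 ^ (μ + 1) * dt (pertPotential bg f Φ) p ^ 2)
        + C * ε *
          (shockIntegral ζ T
              (fun p => p.1 ^ (μ + 1) * bg.shockOp (pertPotential bg f Φ) p ^ 2)
            + shockIntegral ζ T
              (fun p => p.1 ^ (μ + 1) *
                (1 / ‖p.2‖ ^ 2 * ∑ k, dZ k (pertPotential bg f Φ) p ^ 2))) := by

  have hγ := G.one_lt_γ
  have hh : 0 ≤ G.enthalpy G.ρ₀ :=
    div_nonneg (G.soundSq_pos G.ρ₀_pos).le (by linarith)
  set q := min (1 / 4) ((G.γ - 1) / 8) with hq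
  have hq0 : 0 < q := lt_min (by norm_num) (by linarith)
  -- The margin in `μ < -2 - g`; it is positive exactly because `γ > 1`.
  set g := 1 / 2 * Real.sqrt ((G.γ + 7) / 2) - 1 with hg
  have hg0 : 0 < g := by
    have : (2 : ℝ) < Real.sqrt ((G.γ + 7) / 2) := Real.lt_sqrt_of_sq_lt (by linarith)
    rw [hg]; linarith
  -- The threshold ensures `4 h(ρ₀) < q² b₀²`, hence a density ratio at most `q`. Any positive loss
  -- is attainable by shrinking `ε₀`, so the factor 1 in front of the powers of `b₀` suffices.
  refine ⟨2 * Real.sqrt (G.enthalpy G.ρ₀) / q + 1, by positivity, 1, one_pos,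
    fun b₀ hb K K₀ => ?_⟩
  have hs := Real.sqrt_nonneg (G.enthalpy G.ρ₀)
  have hb0 : 0 < b₀ := lt_of_lt_of_le (by positivity) hb
  have hlarge : 4 * G.enthalpy G.ρ₀ < q ^ 2 * b₀ ^ 2 := by
    have h1 : 2 * Real.sqrt (G.enthalpy G.ρ₀) < q * b₀ := by
      rw [← div_lt_iff₀' hq0]; linarith
    have h2 := pow_lt_pow_left₀ h1 (by positivity) two_ne_zero
    rw [mul_pow, mul_pow, Real.sq_sqrt hh] at h2
    linarith
  obtain ⟨N, hN, hpiston⟩ := exists_isPistonClose b₀ K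
  set V := (volume : Measure E3).toSphere.real univ with hV
  set E := 4 * b₀ ^ 2 * (K₀ ^ 2 + 4 * (120 * N) ^ 2 / g) with hE
  have hV0 : 0 ≤ V := measureReal_nonneg
  have hE0 : 0 ≤ E := by positivity
  -- `E` involves only `b₀`, `K₀`, `N` and `g`. The summand 1 covers the coefficient `ε` of the
  -- angular integral.
  refine ⟨V * E + 1, by positivity, fun bg M hM => ?_⟩
  have hδ := bg.densityRatio_le hq0 hb0 hlarge
  have hδ4 : bg.densityRatio ≤ 1 / 4 := hδ.trans (min_le_left _ _)
  have hsu : bg.s₀ ≤ 2 * bg.u bg.s₀ := by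
    rw [bg.u_shock]
    have := mul_le_mul_of_nonneg_left hδ4 (hb0.trans bg.b₀_lt_s₀).le
    linarith [hb0.trans bg.b₀_lt_s₀]
  have hw : 0 < b₀ ^ (-2 / (G.γ - 1)) + b₀ ^ (-2 : ℝ) := by positivity
  obtain ⟨ε₀, hε₀, hmain⟩ := bg.exists_hardy_shock hb0
    (bg.polarCoeff_mem hb0 hδ4 (hδ.trans (min_le_right _ _))) hsu hw hN hM K₀ hg0
  refine ⟨ε₀, hε₀, fun ε hε hlt b hbp f hf T hT ζ Φ hsol hinit hbound μ hμ => ?_⟩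
  have h := hmain ε hε hlt b (hpiston ε hε b hbp) f hf T hT ζ Φ hsol hinit hbound μ
    (by rw [hg]; linarith)
  have hX := shockIntegral_nonneg (ζ := ζ) (ν := μ + 1) hT
    (fun p => bg.shockOp (pertPotential bg f Φ) p ^ 2) fun p => sq_nonneg _
  have hZ := shockIntegral_nonneg (ζ := ζ) (ν := μ + 1) hT
    (fun p => 1 / ‖p.2‖ ^ 2 * ∑ k, dZ k (pertPotential bg f Φ) p ^ 2) fun p => by positivity
  refine h.trans ?_
  have hVE := mul_nonneg hV0 hE0
  have h1 : 1 / μ ^ 2 * (1 + 1 * (b₀ ^ (-2 / (G.γ - 1)) + b₀ ^ (-2 : ℝ))) =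
      (1 + (b₀ ^ (-2 / (G.γ - 1)) + b₀ ^ (-2 : ℝ))) / μ ^ 2 := by ring
  rw [h1]
  -- Since `∂_r φ̇` was eliminated through the jump relation, the integral of `𝓑₀ φ̇` is merely
  -- added as a nonnegative term.
  refine add_le_add (add_le_add (by linarith [sq_nonneg ε]) le_rfl) ?_
  refine mul_le_mul ?_ (le_add_of_nonneg_left hX) hZ (by positivity)
  exact le_mul_of_one_le_left hε.le (by linarith)
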